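/- **Theorem.** There are constants $C$ and algorithms as follows. The input of each consists of a positive integer $n$, a nondeterministic finite automaton $M=\langle Q,\Delta,q_0,F\rangle$ over the alphabet $[n]$ (with finitely many states $Q$, labelled transitions $\Delta\subseteq Q\times[n]\times Q$, one start state $q_0$ and accepting states $F$), a directed graph $G=\langle [n],E,w\rangle$ with integer edge weights, and vertices $s,t\in[n]$. Write $\mathrm{size}(M)=|Q|+|\Delta|$. A path is a sequence of vertices in which consecutive vertices are joined by an edge of $E$ (repetitions are allowed, and a single vertex is a path from itself to itself of weight $0$); its weight is the sum of the weights of its edges, with multiplicity, and it is accepted by $M$ if the word formed by its vertices, first and last included, is in $L(M)$. The algorithm returns an $(s,t)$-path in $G$ that is accepted by $M$ and has minimal weight among all such paths, or reports that no such minimum-weight path exists. 1. For arbitrary integer weights, the running time is at most $C\cdot \mathrm{size}(M)^2\cdot n^3$. 2. If all edge weights of $G$ are non-negative, there is such an algorithm with running time at most $C\cdot\mathrm{size}(M)\cdot\log_2(\mathrm{size}(M)+1)\cdot n^2$. 3. If $M$ is acyclic as a directed graph, there is such an algorithm with running time at most $C\cdot\mathrm{size}(M)\cdot n^2$. The algorithms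 run on a random access machine with addition, subtraction, sign tests and indirect addressing, and the running times above count each operation on integers as $O(1)$. If instead each operation is charged for the number of machine words of the integers that it handles, a word having as many bits as the binary expansion of the length of the input, the same algorithms satisfy the same bounds with an additional factor $\log_2(W+1)$ whenever $W\ge 1$ is an integer and all edge weights lie in $[-W,W]$. (In both measures, $\log_2$ may be rounded down to an integer.) -/

import Mathlib

/-! ### The machine model

A random access machine over the integers in structured form: finitely many named registers, an
integer-addressed memory, an output tape, addition and subtraction as the only arithmetic, indirect
reads and writes, and control flow by testing the sign of a register. -/

namespace RAM

/-- Programs. Registers are named by natural numbers. -/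
inductive Prog : Type
  /-- `reg r := z`, for a constant `z` of the program -/
  | const (r : ℕ) (z : ℤ)
  /-- `reg r := reg a + reg b` -/
  | add (r a b : ℕ)
  /-- `reg r := reg a - reg b` -/
  | sub (r a b : ℕ)
  /-- `reg r := mem[reg a]` -/
  | load (r a : ℕ)
  /-- `mem[reg a] := reg b` -/
  | store (a b : ℕ)
  /-- append `reg a` to the output tape -/
  | print (a : ℕ)
  /-- sequential composition -/
  | seq (c d : Prog)
  /-- if `reg a > 0` then `c` else `d` -/
  | cond (a : ℕ) (c d : Prog)
  /-- while `reg a > 0` do `c` -/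
  | loop (a : ℕ) (c : Prog)

/-- States of the machine: registers, memory and output tape. -/
structure State where
  reg : ℕ → ℤ
  mem : ℤ → ℤ
  out : List ℤ

/-- Initially the input occupies the memory cells `0, 1, …`; all else is `0` or empty. -/
def State.init (input : List ℤ) : State where
  reg := fun _ => 0
  mem := fun i => if 0 ≤ i then input.getD i.toNat 0 else 0
  out := []

/-- The state after `reg r := z`. -/
def State.setReg (σ : State) (r : ℕ) (z : ℤ) : State :=
  { σ with reg := Function.update σ.reg r z }

/-- The state after `mem[i] := z`. -/
def State.setMem (σ : State) (i z : ℤ) : State :=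
  { σ with mem := Function.update σ.mem i z }

/-- `Exec μ c σ σ' T`: the program `c`, started in state `σ`, terminates in state `σ'` after time
`T`. Every elementary operation and every test takes time `1`, plus `μ z` for each integer `z`
that it handles (operands, results and memory addresses). -/
inductive Exec (μ : ℤ → ℕ) : Prog → State → State → ℕ → Prop
  | const (r : ℕ) (z : ℤ) (σ : State) :
      Exec μ (.const r z) σ (σ.setReg r z) (1 + μ z)
  | add (r a b : ℕ) (σ : State) :
      Exec μ (.add r a b) σ (σ.setReg r (σ.reg a + σ.reg b))
        (1 + μ (σ.reg a) + μ (σ.reg b) + μ (σ.reg a + σ.reg b))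
  | sub (r a b : ℕ) (σ : State) :
      Exec μ (.sub r a b) σ (σ.setReg r (σ.reg a - σ.reg b))
        (1 + μ (σ.reg a) + μ (σ.reg b) + μ (σ.reg a - σ.reg b))
  | load (r a : ℕ) (σ : State) :
      Exec μ (.load r a) σ (σ.setReg r (σ.mem (σ.reg a)))
        (1 + μ (σ.reg a) + μ (σ.mem (σ.reg a)))
  | store (a b : ℕ) (σ : State) :
      Exec μ (.store a b) σ (σ.setMem (σ.reg a) (σ.reg b))
        (1 + μ (σ.reg a) + μ (σ.reg b))
  | print (a : ℕ) (σ : State) :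
      Exec μ (.print a) σ { σ with out := σ.out ++ [σ.reg a] } (1 + μ (σ.reg a))
  | seq {c d : Prog} {σ σ' σ'' : State} {T T' : ℕ} :
      Exec μ c σ σ' T → Exec μ d σ' σ'' T' → Exec μ (.seq c d) σ σ'' (T + T')
  | cond_pos {a : ℕ} {c d : Prog} {σ σ' : State} {T : ℕ} :
      0 < σ.reg a → Exec μ c σ σ' T → Exec μ (.cond a c d) σ σ' (1 + μ (σ.reg a) + T)
  | cond_neg {a : ℕ} {c d : Prog} {σ σ' : State} {T : ℕ} :
      ¬ 0 < σ.reg a → Exec μ d σ σ' T → Exec μ (.cond a c d) σ σ' (1 + μ (σ.reg a) + T)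
  | loop_stop {a : ℕ} {c : Prog} {σ : State} :
      ¬ 0 < σ.reg a → Exec μ (.loop a c) σ σ (1 + μ (σ.reg a))
  | loop_step {a : ℕ} {c : Prog} {σ σ' σ'' : State} {T T' : ℕ} :
      0 < σ.reg a → Exec μ c σ σ' T → Exec μ (.loop a c) σ' σ'' T' →
        Exec μ (.loop a c) σ σ'' (1 + μ (σ.reg a) + T + T')

/-- On this input, `c` halts after at most `B` elementary operations, having printed `output`. The
cost is the unit cost: every operation, also on long integers, takes one unit of time. -/
def ComputesInUnitTime (c : Prog) (input output : List ℤ) (B : ℕ) : Prop :=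
  ∃ σ T, Exec (fun _ => 0) c (State.init input) σ T ∧ σ.out = output ∧ T ≤ B

/-- The number of machine words of `ℓ` bits that the integer `z` occupies. -/
def words (ℓ : ℕ) (z : ℤ) : ℕ := z.natAbs.size / ℓ + 1

/-- On this input, `c` halts in time at most `B`, having printed `output`, where an operation is
charged for the number of machine words of all integers that it handles; as usual, a machine word
has just enough bits to write down the length of the input. -/
def ComputesInWordTime (c : Prog) (input output : List ℤ) (B : ℕ) : Prop :=
  ∃ σ T, Exec (words input.length.size) c (State.init input) σ T ∧ σ.out = output ∧ T ≤ B

end RAM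

/-! ### Automata -/

/-- A nondeterministic finite automaton over the alphabet `[n]`: states `0, …, numStates - 1`, one
start state, a set of accepting states and a finite set of labelled transitions `(p, a, q)`, which
is listed, in any order, without repetition. -/
structure FinNFA (n : ℕ) where
  numStates : ℕ
  start : Fin numStates
  accept : Finset (Fin numStates)
  trans : List (Fin numStates × Fin n × Fin numStates)
  nodup_trans : trans.Nodup

namespace FinNFA

variable {n : ℕ}

/-- The underlying automaton, in the sense of Mathlib. -/
def toNFA (M : FinNFA n) : NFA (Fin n) (Fin M.numStates) where
  step p a := {q | (p, a, q) ∈ M.trans}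
  start := {M.start}
  accept := M.accept

/-- The number of states plus the number of transitions. -/
def size (M : FinNFA n) : ℕ := M.numStates + M.trans.length

/-- There is a transition from `p` to `q`. -/
def Edge (M : FinNFA n) (p q : Fin M.numStates) : Prop := ∃ a, (p, a, q) ∈ M.trans

/-- The transition graph has no directed cycle (in particular no loop). -/
def IsAcyclic (M : FinNFA n) : Prop := ∀ p, ¬ Relation.TransGen M.Edge p p

end FinNFA

/-! ### Paths -/

section Paths

variable {n : ℕ}

/-- `p` is the sequence of vertices of a directed path from `s` to `t` in `G`. Vertices and edges
may be repeated; for `s = t` the path may have no edge. -/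
def IsPath (G : Digraph (Fin n)) (s t : Fin n) (p : List (Fin n)) : Prop :=
  p.IsChain G.Adj ∧ p.head? = some s ∧ p.getLast? = some t

/-- The sum of the weights of the edges of the path, with multiplicity. -/
def pathWeight (w : Fin n → Fin n → ℤ) (p : List (Fin n)) : ℤ :=
  ((p.zip p.tail).map fun e => w e.1 e.2).sum

/-- `p` is an `(s, t)`-path accepted by `M`, and of minimal weight among these. -/
def IsMinAcceptedPath (M : FinNFA n) (G : Digraph (Fin n)) (w : Fin n → Fin n → ℤ) (s t : Fin n)
    (p : List (Fin n)) : Prop :=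
  IsPath G s t p ∧ p ∈ M.toNFA.accepts ∧
    ∀ p', IsPath G s t p' → p' ∈ M.toNFA.accepts → pathWeight w p ≤ pathWeight w p'

/-- A correct output: the vertices of a minimum-weight accepted `(s, t)`-path or, if there is no
such path, nothing at all. -/
def IsAnswer (M : FinNFA n) (G : Digraph (Fin n)) (w : Fin n → Fin n → ℤ) (s t : Fin n)
    (output : List ℤ) : Prop :=
  (∃ p, IsMinAcceptedPath M G w s t p ∧ output = p.map fun v => ((v : ℕ) : ℤ)) ∨
    ((¬ ∃ p, IsMinAcceptedPath M G w s t p) ∧ output = [])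

open Classical in
/-- The input, written as a list of integers: the numbers `n`, `|Q|`, `|Δ|`, `q₀`, `s`, `t`, the
accepting states as a 0-1 vector, the list of transitions, the adjacency matrix of the graph and
its weight matrix (with `0` where there is no edge), both row by row. -/
noncomputable def encodeInput (M : FinNFA n) (G : Digraph (Fin n)) (w : Fin n → Fin n → ℤ)
    (s t : Fin n) : List ℤ :=
  [(n : ℤ), (M.numStates : ℤ), (M.trans.length : ℤ), ((M.start : ℕ) : ℤ), ((s : ℕ) : ℤ),
      ((t : ℕ) : ℤ)] ++
    (List.finRange M.numStates).map (fun q => if q ∈ M.accept then 1 else 0) ++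
    M.trans.flatMap (fun e => [((e.1 : ℕ) : ℤ), ((e.2.1 : ℕ) : ℤ), ((e.2.2 : ℕ) : ℤ)]) ++
    (List.finRange n).flatMap
      (fun u => (List.finRange n).map fun v => if G.Adj u v then 1 else 0) ++
    (List.finRange n).flatMap
      (fun u => (List.finRange n).map fun v => if G.Adj u v then w u v else 0)

/-- On the instance `(M, G, w, s, t)` the program `c` returns a correct output, within unit-cost
time `B`, and within time `B · log₂ (W + 1)` if integers are charged for their length and the edge
weights lie in `[-W, W]`. -/
def SolvesWithin (c : RAM.Prog) (M : FinNFA n) (G : Digraph (Fin n)) (w : Fin n → Fin n → ℤ)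
    (s t : Fin n) (B : ℕ) : Prop :=
  ∃ output, IsAnswer M G w s t output ∧
    RAM.ComputesInUnitTime c (encodeInput M G w s t) output B ∧
    ∀ W : ℕ, 1 ≤ W → (∀ u v, G.Adj u v → |w u v| ≤ (W : ℤ)) →
      RAM.ComputesInWordTime c (encodeInput M G w s t) output (B * Nat.log 2 (W + 1))

end Paths

/-! Pair every state q with every vertex v: the node (q, v) means that the automaton is in state q
and about to read v. An accepted (s, t)-path is a walk in this product graph from the root (q₀, s)
to a node where some transition reads t into an accepting state. A transition fixes the vertex that
is read, so only the next vertex is free, and the product has |Q|·n nodes and at most |Δ|·n edges.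
The three claims are single-target shortest path problems on it: Bellman-Ford for arbitrary weights,
Dijkstra for non-negative ones, and one sweep in reverse topological order if M is acyclic.

All three programs keep at each node a value that is either infinite or the weight of a stored
accepted path from that node (`HL.Sound`). It is at most 0 where a path may end (`Inst.Based`) and
is improved backwards along edges. Once no relaxation helps on a set of nodes that contains the root
and is closed under successors, induction along a path (`Inst.Good.le_of_fixed`) bounds the value by
the weight of every accepted path, so the stored path of the root is minimal (`HL.output_spec`). The
programs differ in how they reach such a fixed point.

Bellman-Ford works on the nodes that are reachable from the root. N passes account for all paths of
at most N + 1 vertices, where N is the number of nodes. If the root has a minimum, every reachable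
node with an accepted path has a minimal one of at most N vertices (`Inst.exists_short`), so an
improvement in one further pass proves that there is no minimum. In Dijkstra's algorithm, with a
tournament tree as priority queue, non-negative weights guarantee that final nodes are never
improved (`HL.settleStep_spec`). In the acyclic case each transition is relaxed once, when the
values of its target state are final (`HL.kahnStep_spec`).

For the cost, the programs are written in a small language whose clock counts assignments, writes
and prints. Compiled code takes a constant times (clock + 1) operations, on integers of absolute
value at most a constant times W·(A + clock), where A bounds the sizes in the input
(`HL.HExec.compile_runs`). Values of nodes obey this because a path gets one new list cell per
vertex. Hence all integers are at most W times a polynomial in the input length and occupy O(log (W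
+ 1)) machine words (`words_le`). The counts of nodes and edges beat the claimed bounds by a factor
n, which for Dijkstra absorbs log n. -/

set_option linter.unusedSimpArgs false

/-! ### A small imperative language over the random access machine

Programs with named variables, sixteen zero-initialised arrays and read-only access to the input. A
ghost clock counts assignments; the side conditions of the semantics bound the assigned values in
terms of the clock, which controls the word cost of the compiled program. -/

namespace HL

open RAM

inductive Expr : Type
  | var (x : ℕ)
  | lit (z : ℤ)
  | add (e f : Expr)
  | sub (e f : Expr)
  | get (k : Fin 16) (e : Expr)
  | inp (e : Expr)

instance : Add Expr := ⟨Expr.add⟩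
instance : Sub Expr := ⟨Expr.sub⟩
instance (k : ℕ) : OfNat Expr k := ⟨Expr.lit k⟩

prefix:max "♯" => Expr.var

inductive Cmd : Type
  | skip
  | assign (x : ℕ) (e : Expr)
  | write (k : Fin 16) (e f : Expr)
  | print (e : Expr)
  | seq (c d : Cmd)
  | cond (e : Expr) (c d : Cmd)
  | loop (e : Expr) (c : Cmd)

infix:50 " ≔ " => Cmd.assign
infixr:40 " ⨟ " => Cmd.seq

/-- States: variables, arrays, output and a ghost clock. -/
structure St where
  vars : ℕ → ℤ
  arr : Fin 16 → ℤ → ℤ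
  out : List ℤ
  clock : ℕ

/-- The input, and the parameters of the bound on the values. -/
structure Ctx where
  inp : ℤ → ℤ
  A : ℕ
  W : ℕ

/-- The bound on all values at a given time. -/
def Ctx.bd (C : Ctx) (τ : ℕ) : ℤ := C.W * (C.A + τ)

def St.setVar (σ : St) (x : ℕ) (z : ℤ) : St :=
  { σ with vars := Function.update σ.vars x z, clock := σ.clock + 1 }

def St.setArr (σ : St) (k : Fin 16) (i z : ℤ) : St :=
  { σ with arr := Function.update σ.arr k (Function.update (σ.arr k) i z), clock := σ.clock + 1 }

def St.emit (σ : St) (z : ℤ) : St :=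
  { σ with out := σ.out ++ [z], clock := σ.clock + 1 }

namespace Expr

@[simp] def eval (C : Ctx) (σ : St) : Expr → ℤ
  | var x => σ.vars x
  | lit z => z
  | add e f => e.eval C σ + f.eval C σ
  | sub e f => e.eval C σ - f.eval C σ
  | get k e => σ.arr k (e.eval C σ)
  | inp e => C.inp (e.eval C σ)

/-- All addresses are nonnegative. -/
@[simp] def ok (C : Ctx) (σ : St) : Expr → Prop
  | var _ => True
  | lit _ => True
  | add e f => e.ok C σ ∧ f.ok C σ
  | sub e f => e.ok C σ ∧ f.ok C σ
  | get _ e => e.ok C σ ∧ 0 ≤ e.eval C σ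
  | inp e => e.ok C σ ∧ 0 ≤ e.eval C σ

@[simp] theorem eval_add (C : Ctx) (σ : St) (e f : Expr) :
    (e + f).eval C σ = e.eval C σ + f.eval C σ := rfl
@[simp] theorem eval_sub (C : Ctx) (σ : St) (e f : Expr) :
    (e - f).eval C σ = e.eval C σ - f.eval C σ := rfl
@[simp] theorem eval_ofNat (C : Ctx) (σ : St) (k : ℕ) [k.AtLeastTwo] :
    (OfNat.ofNat k : Expr).eval C σ = (OfNat.ofNat k : ℤ) := rfl
@[simp] theorem eval_zero (C : Ctx) (σ : St) : (0 : Expr).eval C σ = 0 := rfl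
@[simp] theorem eval_one (C : Ctx) (σ : St) : (1 : Expr).eval C σ = 1 := rfl
@[simp] theorem ok_add (C : Ctx) (σ : St) (e f : Expr) :
    (e + f).ok C σ ↔ e.ok C σ ∧ f.ok C σ := Iff.rfl
@[simp] theorem ok_sub (C : Ctx) (σ : St) (e f : Expr) :
    (e - f).ok C σ ↔ e.ok C σ ∧ f.ok C σ := Iff.rfl
@[simp] theorem ok_ofNat (C : Ctx) (σ : St) (k : ℕ) : (OfNat.ofNat k : Expr).ok C σ := trivial

/-- Every value that occurs in the evaluation is at most `wt` times the bound on the state. -/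
def wt : Expr → ℕ
  | var _ => 1
  | lit z => z.natAbs + 1
  | add e f => e.wt + f.wt
  | sub e f => e.wt + f.wt
  | get _ e => 16 * e.wt + 34
  | inp e => e.wt + 1

/-- The 7 for `get` consists of six operations for the address and one load. -/
def cost : Expr → ℕ
  | var _ => 2
  | lit _ => 1
  | add e f => e.cost + f.cost + 1
  | sub e f => e.cost + f.cost + 1
  | get _ e => e.cost + 7
  | inp e => e.cost + 1

/-- `reg (2j+1) := -1 - k - 16 * reg (2j+1)` -/
def addrCode (k : Fin 16) (j : ℕ) : Prog :=
  .seq (.add (2*j+1) (2*j+1) (2*j+1)) <| .seq (.add (2*j+1) (2*j+1) (2*j+1)) <|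
  .seq (.add (2*j+1) (2*j+1) (2*j+1)) <| .seq (.add (2*j+1) (2*j+1) (2*j+1)) <|
  .seq (.const (2*j+3) (-1 - (k : ℕ))) (.sub (2*j+1) (2*j+3) (2*j+1))

/-- Variables live in even registers; `e` is evaluated into register `2j+1`. -/
def compile : Expr → ℕ → Prog
  | var x, j => .seq (.const (2*j+1) 0) (.add (2*j+1) (2*j+1) (2*x))
  | lit z, j => .const (2*j+1) z
  | add e f, j => .seq (e.compile j) (.seq (f.compile (j+1)) (.add (2*j+1) (2*j+1) (2*j+3)))
  | sub e f, j => .seq (e.compile j) (.seq (f.compile (j+1)) (.sub (2*j+1) (2*j+1) (2*j+3)))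
  | get k e, j => .seq (e.compile j) (.seq (addrCode k j) (.load (2*j+1) (2*j+1)))
  | inp e, j => .seq (e.compile j) (.load (2*j+1) (2*j+1))

end Expr

/-- The size bounds on stored values are side conditions of the semantics, so a verified program
handles only short integers. The body of a loop has to advance the clock; this is what lets the
clock pay for tests and other untimed work. -/
inductive HExec (C : Ctx) : Cmd → St → St → Prop
  | skip (σ : St) : HExec C .skip σ σ
  | assign {x : ℕ} {e : Expr} {σ : St} : e.ok C σ → |e.eval C σ| ≤ C.bd σ.clock →
      HExec C (.assign x e) σ (σ.setVar x (e.eval C σ))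
  | write {k : Fin 16} {e f : Expr} {σ : St} : e.ok C σ → f.ok C σ → 0 ≤ e.eval C σ →
      |f.eval C σ| ≤ C.bd σ.clock →
      HExec C (.write k e f) σ (σ.setArr k (e.eval C σ) (f.eval C σ))
  | print {e : Expr} {σ : St} : e.ok C σ → HExec C (.print e) σ (σ.emit (e.eval C σ))
  | seq {c d : Cmd} {σ σ' σ'' : St} : HExec C c σ σ' → HExec C d σ' σ'' →
      HExec C (.seq c d) σ σ''
  | cond_pos {e : Expr} {c d : Cmd} {σ σ' : St} : e.ok C σ → 0 < e.eval C σ → HExec C c σ σ' →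
      HExec C (.cond e c d) σ σ'
  | cond_neg {e : Expr} {c d : Cmd} {σ σ' : St} : e.ok C σ → ¬ 0 < e.eval C σ → HExec C d σ σ' →
      HExec C (.cond e c d) σ σ'
  | loop_done {e : Expr} {c : Cmd} {σ : St} : e.ok C σ → ¬ 0 < e.eval C σ →
      HExec C (.loop e c) σ σ
  | loop_step {e : Expr} {c : Cmd} {σ σ' σ'' : St} : e.ok C σ → 0 < e.eval C σ →
      HExec C c σ σ' → σ.clock < σ'.clock → HExec C (.loop e c) σ' σ'' →
      HExec C (.loop e c) σ σ''

namespace Cmd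

/-- The machine tests a register, not an expression: a loop evaluates its test into register 1 once
before and again at the end of each round. Assignment copies register 1 by adding a zero from
register 3. In a write the address waits in register 1 while the value is evaluated into register 3.
-/
def compile : Cmd → Prog
  | skip => .const 1 0
  | assign x e => .seq (e.compile 0) (.seq (.const 3 0) (.add (2*x) 1 3))
  | write k e f => .seq (e.compile 0) (.seq (Expr.addrCode k 0) (.seq (f.compile 1) (.store 1 3)))
  | print e => .seq (e.compile 0) (.print 1)
  | seq c d => .seq c.compile d.compile
  | cond e c d => .seq (e.compile 0) (.cond 1 c.compile d.compile)
  | loop e c => .seq (e.compile 0) (.loop 1 (.seq c.compile (e.compile 0)))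

def wt : Cmd → ℕ
  | skip => 1
  | assign _ e => e.wt + 1
  | write _ e f => 16 * e.wt + 34 + f.wt
  | print e => e.wt
  | seq c d => c.wt + d.wt
  | cond e c d => e.wt + c.wt + d.wt
  | loop e c => e.wt + c.wt

/-- If `c` advances the clock by δ, its code takes at most `c.cost * (δ + 1)` operations. In a round
of a loop δ ≥ 1, hence δ + 1 ≤ 2δ; this is the factor 2 on the body of a loop. -/
def cost : Cmd → ℕ
  | skip => 1
  | assign _ e => e.cost + 2
  | write _ e f => e.cost + f.cost + 7
  | print e => e.cost + 1
  | seq c d => 2 * (c.cost + d.cost)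
  | cond e c d => e.cost + 1 + c.cost + d.cost
  | loop e c => e.cost + 1 + 2 * c.cost

end Cmd

/-! ### Correctness of the compilation -/

/-- `c` runs from `ρ` to `ρ'` in `T` operations, on integers of absolute value at most `B`. -/
def Runs (B : ℤ) (c : Prog) (ρ ρ' : State) (T : ℕ) : Prop :=
  ∀ (μ : ℤ → ℕ) (m : ℕ), (∀ z, |z| ≤ B → μ z ≤ m) → ∃ T', Exec μ c ρ ρ' T' ∧ T' ≤ T * (1 + 3 * m)

namespace Runs

variable {B : ℤ} {c d : Prog} {ρ ρ' ρ'' : State} {T T' : ℕ}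

theorem weaken (h : Runs B c ρ ρ' T) (hT : T ≤ T') : Runs B c ρ ρ' T' := by
  intro μ m hμ
  obtain ⟨t, h1, h2⟩ := h μ m hμ
  exact ⟨t, h1, h2.trans (Nat.mul_le_mul_right _ hT)⟩

theorem seq (h : Runs B c ρ ρ' T) (h' : Runs B d ρ' ρ'' T') :
    Runs B (.seq c d) ρ ρ'' (T + T') := by
  intro μ m hμ
  obtain ⟨t, h1, h2⟩ := h μ m hμ
  obtain ⟨t', h1', h2'⟩ := h' μ m hμ
  exact ⟨_, .seq h1 h1', by rw [add_mul]; omega⟩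

theorem const (r : ℕ) {z : ℤ} (hz : |z| ≤ B) : Runs B (.const r z) ρ (ρ.setReg r z) 1 := by
  intro μ m hμ
  exact ⟨_, .const r z ρ, by have := hμ _ hz; omega⟩

/-- An operation handles at most three integers, and addition attains this number; hence the 3 in
`Runs`. -/
theorem add (r : ℕ) {a b : ℕ} (ha : |ρ.reg a| ≤ B) (hb : |ρ.reg b| ≤ B)
    (hab : |ρ.reg a + ρ.reg b| ≤ B) :
    Runs B (.add r a b) ρ (ρ.setReg r (ρ.reg a + ρ.reg b)) 1 := by
  intro μ m hμ
  exact ⟨_, .add r a b ρ, by have := hμ _ ha; have := hμ _ hb; have := hμ _ hab; omega⟩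

theorem sub (r : ℕ) {a b : ℕ} (ha : |ρ.reg a| ≤ B) (hb : |ρ.reg b| ≤ B)
    (hab : |ρ.reg a - ρ.reg b| ≤ B) :
    Runs B (.sub r a b) ρ (ρ.setReg r (ρ.reg a - ρ.reg b)) 1 := by
  intro μ m hμ
  exact ⟨_, .sub r a b ρ, by have := hμ _ ha; have := hμ _ hb; have := hμ _ hab; omega⟩

theorem load (r : ℕ) {a : ℕ} (ha : |ρ.reg a| ≤ B) (hm : |ρ.mem (ρ.reg a)| ≤ B) :
    Runs B (.load r a) ρ (ρ.setReg r (ρ.mem (ρ.reg a))) 1 := by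
  intro μ m hμ
  exact ⟨_, .load r a ρ, by have := hμ _ ha; have := hμ _ hm; omega⟩

theorem store {a b : ℕ} (ha : |ρ.reg a| ≤ B) (hb : |ρ.reg b| ≤ B) :
    Runs B (.store a b) ρ (ρ.setMem (ρ.reg a) (ρ.reg b)) 1 := by
  intro μ m hμ
  exact ⟨_, .store a b ρ, by have := hμ _ ha; have := hμ _ hb; omega⟩

theorem print {a : ℕ} (ha : |ρ.reg a| ≤ B) :
    Runs B (.print a) ρ { ρ with out := ρ.out ++ [ρ.reg a] } 1 := by
  intro μ m hμ
  exact ⟨_, .print a ρ, by have := hμ _ ha; omega⟩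

theorem cond_pos {a : ℕ} (ha : |ρ.reg a| ≤ B) (h0 : 0 < ρ.reg a) (h : Runs B c ρ ρ' T) :
    Runs B (.cond a c d) ρ ρ' (1 + T) := by
  intro μ m hμ
  obtain ⟨t, h1, h2⟩ := h μ m hμ
  exact ⟨_, .cond_pos h0 h1, by have := hμ _ ha; rw [add_mul]; omega⟩

theorem cond_neg {a : ℕ} (ha : |ρ.reg a| ≤ B) (h0 : ¬ 0 < ρ.reg a) (h : Runs B d ρ ρ' T) :
    Runs B (.cond a c d) ρ ρ' (1 + T) := by
  intro μ m hμ
  obtain ⟨t, h1, h2⟩ := h μ m hμ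
  exact ⟨_, .cond_neg h0 h1, by have := hμ _ ha; rw [add_mul]; omega⟩

theorem loop_done {a : ℕ} (ha : |ρ.reg a| ≤ B) (h0 : ¬ 0 < ρ.reg a) :
    Runs B (.loop a c) ρ ρ 1 := by
  intro μ m hμ
  exact ⟨_, Exec.loop_stop h0, by have := hμ _ ha; omega⟩

/-- The second evaluation of the test, followed by the loop, is again the compiled loop. The
hypothesis on the remaining rounds therefore has the form of the induction hypothesis in
`HExec.compile_runs`. -/
theorem loop_step {a : ℕ} {ρ₁ : State} {T₁ : ℕ} (ha : |ρ.reg a| ≤ B) (h0 : 0 < ρ.reg a)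
    (h : Runs B c ρ ρ₁ T₁) (h' : Runs B (.seq d (.loop a (.seq c d))) ρ₁ ρ'' T') :
    Runs B (.loop a (.seq c d)) ρ ρ'' (1 + T₁ + T') := by
  intro μ m hμ
  obtain ⟨t, h1, h2⟩ := h μ m hμ
  obtain ⟨t', h1', h2'⟩ := h' μ m hμ
  cases h1' with
  | seq k1 k2 =>
    refine ⟨_, .loop_step h0 (.seq h1 k1) k2, ?_⟩
    have := hμ _ ha
    rw [add_mul, add_mul]
    omega

end Runs

/-- The RAM state `ρ` represents `σ`. -/
structure Rel (C : Ctx) (σ : St) (ρ : State) : Prop where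
  var : ∀ x, ρ.reg (2 * x) = σ.vars x
  inp : ∀ i, 0 ≤ i → ρ.mem i = C.inp i
  arr : ∀ (k : Fin 16) (i : ℤ), 0 ≤ i → ρ.mem (-1 - (k : ℕ) - 16 * i) = σ.arr k i
  out : ρ.out = σ.out

/-- All values in the state are bounded by `K`. -/
structure Bounded (C : Ctx) (σ : St) (K : ℤ) : Prop where
  one : 1 ≤ K
  var : ∀ x, |σ.vars x| ≤ K
  inp : ∀ i, 0 ≤ i → |C.inp i| ≤ K
  arr : ∀ (k : Fin 16) (i : ℤ), |σ.arr k i| ≤ K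

theorem Bounded.mono {C : Ctx} {σ : St} {K K' : ℤ} (h : Bounded C σ K) (hK : K ≤ K') :
    Bounded C σ K' :=
  ⟨h.one.trans hK, fun x => (h.var x).trans hK, fun i hi => (h.inp i hi).trans hK,
    fun k i => (h.arr k i).trans hK⟩

/-- `ρ'` differs from `ρ` at most in the scratch registers from `2j+1` on. -/
structure Scratch (j : ℕ) (ρ ρ' : State) : Prop where
  mem : ρ'.mem = ρ.mem
  out : ρ'.out = ρ.out
  low : ∀ r, r < 2 * j + 1 → ρ'.reg r = ρ.reg r
  even : ∀ x, ρ'.reg (2 * x) = ρ.reg (2 * x)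

theorem Scratch.trans {j : ℕ} {ρ ρ' ρ'' : State} (h : Scratch j ρ ρ') (h' : Scratch j ρ' ρ'') :
    Scratch j ρ ρ'' :=
  ⟨h'.mem.trans h.mem, h'.out.trans h.out, fun r hr => (h'.low r hr).trans (h.low r hr),
    fun x => (h'.even x).trans (h.even x)⟩

theorem Scratch.anti {j j' : ℕ} {ρ ρ' : State} (h : Scratch j' ρ ρ') (hj : j ≤ j') :
    Scratch j ρ ρ' :=
  ⟨h.mem, h.out, fun r hr => h.low r (by omega), h.even⟩

theorem Scratch.set (j i : ℕ) (hi : j ≤ i) (ρ : State) (z : ℤ) :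
    Scratch j ρ (ρ.setReg (2 * i + 1) z) := by
  refine ⟨rfl, rfl, fun r hr => ?_, fun x => ?_⟩ <;> simp only [State.setReg] <;>
    exact Function.update_of_ne (by omega) _ _

theorem Scratch.rel {C : Ctx} {σ : St} {j : ℕ} {ρ ρ' : State} (h : Scratch j ρ ρ')
    (hr : Rel C σ ρ) : Rel C σ ρ' :=
  ⟨fun x => (h.even x).trans (hr.var x), fun i hi => by rw [h.mem]; exact hr.inp i hi,
    fun k i hi => by rw [h.mem]; exact hr.arr k i hi, h.out.trans hr.out⟩

@[simp] theorem setReg_reg_self (ρ : State) (r : ℕ) (z : ℤ) : (ρ.setReg r z).reg r = z := by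
  simp [State.setReg]

theorem setReg_reg_of_ne (ρ : State) {r r' : ℕ} (z : ℤ) (h : r' ≠ r) :
    (ρ.setReg r z).reg r' = ρ.reg r' := by
  simp [State.setReg, h]

theorem addrCode_runs (k : Fin 16) (j : ℕ) (ρ : State) {a K B : ℤ} (hK : 1 ≤ K)
    (ha : |a| ≤ K) (hB : 16 * K + 34 ≤ B) (hj : ρ.reg (2 * j + 1) = a) :
    ∃ ρ', Runs B (Expr.addrCode k j) ρ ρ' 6 ∧ Scratch j ρ ρ' ∧
      ρ'.reg (2 * j + 1) = -1 - (k : ℕ) - 16 * a := by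
  have hk : (k : ℕ) < 16 := k.2
  rw [abs_le] at ha
  have dbl : ∀ (ρ : State) (z : ℤ), ρ.reg (2 * j + 1) = z → |z| ≤ 8 * K →
      ∃ ρ', Runs B (.add (2*j+1) (2*j+1) (2*j+1)) ρ ρ' 1 ∧ Scratch j ρ ρ' ∧
        ρ'.reg (2 * j + 1) = 2 * z := by
    intro ρ z hz hb
    rw [abs_le] at hb
    refine ⟨_, Runs.add _ ?_ ?_ ?_, Scratch.set j j le_rfl _ _, ?_⟩
    any_goals rw [hz, abs_le]; omega
    rw [setReg_reg_self, hz, two_mul]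
  obtain ⟨ρ₁, r1, s1, v1⟩ := dbl ρ a hj (by rw [abs_le]; omega)
  obtain ⟨ρ₂, r2, s2, v2⟩ := dbl ρ₁ _ v1 (by rw [abs_le]; omega)
  obtain ⟨ρ₃, r3, s3, v3⟩ := dbl ρ₂ _ v2 (by rw [abs_le]; omega)
  obtain ⟨ρ₄, r4, s4, v4⟩ := dbl ρ₃ _ v3 (by rw [abs_le]; omega)
  have h5 := Runs.const (B := B) (ρ := ρ₄) (2 * j + 3) (z := -1 - (k : ℕ))
    (by rw [abs_le]; omega)
  have v5 : (ρ₄.setReg (2 * j + 3) (-1 - (k : ℕ))).reg (2 * j + 1) = 16 * a := by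
    rw [setReg_reg_of_ne _ _ (by omega), v4]; ring
  have h6 := Runs.sub (B := B) (ρ := ρ₄.setReg (2 * j + 3) (-1 - (k : ℕ)))
    (2 * j + 1) (a := 2 * j + 3) (b := 2 * j + 1)
    (by rw [setReg_reg_self, abs_le]; omega) (by rw [v5, abs_le]; omega)
    (by rw [v5, setReg_reg_self, abs_le]; omega)
  refine ⟨_, r1.seq (r2.seq (r3.seq (r4.seq (h5.seq h6)))), ?_, ?_⟩
  · exact ((((s1.trans s2).trans s3).trans s4).trans
      (Scratch.set j (j + 1) (by omega) _ _)).trans (Scratch.set j j le_rfl _ _)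
  · rw [setReg_reg_self, setReg_reg_self, v5]

theorem Expr.wt_pos (e : Expr) : 1 ≤ e.wt := by
  induction e <;> simp only [Expr.wt] <;> omega

theorem Expr.abs_eval_le {C : Ctx} {σ : St} {K : ℤ} (hb : Bounded C σ K) (e : Expr)
    (hok : e.ok C σ) : |e.eval C σ| ≤ e.wt * K := by
  have h1 := hb.one
  induction e with
  | var x => simpa [wt] using hb.var x
  | lit z =>
    simp only [eval, wt]
    push_cast
    nlinarith [abs_nonneg z]
  | add e f ihe ihf =>
    simp only [wt, eval]
    push_cast
    have := ihe hok.1; have := ihf hok.2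
    have := abs_add_le (e.eval C σ) (f.eval C σ)
    nlinarith
  | sub e f ihe ihf =>
    simp only [wt, eval]
    push_cast
    have := ihe hok.1; have := ihf hok.2
    have := abs_sub (e.eval C σ) (f.eval C σ)
    nlinarith
  | get k e ih =>
    simp only [wt, eval]
    push_cast
    have := hb.arr k (e.eval C σ)
    have : (0 : ℤ) ≤ e.wt * K := by positivity
    nlinarith
  | inp e ih =>
    simp only [wt, eval]
    push_cast
    have := hb.inp _ hok.2
    have : (0 : ℤ) ≤ e.wt * K := by positivity
    nlinarith

/-- A second operand is evaluated at level `j + 1`, whose scratch registers start at `2j+3`, so it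
preserves the first operand in register `2j+1`. -/
theorem Expr.compile_runs {C : Ctx} {σ : St} {K B : ℤ} (hb : Bounded C σ K) (e : Expr) :
    ∀ (j : ℕ) (ρ : State), Rel C σ ρ → e.ok C σ → e.wt * K ≤ B →
    ∃ ρ', Runs B (e.compile j) ρ ρ' e.cost ∧ Scratch j ρ ρ' ∧
      ρ'.reg (2 * j + 1) = e.eval C σ := by
  have hK := hb.one
  induction e with
  | var x =>
    intro j ρ hr hok hB
    simp only [wt, Nat.cast_one, one_mul] at hB
    have h1 := Runs.const (B := B) (ρ := ρ) (2 * j + 1) (z := 0) (by rw [abs_zero]; omega)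
    have hx : (ρ.setReg (2 * j + 1) 0).reg (2 * x) = σ.vars x := by
      rw [setReg_reg_of_ne _ _ (by omega), hr.var]
    have hv := (hb.var x).trans hB
    have h2 := Runs.add (B := B) (ρ := ρ.setReg (2 * j + 1) 0) (2 * j + 1) (a := 2 * j + 1)
      (b := 2 * x) (by rw [setReg_reg_self, abs_zero]; omega) (by rwa [hx])
      (by rw [hx, setReg_reg_self, zero_add]; exact hv)
    refine ⟨_, h1.seq h2, (Scratch.set j j le_rfl _ _).trans (Scratch.set j j le_rfl _ _), ?_⟩
    rw [setReg_reg_self, setReg_reg_self, hx, zero_add]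
    rfl
  | lit z =>
    intro j ρ hr hok hB
    have := Expr.abs_eval_le hb (lit z) hok
    exact ⟨_, Runs.const (2 * j + 1) (this.trans hB), Scratch.set j j le_rfl _ _,
      setReg_reg_self _ _ _⟩
  | add e f ihe ihf =>
    intro j ρ hr hok hB
    have hB' : e.wt * K + f.wt * K ≤ B := by simpa [wt, add_mul] using hB
    have he : (0 : ℤ) ≤ e.wt * K := by positivity
    have hf : (0 : ℤ) ≤ f.wt * K := by positivity
    obtain ⟨ρ₁, r1, s1, v1⟩ := ihe j ρ hr hok.1 (by omega)
    obtain ⟨ρ₂, r2, s2, v2⟩ := ihf (j + 1) ρ₁ (s1.rel hr) hok.2 (by omega)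
    have v2' : ρ₂.reg (2 * j + 3) = f.eval C σ := v2
    have v1' : ρ₂.reg (2 * j + 1) = e.eval C σ := by rw [s2.low _ (by omega), v1]
    have b1 := Expr.abs_eval_le hb e hok.1
    have b2 := Expr.abs_eval_le hb f hok.2
    have h3 := Runs.add (B := B) (ρ := ρ₂) (2 * j + 1) (a := 2 * j + 1) (b := 2 * j + 3)
      (by rw [v1']; omega) (by rw [v2']; omega)
      (by rw [v1', v2']; exact (abs_add_le _ _).trans (by omega))
    refine ⟨_, (r1.seq (r2.seq h3)).weaken (by simp only [cost]; omega),
      s1.trans ((s2.anti (by omega)).trans (Scratch.set j j le_rfl _ _)), ?_⟩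
    rw [setReg_reg_self, v1', v2']
    rfl
  | sub e f ihe ihf =>
    intro j ρ hr hok hB
    have hB' : e.wt * K + f.wt * K ≤ B := by simpa [wt, add_mul] using hB
    have he : (0 : ℤ) ≤ e.wt * K := by positivity
    have hf : (0 : ℤ) ≤ f.wt * K := by positivity
    obtain ⟨ρ₁, r1, s1, v1⟩ := ihe j ρ hr hok.1 (by omega)
    obtain ⟨ρ₂, r2, s2, v2⟩ := ihf (j + 1) ρ₁ (s1.rel hr) hok.2 (by omega)
    have v2' : ρ₂.reg (2 * j + 3) = f.eval C σ := v2
    have v1' : ρ₂.reg (2 * j + 1) = e.eval C σ := by rw [s2.low _ (by omega), v1]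
    have b1 := Expr.abs_eval_le hb e hok.1
    have b2 := Expr.abs_eval_le hb f hok.2
    have h3 := Runs.sub (B := B) (ρ := ρ₂) (2 * j + 1) (a := 2 * j + 1) (b := 2 * j + 3)
      (by rw [v1']; omega) (by rw [v2']; omega)
      (by rw [v1', v2']; exact (abs_sub _ _).trans (by omega))
    refine ⟨_, (r1.seq (r2.seq h3)).weaken (by simp only [cost]; omega),
      s1.trans ((s2.anti (by omega)).trans (Scratch.set j j le_rfl _ _)), ?_⟩
    rw [setReg_reg_self, v1', v2']
    rfl
  | get k e ih =>
    intro j ρ hr hok hB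
    simp only [wt] at hB
    push_cast at hB
    have hw : K ≤ e.wt * K := by
      have := e.wt_pos
      nlinarith
    have hB' : 16 * (e.wt * K) + 34 ≤ B := by nlinarith
    obtain ⟨ρ₁, r1, s1, v1⟩ := ih j ρ hr hok.1 (by omega)
    obtain ⟨ρ₂, r2, s2, v2⟩ := addrCode_runs k j ρ₁ (hK.trans hw)
      (Expr.abs_eval_le hb e hok.1) hB' v1
    have b1 := Expr.abs_eval_le hb e hok.1
    rw [abs_le] at b1
    have hm : ρ₂.mem (ρ₂.reg (2 * j + 1)) = σ.arr k (e.eval C σ) := by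
      rw [v2]
      exact ((s1.trans s2).rel hr).arr k _ hok.2
    have h3 := Runs.load (B := B) (ρ := ρ₂) (2 * j + 1) (a := 2 * j + 1)
      (by rw [v2, abs_le]; have := k.2; omega)
      (by rw [hm]; have := hb.arr k (e.eval C σ); omega)
    refine ⟨_, (r1.seq (r2.seq h3)).weaken (by simp only [cost]; omega),
      s1.trans (s2.trans (Scratch.set j j le_rfl _ _)), ?_⟩
    rw [setReg_reg_self, hm]
    rfl
  | inp e ih =>
    intro j ρ hr hok hB
    simp only [wt] at hB
    push_cast at hB
    have hw : (0 : ℤ) ≤ e.wt * K := by positivity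
    have hB' : e.wt * K + K ≤ B := by nlinarith
    obtain ⟨ρ₁, r1, s1, v1⟩ := ih j ρ hr hok.1 (by omega)
    have b1 := Expr.abs_eval_le hb e hok.1
    have hm : ρ₁.mem (ρ₁.reg (2 * j + 1)) = C.inp (e.eval C σ) := by
      rw [v1]
      exact (s1.rel hr).inp _ hok.2
    have h3 := Runs.load (B := B) (ρ := ρ₁) (2 * j + 1) (a := 2 * j + 1)
      (by rw [v1]; omega) (by rw [hm]; have := hb.inp _ hok.2; omega)
    refine ⟨_, (r1.seq h3).weaken (by simp only [cost]; omega),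
      s1.trans (Scratch.set j j le_rfl _ _), ?_⟩
    rw [setReg_reg_self, hm]
    rfl

theorem Ctx.bd_mono (C : Ctx) {τ τ' : ℕ} (h : τ ≤ τ') : C.bd τ ≤ C.bd τ' := by
  unfold Ctx.bd
  have : (τ : ℤ) ≤ τ' := by exact_mod_cast h
  gcongr

theorem Bounded.setVar {C : Ctx} {σ : St} {K : ℤ} (h : Bounded C σ K) (x : ℕ) {z : ℤ}
    (hz : |z| ≤ K) : Bounded C (σ.setVar x z) K := by
  refine ⟨h.one, fun y => ?_, h.inp, h.arr⟩
  by_cases hy : y = x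
  · subst hy; simpa [St.setVar] using hz
  · simpa [St.setVar, hy] using h.var y

theorem Bounded.setArr {C : Ctx} {σ : St} {K : ℤ} (h : Bounded C σ K) (k : Fin 16) (i : ℤ) {z : ℤ}
    (hz : |z| ≤ K) : Bounded C (σ.setArr k i z) K := by
  refine ⟨h.one, h.var, h.inp, fun k' i' => ?_⟩
  by_cases hk : k' = k
  · subst hk
    by_cases hi : i' = i
    · subst hi; simpa [St.setArr] using hz
    · simpa [St.setArr, hi] using h.arr k' i'
  · simpa [St.setArr, hk] using h.arr k' i'

theorem HExec.clock_le {C : Ctx} {c : Cmd} {σ σ' : St} (h : HExec C c σ σ') :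
    σ.clock ≤ σ'.clock := by
  induction h with
  | skip σ => exact le_rfl
  | assign => exact Nat.le_succ _
  | write => exact Nat.le_succ _
  | print => exact Nat.le_succ _
  | seq _ _ ih1 ih2 => exact ih1.trans ih2
  | cond_pos _ _ _ ih => exact ih
  | cond_neg _ _ _ ih => exact ih
  | loop_done => exact le_rfl
  | loop_step _ _ _ _ _ ih1 ih2 => exact ih1.trans ih2

/-- Only assignments and writes store values; their side conditions give the bound, which grows with
the clock. -/
theorem HExec.bounded {C : Ctx} {c : Cmd} {σ σ' : St} (h : HExec C c σ σ')
    (hb : Bounded C σ (C.bd σ.clock)) : Bounded C σ' (C.bd σ'.clock) := by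
  induction h with
  | skip σ => exact hb
  | assign _ hz => exact (hb.setVar _ hz).mono (C.bd_mono (Nat.le_succ _))
  | write _ _ _ hz => exact (hb.setArr _ _ hz).mono (C.bd_mono (Nat.le_succ _))
  | @print _ σ _ =>
    have h := hb.mono (C.bd_mono (Nat.le_succ _))
    exact ⟨h.one, h.var, h.inp, h.arr⟩
  | seq _ _ ih1 ih2 => exact ih2 (ih1 hb)
  | cond_pos _ _ _ ih => exact ih hb
  | cond_neg _ _ _ ih => exact ih hb
  | loop_done => exact hb
  | loop_step _ _ _ _ _ ih1 ih2 => exact ih2 (ih1 hb)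

/-- The bound `B` refers to the final clock and therefore covers all earlier moments. The constant
`c.cost` is independent of the number of rounds of loops because the clock increments of the rounds
add up. -/
theorem HExec.compile_runs {C : Ctx} {c : Cmd} {σ σ' : St} (h : HExec C c σ σ') {B : ℤ} :
    ∀ ρ, Rel C σ ρ → Bounded C σ (C.bd σ.clock) → c.wt * C.bd σ'.clock ≤ B →
      ∃ ρ', Rel C σ' ρ' ∧ Runs B c.compile ρ ρ' (c.cost * (σ'.clock - σ.clock + 1)) := by
  induction h with
  | skip σ =>
    intro ρ hr hb hB
    refine ⟨_, (Scratch.set 0 0 le_rfl ρ 0).rel hr, ?_⟩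
    have := hb.one
    simp only [Cmd.wt, Cmd.cost] at hB ⊢
    refine (Runs.const 1 ?_).weaken (by omega)
    rw [abs_zero]; omega
  | @assign x e σ hok hz =>
    intro ρ hr hb hB
    have hb' : Bounded C σ (C.bd (σ.clock + 1)) := hb.mono (C.bd_mono (Nat.le_succ _))
    have h1 := hb'.one
    simp only [Cmd.wt, Nat.cast_add, Nat.cast_one, add_mul, one_mul] at hB
    change _ + C.bd (σ.clock + 1) ≤ B at hB
    change e.wt * C.bd (σ.clock + 1) + _ ≤ B at hB
    have he := Expr.abs_eval_le hb' e hok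
    have he0 := abs_nonneg (e.eval C σ)
    obtain ⟨ρ₁, r1, s1, v1⟩ := e.compile_runs hb' 0 ρ hr hok (B := B) (by omega)
    have v2 : (ρ₁.setReg 3 0).reg 1 = e.eval C σ := by
      rw [setReg_reg_of_ne _ _ (by omega)]; exact v1
    have h3 := Runs.add (B := B) (ρ := ρ₁.setReg 3 0) (2 * x) (a := 1) (b := 3)
      (by rw [v2]; omega) (by rw [setReg_reg_self, abs_zero]; omega)
      (by rw [v2, setReg_reg_self, add_zero]; omega)
    rw [v2, setReg_reg_self, add_zero] at h3
    refine ⟨(ρ₁.setReg 3 0).setReg (2 * x) (e.eval C σ),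
      ⟨fun y => ?_, (s1.rel hr).inp, (s1.rel hr).arr, (s1.rel hr).out⟩,
      (r1.seq ((Runs.const 3 ?_).seq h3)).weaken ?_⟩
    · by_cases hy : y = x
      · subst hy; simp [St.setVar]
      · rw [setReg_reg_of_ne _ _ (by omega), setReg_reg_of_ne _ _ (by omega), s1.even, hr.var]
        simp [St.setVar, hy]
    · rw [abs_zero]; omega
    · simp only [Cmd.cost]
      exact Nat.le_mul_of_pos_right _ (Nat.succ_pos _)
  | @write k e f σ hok hok' h0 hz =>
    intro ρ hr hb hB
    have hb' : Bounded C σ (C.bd (σ.clock + 1)) := hb.mono (C.bd_mono (Nat.le_succ _))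
    have h1 := hb'.one
    simp only [Cmd.wt] at hB
    push_cast at hB
    change _ * C.bd (σ.clock + 1) ≤ B at hB
    have he := Expr.abs_eval_le hb' e hok
    have hf := Expr.abs_eval_le hb' f hok'
    have hw : C.bd (σ.clock + 1) ≤ e.wt * C.bd (σ.clock + 1) := by
      have : 1 ≤ e.wt := e.wt_pos
      nlinarith
    have hw' : 0 ≤ f.wt * C.bd (σ.clock + 1) := by positivity
    have hB1 : 16 * (e.wt * C.bd (σ.clock + 1)) + 34 + f.wt * C.bd (σ.clock + 1) ≤ B := by
      nlinarith
    obtain ⟨ρ₁, r1, s1, v1⟩ := e.compile_runs hb' 0 ρ hr hok (B := B) (by omega)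
    obtain ⟨ρ₂, r2, s2, v2⟩ := addrCode_runs k 0 ρ₁ (h1.trans hw) he (B := B) (by omega) v1
    obtain ⟨ρ₃, r3, s3, v3⟩ := f.compile_runs hb' 1 ρ₂ ((s1.trans s2).rel hr) hok' (B := B)
      (by omega)
    have hr3 := ((s1.trans s2).trans (s3.anti (Nat.zero_le 1))).rel hr
    have v2' : ρ₃.reg 1 = -1 - (k : ℕ) - 16 * e.eval C σ := by
      rw [s3.low 1 (by omega)]; exact v2
    have v3' : ρ₃.reg 3 = f.eval C σ := v3
    have h4 := Runs.store (B := B) (ρ := ρ₃) (a := 1) (b := 3)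
      (by rw [v2']; rw [abs_le] at he ⊢; have := k.2; omega) (by rw [v3']; omega)
    rw [v2', v3'] at h4
    refine ⟨ρ₃.setMem (-1 - (k : ℕ) - 16 * e.eval C σ) (f.eval C σ),
      ⟨hr3.var, fun i hi => ?_, fun k' i hi => ?_, hr3.out⟩,
      (r1.seq (r2.seq (r3.seq h4))).weaken ?_⟩
    · rw [← hr3.inp i hi]
      exact Function.update_of_ne (by omega) _ _
    · have hk := k.2
      have hk' := k'.2
      simp only [State.setMem, St.setArr]
      by_cases hkk : k' = k
      · subst hkk
        rw [Function.update_self]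
        by_cases hii : i = e.eval C σ
        · subst hii; rw [Function.update_self, Function.update_self]
        · rw [Function.update_of_ne (by omega), Function.update_of_ne hii, hr3.arr k' i hi]
      · have : (k' : ℕ) ≠ k := fun h => hkk (Fin.ext h)
        rw [Function.update_of_ne (by omega), Function.update_of_ne hkk, hr3.arr k' i hi]
    · simp only [Cmd.cost]
      exact le_trans (by omega) (Nat.le_mul_of_pos_right _ (Nat.succ_pos _))
  | @print e σ hok =>
    intro ρ hr hb hB
    have hb' : Bounded C σ (C.bd (σ.clock + 1)) := hb.mono (C.bd_mono (Nat.le_succ _))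
    change e.wt * C.bd (σ.clock + 1) ≤ B at hB
    have he := Expr.abs_eval_le hb' e hok
    obtain ⟨ρ₁, r1, s1, v1⟩ := e.compile_runs hb' 0 ρ hr hok (B := B) (by omega)
    have v1' : ρ₁.reg 1 = e.eval C σ := v1
    have hr1 := s1.rel hr
    refine ⟨{ ρ₁ with out := ρ₁.out ++ [ρ₁.reg 1] }, ⟨hr1.var, hr1.inp, hr1.arr, ?_⟩,
      (r1.seq (Runs.print (a := 1) (by rw [v1']; omega))).weaken ?_⟩
    · simp only [St.emit, v1', hr1.out]
    · simp only [Cmd.cost]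
      exact Nat.le_mul_of_pos_right _ (Nat.succ_pos _)
  | @seq c d σ σ' σ'' h1 h2 ih1 ih2 =>
    intro ρ hr hb hB
    have l1 := h1.clock_le
    have l2 := h2.clock_le
    have hb1 := h1.bounded hb
    have hm := C.bd_mono l2
    simp only [Cmd.wt, Nat.cast_add, add_mul] at hB
    have hb2 := h2.bounded hb1
    have := hb1.one; have := hb2.one
    have w1 : c.wt * C.bd σ'.clock ≤ c.wt * C.bd σ''.clock := by gcongr
    have w2 : 0 ≤ d.wt * C.bd σ''.clock := by positivity
    have w3 : 0 ≤ c.wt * C.bd σ''.clock := by positivity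
    obtain ⟨ρ₁, hr1, r1⟩ := ih1 ρ hr hb (by omega)
    obtain ⟨ρ₂, hr2, r2⟩ := ih2 ρ₁ hr1 hb1 (by omega)
    refine ⟨ρ₂, hr2, (r1.seq r2).weaken ?_⟩
    simp only [Cmd.cost]
    calc c.cost * (σ'.clock - σ.clock + 1) + d.cost * (σ''.clock - σ'.clock + 1)
        ≤ c.cost * (2 * (σ''.clock - σ.clock + 1)) + d.cost * (2 * (σ''.clock - σ.clock + 1)) := by
          gcongr <;> omega
      _ = _ := by ring
  | @cond_pos e c d σ σ' hok h0 h1 ih =>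
    intro ρ hr hb hB
    have hb' : Bounded C σ (C.bd σ'.clock) := hb.mono (C.bd_mono h1.clock_le)
    simp only [Cmd.wt, Nat.cast_add, add_mul] at hB
    have := hb'.one
    have w1 : 0 ≤ d.wt * C.bd σ'.clock := by positivity
    have w2 : 0 ≤ c.wt * C.bd σ'.clock := by positivity
    have w3 : 0 ≤ e.wt * C.bd σ'.clock := by positivity
    have he := Expr.abs_eval_le hb' e hok
    obtain ⟨ρ₁, r1, s1, v1⟩ := e.compile_runs hb' 0 ρ hr hok (B := B) (by omega)
    have v1' : ρ₁.reg 1 = e.eval C σ := v1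
    obtain ⟨ρ₂, hr2, r2⟩ := ih ρ₁ (s1.rel hr) hb (by omega)
    refine ⟨ρ₂, hr2, (r1.seq (Runs.cond_pos (by rw [v1']; omega) (by rwa [v1']) r2)).weaken ?_⟩
    simp only [Cmd.cost]
    nlinarith [Nat.zero_le (d.cost * (σ'.clock - σ.clock + 1)),
      Nat.zero_le (e.cost * (σ'.clock - σ.clock))]
  | @cond_neg e c d σ σ' hok h0 h1 ih =>
    intro ρ hr hb hB
    have hb' : Bounded C σ (C.bd σ'.clock) := hb.mono (C.bd_mono h1.clock_le)
    simp only [Cmd.wt, Nat.cast_add, add_mul] at hB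
    have := hb'.one
    have w1 : 0 ≤ d.wt * C.bd σ'.clock := by positivity
    have w2 : 0 ≤ c.wt * C.bd σ'.clock := by positivity
    have w3 : 0 ≤ e.wt * C.bd σ'.clock := by positivity
    have he := Expr.abs_eval_le hb' e hok
    obtain ⟨ρ₁, r1, s1, v1⟩ := e.compile_runs hb' 0 ρ hr hok (B := B) (by omega)
    have v1' : ρ₁.reg 1 = e.eval C σ := v1
    obtain ⟨ρ₂, hr2, r2⟩ := ih ρ₁ (s1.rel hr) hb (by omega)
    refine ⟨ρ₂, hr2, (r1.seq (Runs.cond_neg (by rw [v1']; omega) (by rwa [v1']) r2)).weaken ?_⟩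
    simp only [Cmd.cost]
    nlinarith [Nat.zero_le (c.cost * (σ'.clock - σ.clock + 1)),
      Nat.zero_le (e.cost * (σ'.clock - σ.clock))]
  | @loop_done e c σ hok h0 =>
    intro ρ hr hb hB
    simp only [Cmd.wt, Nat.cast_add, add_mul] at hB
    have := hb.one
    have w2 : 0 ≤ c.wt * C.bd σ.clock := by positivity
    have he := Expr.abs_eval_le hb e hok
    obtain ⟨ρ₁, r1, s1, v1⟩ := e.compile_runs hb 0 ρ hr hok (B := B) (by omega)
    have v1' : ρ₁.reg 1 = e.eval C σ := v1
    refine ⟨ρ₁, s1.rel hr,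
      (r1.seq (Runs.loop_done (by rw [v1']; omega) (by rwa [v1']))).weaken ?_⟩
    simp only [Cmd.cost]
    nlinarith [Nat.zero_le ((e.cost + 1 + 2 * c.cost) * (σ.clock - σ.clock))]
  | @loop_step e c σ σ' σ'' hok h0 h1 hlt h2 ih1 ih2 =>
    intro ρ hr hb hB
    have l2 := h2.clock_le
    have hb1 := h1.bounded hb
    have hb' : Bounded C σ (C.bd σ''.clock) := hb.mono (C.bd_mono (hlt.le.trans l2))
    have hB' := hB
    simp only [Cmd.wt, Nat.cast_add, add_mul] at hB
    have := hb'.one; have := hb1.one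
    have w2 : 0 ≤ c.wt * C.bd σ''.clock := by positivity
    have w3 : 0 ≤ e.wt * C.bd σ''.clock := by positivity
    have w4 : c.wt * C.bd σ'.clock ≤ c.wt * C.bd σ''.clock := by
      gcongr; exact C.bd_mono l2
    have he := Expr.abs_eval_le hb' e hok
    obtain ⟨ρ₁, r1, s1, v1⟩ := e.compile_runs hb' 0 ρ hr hok (B := B) (by omega)
    have v1' : ρ₁.reg 1 = e.eval C σ := v1
    obtain ⟨ρ₂, hr2, r2⟩ := ih1 ρ₁ (s1.rel hr) hb (by omega)
    obtain ⟨ρ₃, hr3, r3⟩ := ih2 ρ₂ hr2 hb1 hB'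
    refine ⟨ρ₃, hr3,
      (r1.seq (Runs.loop_step (by rw [v1']; omega) (by rwa [v1']) r2 r3)).weaken ?_⟩
    simp only [Cmd.cost]
    -- The round advances the clock by `a + 1`. Its body costs `c.cost * (a + 2) ≤ 2 * c.cost * (a +
    -- 1)`, and the test is paid from the same increment.
    obtain ⟨a, ha⟩ : ∃ a, σ'.clock = σ.clock + (a + 1) := ⟨σ'.clock - σ.clock - 1, by omega⟩
    obtain ⟨b, hb⟩ : ∃ b, σ''.clock = σ'.clock + b := ⟨σ''.clock - σ'.clock, by omega⟩
    have e1 : σ'.clock - σ.clock = a + 1 := by omega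
    have e2 : σ''.clock - σ'.clock = b := by omega
    have e3 : σ''.clock - σ.clock = a + 1 + b := by omega
    rw [e1, e2, e3]
    nlinarith [Nat.zero_le (e.cost * a), Nat.zero_le (c.cost * a)]

/-! ### Verification -/

/-- Total correctness: `c` terminates from `σ` in a state that satisfies `Q`. -/
def wp (C : Ctx) (c : Cmd) (Q : St → Prop) (σ : St) : Prop := ∃ σ', HExec C c σ σ' ∧ Q σ'

section wp

variable {C : Ctx} {Q Q' : St → Prop} {σ : St} {c d : Cmd} {e f : Expr}

theorem wp_mono (h : wp C c Q σ) (hQ : ∀ σ', Q σ' → Q' σ') : wp C c Q' σ :=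
  let ⟨σ', h1, h2⟩ := h
  ⟨σ', h1, hQ σ' h2⟩

@[simp] theorem wp_skip : wp C .skip Q σ ↔ Q σ :=
  ⟨fun ⟨_, h, hQ⟩ => by cases h; exact hQ, fun h => ⟨_, .skip σ, h⟩⟩

@[simp] theorem wp_assign {x : ℕ} : wp C (x ≔ e) Q σ ↔
    e.ok C σ ∧ |e.eval C σ| ≤ C.bd σ.clock ∧ Q (σ.setVar x (e.eval C σ)) :=
  ⟨fun ⟨_, h, hQ⟩ => by cases h with | assign h1 h2 => exact ⟨h1, h2, hQ⟩,
    fun ⟨h1, h2, h⟩ => ⟨_, .assign h1 h2, h⟩⟩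

@[simp] theorem wp_write {k : Fin 16} : wp C (.write k e f) Q σ ↔
    e.ok C σ ∧ f.ok C σ ∧ 0 ≤ e.eval C σ ∧ |f.eval C σ| ≤ C.bd σ.clock ∧
      Q (σ.setArr k (e.eval C σ) (f.eval C σ)) :=
  ⟨fun ⟨_, h, hQ⟩ => by cases h with | write h1 h2 h3 h4 => exact ⟨h1, h2, h3, h4, hQ⟩,
    fun ⟨h1, h2, h3, h4, h⟩ => ⟨_, .write h1 h2 h3 h4, h⟩⟩

@[simp] theorem wp_print : wp C (.print e) Q σ ↔ e.ok C σ ∧ Q (σ.emit (e.eval C σ)) :=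
  ⟨fun ⟨_, h, hQ⟩ => by cases h with | print h1 => exact ⟨h1, hQ⟩,
    fun ⟨h1, h⟩ => ⟨_, .print h1, h⟩⟩

@[simp] theorem wp_seq : wp C (c ⨟ d) Q σ ↔ wp C c (wp C d Q) σ :=
  ⟨fun ⟨_, h, hQ⟩ => by cases h with | seq h1 h2 => exact ⟨_, h1, _, h2, hQ⟩,
    fun ⟨_, h1, _, h2, h⟩ => ⟨_, .seq h1 h2, h⟩⟩

@[simp] theorem wp_cond : wp C (.cond e c d) Q σ ↔
    e.ok C σ ∧ (0 < e.eval C σ → wp C c Q σ) ∧ (e.eval C σ ≤ 0 → wp C d Q σ) := by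
  constructor
  · rintro ⟨_, h, hQ⟩
    cases h with
    | cond_pos h1 h2 h3 => exact ⟨h1, fun _ => ⟨_, h3, hQ⟩, fun h => absurd h2 h.not_gt⟩
    | cond_neg h1 h2 h3 => exact ⟨h1, fun h => absurd h h2, fun _ => ⟨_, h3, hQ⟩⟩
  · rintro ⟨h1, h2, h3⟩
    by_cases h : 0 < e.eval C σ
    · obtain ⟨σ', h4, h5⟩ := h2 h
      exact ⟨σ', .cond_pos h1 h h4, h5⟩
    · obtain ⟨σ', h4, h5⟩ := h3 (not_lt.1 h)
      exact ⟨σ', .cond_neg h1 h h4, h5⟩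

end wp

/-! ### Frames -/

namespace Cmd

/-- `c` does not assign to `x`. -/
def keepsVar (x : ℕ) : Cmd → Bool
  | assign y _ => x != y
  | seq c d => c.keepsVar x && d.keepsVar x
  | cond _ c d => c.keepsVar x && d.keepsVar x
  | loop _ c => c.keepsVar x
  | _ => true

/-- `c` does not write to the array `k`. -/
def keepsArr (k : Fin 16) : Cmd → Bool
  | write l _ _ => k != l
  | seq c d => c.keepsArr k && d.keepsArr k
  | cond _ c d => c.keepsArr k && d.keepsArr k
  | loop _ c => c.keepsArr k
  | _ => true

/-- `c` does not print. -/
def silent : Cmd → Bool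
  | print _ => false
  | seq c d => c.silent && d.silent
  | cond _ c d => c.silent && d.silent
  | loop _ c => c.silent
  | _ => true

end Cmd

/-- `σ'` differs from `σ` only as far as `c` can change it. -/
structure Frame (c : Cmd) (σ σ' : St) : Prop where
  var : ∀ x, c.keepsVar x = true → σ'.vars x = σ.vars x
  arr : ∀ k, c.keepsArr k = true → σ'.arr k = σ.arr k
  out : c.silent = true → σ'.out = σ.out
  clock : σ.clock ≤ σ'.clock

theorem Frame.refl (c : Cmd) (σ : St) : Frame c σ σ :=
  ⟨fun _ _ => rfl, fun _ _ => rfl, fun _ => rfl, le_rfl⟩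

theorem Frame.trans {c : Cmd} {σ σ' σ'' : St} (h : Frame c σ σ') (h' : Frame c σ' σ'') :
    Frame c σ σ'' :=
  ⟨fun x hx => (h'.var x hx).trans (h.var x hx), fun k hk => (h'.arr k hk).trans (h.arr k hk),
    fun hs => (h'.out hs).trans (h.out hs), h.clock.trans h'.clock⟩

theorem Frame.seq {c d : Cmd} {σ σ' σ'' : St} (h : Frame c σ σ') (h' : Frame d σ' σ'') :
    Frame (c ⨟ d) σ σ'' := by
  constructor
  · intro x hx
    simp only [Cmd.keepsVar, Bool.and_eq_true] at hx
    exact (h'.var x hx.2).trans (h.var x hx.1)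
  · intro x hx
    simp only [Cmd.keepsArr, Bool.and_eq_true] at hx
    exact (h'.arr x hx.2).trans (h.arr x hx.1)
  · intro hx
    simp only [Cmd.silent, Bool.and_eq_true] at hx
    exact (h'.out hx.2).trans (h.out hx.1)
  · exact h.clock.trans h'.clock

theorem HExec.frame {C : Ctx} {c : Cmd} {σ σ' : St} (h : HExec C c σ σ') : Frame c σ σ' := by
  induction h with
  | skip σ => exact .refl _ _
  | assign =>
    refine ⟨fun y hy => ?_, fun _ _ => rfl, fun _ => rfl, Nat.le_succ _⟩
    simp only [Cmd.keepsVar, bne_iff_ne] at hy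
    simp [St.setVar, hy]
  | write =>
    refine ⟨fun _ _ => rfl, fun y hy => ?_, fun _ => rfl, Nat.le_succ _⟩
    simp only [Cmd.keepsArr, bne_iff_ne] at hy
    simp [St.setArr, hy]
  | print => exact ⟨fun _ _ => rfl, fun _ _ => rfl, fun h => by simp [Cmd.silent] at h,
      Nat.le_succ _⟩
  | seq _ _ ih1 ih2 => exact ih1.seq ih2
  | cond_pos _ _ _ ih =>
    refine ⟨fun x hx => ih.var x ?_, fun x hx => ih.arr x ?_, fun hx => ih.out ?_, ih.clock⟩
    · simp only [Cmd.keepsVar, Bool.and_eq_true] at hx; exact hx.1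
    · simp only [Cmd.keepsArr, Bool.and_eq_true] at hx; exact hx.1
    · simp only [Cmd.silent, Bool.and_eq_true] at hx; exact hx.1
  | cond_neg _ _ _ ih =>
    refine ⟨fun x hx => ih.var x ?_, fun x hx => ih.arr x ?_, fun hx => ih.out ?_, ih.clock⟩
    · simp only [Cmd.keepsVar, Bool.and_eq_true] at hx; exact hx.2
    · simp only [Cmd.keepsArr, Bool.and_eq_true] at hx; exact hx.2
    · simp only [Cmd.silent, Bool.and_eq_true] at hx; exact hx.2
  | loop_done => exact .refl _ _
  | loop_step _ _ _ _ _ ih1 ih2 => exact Frame.trans ⟨ih1.var, ih1.arr, ih1.out, ih1.clock⟩ ih2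

section wp

variable {C : Ctx} {Q Q' : St → Prop} {σ : St} {c d : Cmd} {e f : Expr}

/-- Adds to a postcondition that everything the code does not touch is unchanged, so that
specifications only mention what changes. -/
theorem wp_frame (h : wp C c Q σ) (hQ : ∀ σ', Q σ' → Frame c σ σ' → Q' σ') : wp C c Q' σ :=
  let ⟨σ', h1, h2⟩ := h
  ⟨σ', h1, hQ σ' h2 h1.frame⟩

/-- While loops, with an invariant `I` and a measure `φ`. -/
theorem wp_loop (I : St → Prop) (φ : St → ℕ) (h0 : I σ)
    (hstep : ∀ σ', Frame (.loop e c) σ σ' → I σ' →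
      e.ok C σ' ∧ (0 < e.eval C σ' →
        wp C c (fun σ'' => I σ'' ∧ φ σ'' < φ σ' ∧ σ'.clock < σ''.clock) σ'))
    (hQ : ∀ σ', Frame (.loop e c) σ σ' → I σ' → e.eval C σ' ≤ 0 → Q σ') :
    wp C (.loop e c) Q σ := by
  suffices H : ∀ k σ', φ σ' ≤ k → Frame (.loop e c) σ σ' → I σ' → wp C (.loop e c) Q σ' from
    H _ σ le_rfl (.refl _ _) h0
  intro k
  induction k with
  | zero =>
    intro σ' hk hf hI
    obtain ⟨hok, hs⟩ := hstep σ' hf hI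
    by_cases he : 0 < e.eval C σ'
    · obtain ⟨σ'', _, _, hφ, _⟩ := hs he
      omega
    · exact ⟨σ', .loop_done hok he, hQ σ' hf hI (not_lt.1 he)⟩
  | succ k ih =>
    intro σ' hk hf hI
    obtain ⟨hok, hs⟩ := hstep σ' hf hI
    by_cases he : 0 < e.eval C σ'
    · obtain ⟨σ'', hx, hI', hφ, hc⟩ := hs he
      have hfr := hx.frame
      obtain ⟨σ₃, hx', hq⟩ := ih σ'' (by omega)
        (hf.trans ⟨hfr.var, hfr.arr, hfr.out, hfr.clock⟩) hI'
      exact ⟨σ₃, .loop_step hok he hx hc hx', hq⟩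
    · exact ⟨σ', .loop_done hok he, hQ σ' hf hI (not_lt.1 he)⟩

end wp

/-- `for i := 0 to b - 1 do c` -/
def Cmd.for (i b : ℕ) (c : Cmd) : Cmd :=
  i ≔ 0 ⨟ .loop (♯b - ♯i) (c ⨟ i ≔ ♯i + 1)

section states

variable (σ : St) (x y : ℕ) (k l : Fin 16) (i z : ℤ)

@[simp] theorem setVar_vars : (σ.setVar x z).vars y = if y = x then z else σ.vars y := by
  simp [St.setVar, Function.update_apply]
@[simp] theorem setVar_arr : (σ.setVar x z).arr = σ.arr := rfl
@[simp] theorem setVar_out : (σ.setVar x z).out = σ.out := rfl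
@[simp] theorem setVar_clock : (σ.setVar x z).clock = σ.clock + 1 := rfl
@[simp] theorem setArr_vars : (σ.setArr k i z).vars = σ.vars := rfl
@[simp] theorem setArr_arr : (σ.setArr k i z).arr l =
    if l = k then Function.update (σ.arr k) i z else σ.arr l := by
  by_cases h : l = k
  · subst h; simp [St.setArr]
  · simp [St.setArr, h]
@[simp] theorem setArr_clock : (σ.setArr k i z).clock = σ.clock + 1 := rfl
@[simp] theorem emit_vars : (σ.emit z).vars = σ.vars := rfl
@[simp] theorem emit_arr : (σ.emit z).arr = σ.arr := rfl
@[simp] theorem emit_out : (σ.emit z).out = σ.out ++ [z] := rfl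
@[simp] theorem emit_clock : (σ.emit z).clock = σ.clock + 1 := rfl

end states

/-- For counters, addresses and numbers of vertices, states or nodes; only weights of paths need the
factor `C.W`. -/
theorem Ctx.le_bd {C : Ctx} (hW : 1 ≤ C.W) {z : ℤ} (τ : ℕ) (h0 : 0 ≤ z) (h : z ≤ C.A + τ) :
    |z| ≤ C.bd τ := by
  rw [abs_of_nonneg h0]
  have : (1 : ℤ) ≤ C.W := by exact_mod_cast hW
  unfold Ctx.bd
  nlinarith

/-- For loops, with an invariant `I` that the counter and the clock do not affect, and a bound `T`
on the time of an iteration. -/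
theorem wp_for {C : Ctx} (hW : 1 ≤ C.W) {Q : St → Prop} {σ : St} {c : Cmd} {i b : ℕ}
    (N T : ℕ) (I : ℕ → St → Prop) (hN : N ≤ C.A) (hib : i ≠ b) (hb : σ.vars b = N)
    (hci : c.keepsVar i = true) (hcb : c.keepsVar b = true)
    (h0 : I 0 (σ.setVar i 0))
    (hstep : ∀ k < N, ∀ σ', Frame (.for i b c) σ σ' → σ'.vars i = k → I k σ' →
      wp C c (fun σ'' => σ''.clock ≤ σ'.clock + T ∧ I (k + 1) (σ''.setVar i (k + 1))) σ')
    (hQ : ∀ σ', Frame (.for i b c) σ σ' → I N σ' → σ'.clock ≤ σ.clock + 1 + N * (T + 1) → Q σ') :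
    wp C (.for i b c) Q σ := by
  have hfr : ∀ {σ₁}, Frame (.loop (♯b - ♯i) (c ⨟ i ≔ ♯i + 1)) (σ.setVar i 0) σ₁ →
      Frame (.for i b c) σ σ₁ := fun h => Frame.seq (c := i ≔ 0) (σ' :=
          σ.setVar i 0) ⟨fun y hy => by
        simp only [Cmd.keepsVar, bne_iff_ne] at hy
        simp [hy], fun _ _ => rfl, fun _ => rfl, Nat.le_succ _⟩ h
  unfold Cmd.for
  have e0 : (0 : Expr).ok C σ := trivial
  rw [wp_seq, wp_assign]
  refine ⟨e0, Ctx.le_bd hW _ le_rfl (by simp; positivity), ?_⟩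
  rw [Expr.eval_zero]
  -- One time unit initialises the counter; a round takes `T` for the body and 1 for the increment.
  refine wp_loop (fun σ' => σ'.vars b = N ∧ ∃ k : ℕ, k ≤ N ∧ σ'.vars i = k ∧
    σ'.clock ≤ σ.clock + 1 + k * (T + 1) ∧ I k σ') (fun σ' => (σ'.vars b - σ'.vars i).toNat)
    ⟨by simp [hib.symm, hb], 0, Nat.zero_le _, by simp, by simp, h0⟩ ?_ ?_
  · rintro σ' hf ⟨hb', k, hk, hi, hcl, hI⟩
    refine ⟨⟨trivial, trivial⟩, fun hpos => ?_⟩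
    simp only [Expr.eval_sub, Expr.eval, hb', hi] at hpos
    rw [wp_seq]
    refine wp_frame (hstep k (by omega) σ' (hfr hf) hi hI) ?_
    rintro σ'' ⟨hc'', hI''⟩ hf''
    have hb'' : σ''.vars b = N := (hf''.var b hcb).trans hb'
    have hi'' : σ''.vars i = k := (hf''.var i hci).trans hi
    have := hf''.clock
    have e1 : (♯i + 1 : Expr).ok C σ'' := ⟨trivial, trivial⟩
    rw [wp_assign]
    simp only [Expr.eval_add, Expr.eval, Expr.eval_one, hi'']
    refine ⟨e1, Ctx.le_bd hW _ (by omega) (by omega), ⟨?_, k + 1, by omega, ?_, ?_, hI''⟩, ?_, ?_⟩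
    · simp [hib.symm, hb'']
    · simp
    · simp only [setVar_clock, add_mul, one_mul]; omega
    · simp [hib.symm, hb'', hb', hi]; omega
    · simp; omega
  · rintro σ' hf ⟨hb', k, hk, hi, hcl, hI⟩ hle
    simp only [Expr.eval_sub, Expr.eval, hb', hi] at hle
    obtain rfl : k = N := by omega
    exact hQ σ' (hfr hf) hI hcl

end HL

/-! ### Shortest accepted paths, over natural numbers -/

/-- An automaton with numbered transitions, a weighted graph and two vertices. -/
structure Inst where
  n : ℕ
  nq : ℕ
  m : ℕ
  q0 : ℕ
  s : ℕ
  t : ℕ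
  src : ℕ → ℕ
  lab : ℕ → ℕ
  tgt : ℕ → ℕ
  acc : ℕ → Prop
  adj : ℕ → ℕ → Prop
  w : ℕ → ℕ → ℤ
  q0_lt : q0 < nq
  s_lt : s < n
  t_lt : t < n
  src_lt : ∀ e < m, src e < nq
  lab_lt : ∀ e < m, lab e < n
  tgt_lt : ∀ e < m, tgt e < nq

namespace Inst

variable (I : Inst)

/-- The number of the node `(q, v)`: the automaton is in state `q` and about to read `v`. -/
def nd (q v : ℕ) : ℕ := q * I.n + v
def N : ℕ := I.nq * I.n
/-- The node where transition `e` can be taken. -/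
def xs (e : ℕ) : ℕ := I.nd (I.src e) (I.lab e)
/-- The node after transition `e`, if `u` is the next vertex. -/
def yt (e u : ℕ) : ℕ := I.nd (I.tgt e) u
def root : ℕ := I.nd I.q0 I.s

/-- Offsets in the input: transitions start at `tb`, the adjacency matrix at `ab`, its row `v` at
`row v`, and `nn` is the distance to the weight matrix. `qn q` is the number of the first node of
state `q`. -/
def tb : ℤ := 6 + I.nq
def ab : ℤ := I.tb + I.m + I.m + I.m
def nn : ℤ := I.n * I.n
def row (v : ℕ) : ℤ := I.ab + (v * I.n : ℕ)
def qn (q : ℕ) : ℤ := (q * I.n : ℕ)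

theorem nd_lt {q v : ℕ} (hq : q < I.nq) (hv : v < I.n) : I.nd q v < I.N := by
  unfold nd N
  nlinarith

theorem xs_lt {e : ℕ} (he : e < I.m) : I.xs e < I.N := I.nd_lt (I.src_lt e he) (I.lab_lt e he)
theorem yt_lt {e u : ℕ} (he : e < I.m) (hu : u < I.n) : I.yt e u < I.N :=
  I.nd_lt (I.tgt_lt e he) hu
theorem root_lt : I.root < I.N := I.nd_lt I.q0_lt I.s_lt

theorem n_pos : 0 < I.n := (Nat.zero_le _).trans_lt I.s_lt

theorem nd_inj {q v q' v' : ℕ} (hv : v < I.n) (hv' : v' < I.n) (h : I.nd q v = I.nd q' v') :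
    q = q' ∧ v = v' := by
  unfold nd at h
  have h1 : (q * I.n + v) / I.n = q := by
    rw [mul_comm, Nat.mul_add_div I.n_pos, Nat.div_eq_of_lt hv, add_zero]
  have h2 : (q' * I.n + v') / I.n = q' := by
    rw [mul_comm, Nat.mul_add_div I.n_pos, Nat.div_eq_of_lt hv', add_zero]
  have : q = q' := by rw [← h1, ← h2, h]
  subst this
  exact ⟨rfl, by omega⟩

theorem exists_nd {x : ℕ} (hx : x < I.N) : ∃ q < I.nq, ∃ v < I.n, x = I.nd q v := by
  refine ⟨x / I.n, ?_, x % I.n, Nat.mod_lt _ I.n_pos, ?_⟩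
  · exact Nat.div_lt_of_lt_mul (by rw [mul_comm]; exact hx)
  · unfold nd
    rw [mul_comm]
    exact (Nat.div_add_mod x I.n).symm

theorem qn_add (q v : ℕ) : I.qn q + v = (I.nd q v : ℕ) := by
  unfold qn nd; push_cast; ring

theorem tb_nonneg : 0 ≤ I.tb := by unfold tb; omega
theorem ab_nonneg : 0 ≤ I.ab := by have := I.tb_nonneg; unfold ab; omega
theorem row_nonneg (v : ℕ) : 0 ≤ I.row v := by have := I.ab_nonneg; unfold row; omega
theorem nn_nonneg : 0 ≤ I.nn := by unfold nn; positivity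

/-- `p` is a path from the vertex of the node to `t`, accepted from the state of the node, of
weight `c`. -/
inductive Good : ℕ → List ℕ → ℤ → Prop
  | base (e : ℕ) : e < I.m → I.lab e = I.t → I.acc (I.tgt e) → Good (I.xs e) [I.lab e] 0
  | step (e u : ℕ) (p : List ℕ) (c : ℤ) : e < I.m → u < I.n → I.adj (I.lab e) u →
      Good (I.yt e u) p c → Good (I.xs e) (I.lab e :: p) (c + I.w (I.lab e) u)

/-- A set of nodes that is closed under successors. -/
def Closed (S : ℕ → Prop) : Prop :=
  ∀ e < I.m, ∀ u < I.n, I.adj (I.lab e) u → S (I.xs e) → S (I.yt e u)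

/-- `d` is a fixed point of the relaxations on `S`. -/
def Fixed (S : ℕ → Prop) (d : ℕ → WithTop ℤ) : Prop :=
  ∀ e < I.m, ∀ u < I.n, I.adj (I.lab e) u → S (I.xs e) →
    d (I.xs e) ≤ d (I.yt e u) + (I.w (I.lab e) u : ℤ)

/-- The bases have value at most `0`. -/
def Based (d : ℕ → WithTop ℤ) : Prop :=
  ∀ e < I.m, I.lab e = I.t → I.acc (I.tgt e) → d (I.xs e) ≤ 0

variable {I}

/-- Induction along the path, with one relaxation inequality per edge and `Based` at the end.
Closedness keeps the tail inside `S`; this generality is needed as Bellman-Ford reaches a fixed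
point only on the reachable nodes. -/
theorem Good.le_of_fixed {S : ℕ → Prop} {d : ℕ → WithTop ℤ} (hS : I.Closed S) (hd : I.Fixed S d)
    (hb : I.Based d) {x : ℕ} {p : List ℕ} {c : ℤ} (h : I.Good x p c) (hx : S x) :
    d x ≤ (c : WithTop ℤ) := by
  induction h with
  | base e he h1 h2 => exact hb e he h1 h2
  | step e u p c he hu hadj _ ih =>
    have h1 := ih (hS e he u hu hadj hx)
    refine (hd e he u hu hadj hx).trans ?_
    push_cast
    gcongr

theorem Good.length_pos {x : ℕ} {p : List ℕ} {c : ℤ} (h : I.Good x p c) : 0 < p.length := by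
  cases h <;> simp

theorem Good.lt_N {x : ℕ} {p : List ℕ} {c : ℤ} (h : I.Good x p c) : x < I.N := by
  cases h with
  | base e he _ _ => exact I.xs_lt he
  | step e u p c he => exact I.xs_lt he

end Inst

/-! ### Common parts of the programs -/

notation "vN" => (0 : ℕ)
notation "vQ" => (1 : ℕ)
notation "vM" => (2 : ℕ)
notation "vQz" => (3 : ℕ)
notation "vS" => (4 : ℕ)
notation "vT" => (5 : ℕ)
notation "vTb" => (6 : ℕ)
notation "vAb" => (7 : ℕ)
notation "vNn" => (8 : ℕ)
notation "vNd" => (9 : ℕ)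
notation "vCnt" => (10 : ℕ)
notation "vChg" => (11 : ℕ)
notation "vX" => (12 : ℕ)
notation "vCand" => (13 : ℕ)
notation "vA" => (14 : ℕ)
notation "vNx" => (15 : ℕ)
notation "vE" => (16 : ℕ)
notation "vU" => (17 : ℕ)
notation "vY" => (18 : ℕ)
notation "vF" => (19 : ℕ)
notation "vR" => (20 : ℕ)
notation "vI" => (21 : ℕ)
notation "vJ" => (22 : ℕ)
notation "vHd" => (23 : ℕ)
notation "vTl" => (24 : ℕ)
notation "vL" => (25 : ℕ)
notation "vP" => (26 : ℕ)
notation "aRow" => (0 : Fin 16)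
notation "aQn" => (1 : Fin 16)
notation "aD" => (2 : Fin 16)
notation "aPtr" => (3 : Fin 16)
notation "aCv" => (4 : Fin 16)
notation "aCn" => (5 : Fin 16)
notation "aMark" => (6 : Fin 16)
notation "aHead" => (7 : Fin 16)
notation "aNext" => (8 : Fin 16)
notation "aOut" => (9 : Fin 16)
notation "aQu" => (10 : Fin 16)
notation "aTree" => (11 : Fin 16)
notation "aPar" => (12 : Fin 16)
notation "aQof" => (13 : Fin 16)
notation "aVof" => (14 : Fin 16)

namespace HL

open Inst

/-- The input of the program encodes the instance `I`. -/
structure Enc (I : Inst) (C : Ctx) : Prop where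
  n : C.inp 0 = I.n
  nq : C.inp 1 = I.nq
  m : C.inp 2 = I.m
  q0 : C.inp 3 = I.q0
  s : C.inp 4 = I.s
  t : C.inp 5 = I.t
  acc : ∀ q < I.nq, (0 < C.inp (6 + q) ↔ I.acc q)
  src : ∀ e < I.m, C.inp (I.tb + e + e + e) = I.src e
  lab : ∀ e < I.m, C.inp (I.tb + e + e + e + 1) = I.lab e
  tgt : ∀ e < I.m, C.inp (I.tb + e + e + e + 2) = I.tgt e
  adj : ∀ v < I.n, ∀ u < I.n, (0 < C.inp (I.row v + u) ↔ I.adj v u)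
  w : ∀ v < I.n, ∀ u < I.n, I.adj v u → C.inp (I.row v + I.nn + u) = I.w v u
  w_le : ∀ v < I.n, ∀ u < I.n, I.adj v u → |I.w v u| ≤ C.W
  one_le_W : 1 ≤ C.W
  len_le_A : 20 + I.nq + 3 * I.m + 2 * (I.n * I.n) ≤ C.A
  N_le_A : 4 * I.N + 4 ≤ C.A

/-- The precomputed data. -/
structure Static (I : Inst) (σ : St) : Prop where
  n : σ.vars vN = I.n
  nq : σ.vars vQ = I.nq
  m : σ.vars vM = I.m
  q0 : σ.vars vQz = I.q0
  s : σ.vars vS = I.s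
  t : σ.vars vT = I.t
  tb : σ.vars vTb = I.tb
  nn : σ.vars vNn = I.nn
  N : σ.vars vNd = I.N
  row : ∀ v < I.n, σ.arr aRow v = I.row v
  qn : ∀ q < I.nq, σ.arr aQn q = I.qn q
  qof : ∀ q < I.nq, ∀ v < I.n, σ.arr aQof (I.nd q v : ℕ) = q
  vof : ∀ q < I.nq, ∀ v < I.n, σ.arr aVof (I.nd q v : ℕ) = v

/-- `c` does not affect the precomputed data. -/
def Cmd.keepsStatic (c : Cmd) : Bool :=
  (List.range 10).all (fun x => c.keepsVar x) && [aRow, aQn, aQof, aVof].all fun k => c.keepsArr k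

theorem Static.frame {I : Inst} {σ σ' : St} {c : Cmd} (h : Static I σ) (hf : Frame c σ σ')
    (hc : c.keepsStatic = true) : Static I σ' := by
  simp only [Cmd.keepsStatic, Bool.and_eq_true, List.all_eq_true, List.mem_range] at hc
  have hv : ∀ x < 10, σ'.vars x = σ.vars x := fun x hx => hf.var x (hc.1 x hx)
  have ha : ∀ k ∈ [aRow, aQn, aQof, aVof], σ'.arr k = σ.arr k := fun k hk => hf.arr k (hc.2 k hk)
  constructor
  all_goals first
    | rw [hv _ (by norm_num)]
    | rw [ha _ (by simp)]
  exacts [h.n, h.nq, h.m, h.q0, h.s, h.t, h.tb, h.nn, h.N, h.row, h.qn, h.qof, h.vof]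

/-! ### Paths as linked lists, and relaxation of edges. -/

/-- The cell `k` represents the list `p`. -/
def Rep (cv cn : ℤ → ℤ) : ℤ → List ℕ → Prop
  | k, [] => k = 0
  | k, v :: p => 0 < k ∧ cv k = v ∧ 0 ≤ cn k ∧ cn k < k ∧ Rep cv cn (cn k) p

/-- Links lead to smaller cells, so cells above the first one are irrelevant. New cells never
disturb stored paths, and paths can share tails. -/
theorem Rep.congr {cv cn cv' cn' : ℤ → ℤ} {b : ℤ} (h1 : ∀ k ≤ b, cv' k = cv k)
    (h2 : ∀ k ≤ b, cn' k = cn k) {k : ℤ} {p : List ℕ} (hk : k ≤ b) (h : Rep cv cn k p) :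
    Rep cv' cn' k p := by
  induction p generalizing k with
  | nil => exact h
  | cons v p ih =>
    obtain ⟨h3, h4, h5, h6, h7⟩ := h
    refine ⟨h3, (h1 k hk).trans h4, ?_, ?_, ?_⟩
    · rwa [h2 k hk]
    · rwa [h2 k hk]
    · rw [h2 k hk]; exact ih (by omega) h7

/-- The current values of the nodes. -/
def St.d (σ : St) (x : ℕ) : WithTop ℤ := if σ.arr aPtr x = 0 then ⊤ else (σ.arr aD x : ℤ)

/-- Every finite value is the weight of a path that is stored in the list cells. -/
structure Sound (I : Inst) (C : Ctx) (σ : St) : Prop where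
  cnt_nonneg : 0 ≤ σ.vars vCnt
  cnt_le : σ.vars vCnt ≤ σ.clock
  cell : ∀ x < I.N, σ.arr aPtr x = 0 ∨ (0 < σ.arr aPtr x ∧ σ.arr aPtr x ≤ σ.vars vCnt ∧
    |σ.arr aD x| ≤ σ.arr aPtr x * C.W ∧
    ∃ p, Rep (σ.arr aCv) (σ.arr aCn) (σ.arr aPtr x) p ∧ I.Good x p (σ.arr aD x))

theorem Sound.of_eq {I : Inst} {C : Ctx} {σ σ' : St} (h : Sound I C σ)
    (h1 : σ'.vars vCnt = σ.vars vCnt) (h2 : σ'.arr aPtr = σ.arr aPtr) (h3 : σ'.arr aD = σ.arr aD)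
    (h4 : σ'.arr aCv = σ.arr aCv) (h5 : σ'.arr aCn = σ.arr aCn) (h6 : σ.clock ≤ σ'.clock) :
    Sound I C σ' := by
  have := h.cnt_le
  refine ⟨h1 ▸ h.cnt_nonneg, by omega, ?_⟩
  rw [h1, h2, h3, h4, h5]
  exact h.cell

/-- `c` does not affect the values and the list cells. -/
def Cmd.keepsValues (c : Cmd) : Bool :=
  c.keepsVar vCnt && [aD, aPtr, aCv, aCn].all fun k => c.keepsArr k

theorem Sound.frame {I : Inst} {C : Ctx} {σ σ' : St} {c : Cmd} (h : Sound I C σ)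
    (hf : Frame c σ σ') (hc : c.keepsValues = true) : Sound I C σ' := by
  simp only [Cmd.keepsValues, Bool.and_eq_true, List.all_eq_true] at hc
  have ha : ∀ k ∈ [aD, aPtr, aCv, aCn], σ'.arr k = σ.arr k := fun k hk => hf.arr k (hc.2 k hk)
  exact h.of_eq (hf.var _ hc.1) (ha _ (by simp)) (ha _ (by simp)) (ha _ (by simp))
    (ha _ (by simp)) hf.clock

theorem d_congr {σ σ' : St} (h1 : σ'.arr aPtr = σ.arr aPtr) (h2 : σ'.arr aD = σ.arr aD) :
    σ'.d = σ.d := by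
  funext x
  unfold St.d
  rw [h1, h2]

/-- A new list cell for the node `vX`. -/
def newCell : Cmd :=
  vCnt ≔ ♯vCnt + 1 ⨟ .write aCv ♯vCnt ♯vA ⨟ .write aCn ♯vCnt ♯vNx ⨟ .write aPtr ♯vX ♯vCnt ⨟
    .write aD ♯vX ♯vCand ⨟ vChg ≔ 1

/-- The value of `x` is improved to `vCand` if that is less; the first vertex of the new path is
`vA` and the rest is in the cell `vNx`. -/
def improve : Cmd :=
  vF ≔ 1 ⨟
  .cond (.get aPtr ♯vX) (.cond (.get aD ♯vX - ♯vCand) .skip (vF ≔ 0)) .skip ⨟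
  .cond ♯vF newCell .skip

/-- `σ'` arises from `σ` by lowering the value of `x` to `c`, unless it is at most `c`. -/
structure Improved (I : Inst) (C : Ctx) (x : ℕ) (c : ℤ) (σ σ' : St) : Prop where
  sound : Sound I C σ'
  off : ∀ z : ℕ, z ≠ x → σ'.arr aPtr z = σ.arr aPtr z ∧ σ'.arr aD z = σ.arr aD z
  at_x : (σ'.vars vChg = σ.vars vChg ∧ σ'.arr aPtr = σ.arr aPtr ∧ σ'.arr aD = σ.arr aD ∧
      σ.d x ≤ c) ∨
    (σ'.vars vChg = 1 ∧ σ'.arr aPtr x ≠ 0 ∧ σ'.arr aD x = c ∧ (c : WithTop ℤ) < σ.d x)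

/-- The tail is an older cell `k`, so the new cell has a number of at least `k + 1`, and `hc`
preserves the bound of values by cell numbers in `Sound`. As there are at most as many cells as
clock units, the candidate also respects `C.bd`, even if a negative cycle keeps lowering the values.
-/
theorem improve_spec {I : Inst} {C : Ctx} (hE : Enc I C) {σ : St} (hs : Sound I C σ) {x a : ℕ}
    {c k : ℤ} {p : List ℕ} (hx : x < I.N) (hvx : σ.vars vX = x) (hva : σ.vars vA = a)
    (ha : a < I.n) (hvc : σ.vars vCand = c) (hvn : σ.vars vNx = k) (hk : k ≤ σ.vars vCnt)
    (hk0 : 0 ≤ k) (hp : Rep (σ.arr aCv) (σ.arr aCn) k p) (hg : I.Good x (a :: p) c)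
    (hc : |c| ≤ (k + 1) * C.W) :
    wp C improve (fun σ' => σ'.clock ≤ σ.clock + 8 ∧ Improved I C x c σ σ') σ := by
  have hW := hE.one_le_W
  have hA := hE.len_le_A
  have hcnt := hs.cnt_le
  have hcnt0 := hs.cnt_nonneg
  have hn := I.n_pos
  have hnn : I.n ≤ I.n * I.n := Nat.le_mul_of_pos_left _ hn
  have same : ∀ z : ℤ, σ.d x ≤ (c : WithTop ℤ) →
      Improved I C x c σ ((σ.setVar vF z).setVar vF 0) := fun z h =>
    ⟨hs.of_eq (by simp) rfl rfl rfl rfl (by simp; omega), fun _ _ => ⟨rfl, rfl⟩,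
      .inl ⟨by simp, rfl, rfl, h⟩⟩
  have upd : ∀ τ : St, τ.vars vX = x → τ.vars vA = a → τ.vars vCand = c → τ.vars vNx = k →
      τ.vars vCnt = σ.vars vCnt → τ.vars vF = 1 → τ.arr = σ.arr → τ.clock = σ.clock + 1 →
      (c : WithTop ℤ) < σ.d x →
      wp C newCell (fun σ' => σ'.clock ≤ σ.clock + 8 ∧ Improved I C x c σ σ') τ := by
    intro τ h1 h2 h3 h4 h5 h6 h7 h8 h9
    have b1 : ∀ i : ℕ, |σ.vars vCnt + 1| ≤ C.bd (σ.clock + 1 + i) := fun i =>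
      Ctx.le_bd hW _ (by omega) (by omega)
    have b2 : ∀ i : ℕ, |(a : ℤ)| ≤ C.bd (σ.clock + i) := fun i =>
      Ctx.le_bd hW _ (by omega) (by omega)
    have b3 : ∀ i : ℕ, |k| ≤ C.bd (σ.clock + i) := fun i => Ctx.le_bd hW _ (by omega) (by omega)
    have b4 : ∀ i : ℕ, |c| ≤ C.bd (σ.clock + 1 + i) := fun i => by
      refine hc.trans ?_
      unfold Ctx.bd
      rw [mul_comm]
      refine mul_le_mul_of_nonneg_left ?_ (Int.natCast_nonneg _)
      push_cast
      omega
    have b5 : ∀ i : ℕ, |(1 : ℤ)| ≤ C.bd (σ.clock + i) := fun i =>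
      Ctx.le_bd hW _ (by omega) (by omega)
    simp only [newCell, wp_seq, wp_assign, wp_write, Expr.ok, Expr.eval, Expr.ok_add,
      Expr.eval_add, Expr.eval_one, h6, setVar_vars, setVar_arr, setArr_vars, setArr_arr,
      setVar_clock, setArr_clock, h1, h2, h3, h4, h5, h7, h8, Nat.reduceEqDiff, if_true, if_false,
      add_assoc, Nat.reduceAdd, true_and, reduceIte, Nat.cast_one]
    refine ⟨b1 0, by omega, b2 2, by omega, b3 3, by omega, b1 3, by omega, b4 4, b5 6,
      by omega, ⟨by simp; omega, by simp; omega, ?_⟩, ?_, .inr ⟨by simp, ?_, ?_, h9⟩⟩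
    · intro z hz
      by_cases hzx : z = x
      · subst hzx
        right
        simp only [setVar_vars, setVar_arr, setArr_vars, setArr_arr, Function.update_self, h7,
          Fin.reduceEq, if_true, if_false, reduceIte, Nat.reduceEqDiff]
        refine ⟨by omega, le_rfl, hc.trans (by gcongr), a :: p, ⟨by omega, by simp, ?_, ?_,
          ?_⟩, hg⟩
        · rw [Function.update_self]; exact hk0
        · rw [Function.update_self]; omega
        · rw [Function.update_self]
          refine hp.congr (b := σ.vars vCnt) (fun i hi => ?_) (fun i hi => ?_) hk <;>
            exact Function.update_of_ne (by omega) _ _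
      · have hzx' : (z : ℤ) ≠ x := by exact_mod_cast hzx
        simp only [setVar_vars, setVar_arr, setArr_vars, setArr_arr, h7,
          Fin.reduceEq, if_true, if_false, reduceIte, Nat.reduceEqDiff,
          Function.update_of_ne hzx']
        obtain h0 | ⟨h10, h11, h12, q, h13, h14⟩ := hs.cell z hz
        · exact .inl h0
        · refine .inr ⟨h10, by omega, h12, q, ?_, h14⟩
          refine h13.congr (b := σ.vars vCnt) (fun i hi => ?_) (fun i hi => ?_) h11 <;>
            exact Function.update_of_ne (by omega) _ _
    · intro z hz
      have hzx' : (z : ℤ) ≠ x := by exact_mod_cast hz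
      simp [h7, Function.update_of_ne hzx']
    · simp; omega
    · simp
  have b5 : ∀ i : ℕ, |(1 : ℤ)| ≤ C.bd (σ.clock + i) := fun i =>
    Ctx.le_bd hW _ (by omega) (by omega)
  have b6 : ∀ i : ℕ, |(0 : ℤ)| ≤ C.bd (σ.clock + i) := fun i =>
    Ctx.le_bd hW _ (by omega) (by omega)
  rw [improve, wp_seq, wp_assign, wp_seq]
  simp only [wp_cond, wp_assign, wp_skip, Expr.ok, Expr.eval, Expr.eval_one, Expr.eval_sub,
      Expr.ok_sub,
    setVar_vars, setVar_arr, setVar_clock, hvx, hvc, Nat.reduceEqDiff, if_true, if_false,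
    true_and, reduceIte, Nat.cast_one, Nat.cast_zero, and_true]
  have hx0 : (0 : ℤ) ≤ x := Int.natCast_nonneg _
  refine ⟨b5 0, hx0, fun hpos => ⟨hx0, fun hlt => ⟨fun _ => ?_, by omega⟩,
    fun hle => ⟨b6 1, by omega, fun _ => ⟨by omega, ?_⟩⟩⟩, fun hle => ⟨fun _ => ?_, by omega⟩⟩
  · refine upd _ (by simp [hvx]) (by simp [hva]) (by simp [hvc]) (by simp [hvn]) (by simp)
      (by simp) rfl rfl ?_
    rw [St.d, if_neg (by omega)]
    exact_mod_cast (by omega : c < σ.arr aD x)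
  · exact same 1 (by rw [St.d, if_neg (by omega)]; exact_mod_cast (by omega : σ.arr aD x ≤ c))
  · refine upd _ (by simp [hvx]) (by simp [hva]) (by simp [hvc]) (by simp [hvn]) (by simp)
      (by simp) rfl rfl ?_
    have : σ.arr aPtr x = 0 := by
      obtain h | h := hs.cell x hx
      · exact h
      · omega
    rw [St.d, if_pos this]
    exact WithTop.coe_lt_top c

def srcOf (e : Expr) : Expr := .inp (♯vTb + e + e + e)
def labOf (e : Expr) : Expr := .inp (♯vTb + e + e + e + 1)
def tgtOf (e : Expr) : Expr := .inp (♯vTb + e + e + e + 2)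

/-- Improve the value of the node where the transition `vE` can be taken, through the next
vertex `vU`. -/
def relax : Cmd :=
  vA ≔ labOf ♯vE ⨟
  vX ≔ .get aQn (srcOf ♯vE) + ♯vA ⨟
  vY ≔ .get aQn (tgtOf ♯vE) + ♯vU ⨟
  .cond (.inp (.get aRow ♯vA + ♯vU))
    (.cond (.get aPtr ♯vY)
      (vCand ≔ .get aD ♯vY + .inp (.get aRow ♯vA + ♯vNn + ♯vU) ⨟ vNx ≔ .get aPtr ♯vY ⨟ improve)
      .skip)
    .skip

/-- The case of a change keeps a path lighter than the old value, which Bellman-Ford uses as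
evidence against a minimum. The equation for `c` is what Dijkstra's algorithm combines with
non-negative weights. -/
structure Relaxed (I : Inst) (C : Ctx) (e u : ℕ) (σ σ' : St) : Prop where
  sound : Sound I C σ'
  x : σ'.vars vX = I.xs e
  off : ∀ z : ℕ, z ≠ I.xs e → σ'.arr aPtr z = σ.arr aPtr z ∧ σ'.arr aD z = σ.arr aD z
  le : I.adj (I.lab e) u → σ'.d (I.xs e) ≤ σ.d (I.yt e u) + (I.w (I.lab e) u : ℤ)
  at_x : (σ'.vars vChg = σ.vars vChg ∧ σ'.arr aPtr = σ.arr aPtr ∧ σ'.arr aD = σ.arr aD) ∨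
    (σ'.vars vChg = 1 ∧ σ'.arr aPtr (I.xs e) ≠ 0 ∧ I.adj (I.lab e) u ∧ ∃ c p, I.Good (I.xs e) p c ∧
      (c : WithTop ℤ) = σ.d (I.yt e u) + (I.w (I.lab e) u : ℤ) ∧ σ'.d (I.xs e) = c ∧
      (c : WithTop ℤ) < σ.d (I.xs e))

theorem Static.setVar {I : Inst} {σ : St} (h : Static I σ) (x : ℕ) (z : ℤ) (hx : 10 ≤ x) :
    Static I (σ.setVar x z) := by
  have hv : ∀ y < 10, (σ.setVar x z).vars y = σ.vars y := fun y hy => by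
    rw [setVar_vars, if_neg (by omega)]
  constructor
  case row => exact h.row
  case qn => exact h.qn
  case qof => exact h.qof
  case vof => exact h.vof
  all_goals rw [hv _ (by norm_num)]
  exacts [h.n, h.nq, h.m, h.q0, h.s, h.t, h.tb, h.nn, h.N]

theorem relax_spec {I : Inst} {C : Ctx} (hE : Enc I C) {σ : St} (hst : Static I σ)
    (hs : Sound I C σ) {e u : ℕ} (he : e < I.m) (hu : u < I.n) (hve : σ.vars vE = e)
    (hvu : σ.vars vU = u) :
    wp C relax (fun σ' => σ'.clock ≤ σ.clock + 13 ∧ Relaxed I C e u σ σ') σ := by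
  have hW := hE.one_le_W
  have hA := hE.len_le_A
  have hA' := hE.N_le_A
  have hcnt := hs.cnt_le
  have hl := I.lab_lt e he
  have hnn : I.n ≤ I.n * I.n := Nat.le_mul_of_pos_left _ I.n_pos
  have hx := I.xs_lt he
  have hy := I.yt_lt he hu
  have hx0 : (0 : ℤ) ≤ (I.xs e : ℕ) := Int.natCast_nonneg _
  have hy0 : (0 : ℤ) ≤ (I.yt e u : ℕ) := Int.natCast_nonneg _
  have e1 : I.qn (I.src e) + (I.lab e : ℕ) = (I.xs e : ℕ) := I.qn_add _ _
  have e2 : I.qn (I.tgt e) + u = (I.yt e u : ℕ) := I.qn_add _ _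
  have t1 := I.tb_nonneg
  have t2 := I.row_nonneg (I.lab e)
  have t3 := I.nn_nonneg
  have b : ∀ (z : ℤ) (i : ℕ), 0 ≤ z → z ≤ C.A → |z| ≤ C.bd (σ.clock + i) := fun z i h1 h2 =>
    Ctx.le_bd hW _ (by omega) (by omega)
  have n1 : 0 ≤ I.tb + e + e + e := by omega
  have n2 : 0 ≤ I.tb + e + e + e + 1 := by omega
  have n3 : 0 ≤ I.tb + e + e + e + 2 := by omega
  have n4 : 0 ≤ I.row (I.lab e) + u := by omega
  have n5 : 0 ≤ I.row (I.lab e) + I.nn + u := by omega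
  simp only [relax, labOf, srcOf, tgtOf, wp_cond, wp_seq, wp_assign, wp_skip, Expr.ok, Expr.eval,
    Expr.ok_add, Expr.eval_add, Expr.ok_ofNat,
    Expr.eval_one, setVar_vars, setVar_arr, setVar_clock, Nat.reduceEqDiff, if_true, if_false,
    Nat.add_assoc, Nat.reduceAdd, true_and, and_true, reduceIte, Nat.cast_one, Nat.cast_ofNat,
    hst.tb, hve, hvu, hst.nn, hE.src e he, hE.lab e he, hE.tgt e he, hst.row _ hl,
    hst.qn _ (I.src_lt e he), hst.qn _ (I.tgt_lt e he), e1, e2, n1, n2, n3, n4, n5, hx0, hy0,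
    Int.natCast_nonneg, hE.adj _ hl u hu]
  have triv : ∀ σ' : St, σ'.vars vCnt = σ.vars vCnt → σ'.arr = σ.arr → σ.clock ≤ σ'.clock →
      σ'.vars vX = I.xs e → σ'.vars vChg = σ.vars vChg →
      (I.adj (I.lab e) u → σ.d (I.yt e u) = ⊤) → Relaxed I C e u σ σ' := by
    intro σ' h1 h2 h3 h4 h5 h6
    refine ⟨hs.of_eq h1 ?_ ?_ ?_ ?_ h3, h4, fun _ _ => by rw [h2]; exact ⟨rfl, rfl⟩,
      fun h => ?_, .inl ⟨h5, ?_, ?_⟩⟩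
    any_goals rw [h2]
    rw [h6 h, WithTop.top_add]; exact le_top
  have hnadj : ∀ z : ℤ, (0 < z ↔ I.adj (I.lab e) u) → z ≤ 0 → ¬ I.adj (I.lab e) u :=
    fun z h1 h2 h3 => absurd (h1.2 h3) (by omega)
  refine ⟨b _ 0 (by omega) (by omega), b _ 1 (by omega) (by omega), b _ 2 (by omega) (by omega),
    fun hadj => ⟨fun hpos => ?_, fun hle => ⟨by omega,
    triv _ (by simp) rfl (by simp; omega) (by simp) (by simp)
      fun _ => ?_⟩⟩, fun hle => ⟨by omega, triv _ (by simp) rfl (by simp; omega) (by simp) (by simp)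
      fun h => absurd h (hnadj _ (hE.adj _ hl u hu) hle)⟩⟩
  · obtain h0 | ⟨_, h11, h12, q, h13, h14⟩ := hs.cell _ hy
    · omega
    have hw := hE.w _ hl u hu hadj
    have hwle := hE.w_le _ hl u hu hadj
    have hdy : σ.d (I.yt e u) = (σ.arr aD (I.yt e u : ℕ) : ℤ) := by rw [St.d, if_neg (by omega)]
    rw [hw]
    have hc : |σ.arr aD (I.yt e u : ℕ) + I.w (I.lab e) u| ≤
        (σ.arr aPtr (I.yt e u : ℕ) + 1) * C.W := by
      refine (abs_add_le _ _).trans ?_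
      rw [add_mul, one_mul]
      exact add_le_add h12 hwle
    refine ⟨hc.trans ?_, Ctx.le_bd hW _ (by omega) (by push_cast; omega), ?_⟩
    · unfold Ctx.bd
      rw [mul_comm]
      refine mul_le_mul_of_nonneg_left ?_ (Int.natCast_nonneg _)
      push_cast
      omega
    refine wp_frame (improve_spec hE (x := I.xs e) (a := I.lab e)
      (c := σ.arr aD (I.yt e u : ℕ) + I.w (I.lab e) u) (k := σ.arr aPtr (I.yt e u : ℕ)) (p := q)
      ?_ hx ?_ ?_ hl ?_ ?_ ?_ hpos.le h13 (.step e u q _ he hu hadj h14) hc) ?_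
    · exact hs.of_eq (by simp) rfl rfl rfl rfl (by simp; omega)
    · simp
    · simp
    · simp
    · simp
    · simpa using h11
    rintro σ' ⟨hcl, hi⟩ hf
    simp only [setVar_clock] at hcl
    have hd : (σ.arr aD (I.yt e u : ℕ) + I.w (I.lab e) u : ℤ) =
        σ.d (I.yt e u) + (I.w (I.lab e) u : WithTop ℤ) := by rw [hdy]; push_cast; rfl
    refine ⟨by omega, hi.sound, ?_, hi.off, fun _ => ?_, ?_⟩
    · rw [hf.var vX rfl]; simp
    · rw [← hd]
      obtain ⟨_, h2, h3, h4⟩ | ⟨_, h2, h3, h4⟩ := hi.at_x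
      · rw [d_congr h2 h3]
        exact h4
      · rw [St.d, if_neg h2, h3]
    · obtain ⟨h1, h2, h3, h4⟩ | ⟨h1, h2, h3, h4⟩ := hi.at_x
      · exact .inl ⟨by simpa using h1, h2, h3⟩
      · refine .inr ⟨h1, h2, hadj, _, _, .step e u q _ he hu hadj h14, hd, ?_, h4⟩
        rw [St.d, if_neg h2, h3]
  · rw [St.d, if_pos]
    obtain h0 | h0 := hs.cell _ hy <;> omega

theorem Improved.le {I : Inst} {C : Ctx} {x : ℕ} {c : ℤ} {σ σ' : St} (h : Improved I C x c σ σ')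
    (z : ℕ) : σ'.d z ≤ σ.d z := by
  by_cases hz : z = x
  · subst hz
    obtain ⟨_, h2, h3, _⟩ | ⟨_, h2, h3, h4⟩ := h.at_x
    · rw [d_congr h2 h3]
    · rw [St.d, if_neg h2, h3]; exact h4.le
  · unfold St.d
    rw [(h.off z hz).1, (h.off z hz).2]

theorem Improved.le_at {I : Inst} {C : Ctx} {x : ℕ} {c : ℤ} {σ σ' : St}
    (h : Improved I C x c σ σ') : σ'.d x ≤ (c : WithTop ℤ) := by
  obtain ⟨_, h2, h3, h4⟩ | ⟨_, h2, h3, h4⟩ := h.at_x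
  · rw [d_congr h2 h3]; exact h4
  · rw [St.d, if_neg h2, h3]

theorem Relaxed.d_off {I : Inst} {C : Ctx} {e u : ℕ} {σ σ' : St} (h : Relaxed I C e u σ σ')
    {z : ℕ} (hz : z ≠ I.xs e) : σ'.d z = σ.d z := by
  unfold St.d
  rw [(h.off z hz).1, (h.off z hz).2]

theorem Relaxed.d_le {I : Inst} {C : Ctx} {e u : ℕ} {σ σ' : St} (h : Relaxed I C e u σ σ')
    (z : ℕ) : σ'.d z ≤ σ.d z := by
  by_cases hz : z = I.xs e
  · subst hz
    obtain ⟨_, h2, h3⟩ | ⟨_, _, _, c, p, _, _, h3, h4⟩ := h.at_x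
    · rw [d_congr h2 h3]
    · rw [h3]; exact h4.le
  · exact (h.d_off hz).le

/-- Relax transition `vE` for all next vertices. -/
def relaxAll : Cmd := .for vU vN relax

/-- In `le` the right-hand side has the values before the loop over `u`. Values only decrease, so
this is valid even if the node is its own successor. -/
structure RelaxedAll (I : Inst) (C : Ctx) (e k : ℕ) (σ σ' : St) : Prop where
  sound : Sound I C σ'
  off : ∀ z : ℕ, z ≠ I.xs e → σ'.d z = σ.d z
  d_le : ∀ z, σ'.d z ≤ σ.d z
  le : ∀ u < k, I.adj (I.lab e) u → σ'.d (I.xs e) ≤ σ.d (I.yt e u) + (I.w (I.lab e) u : ℤ)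
  chg : (σ'.vars vChg = σ.vars vChg ∧ σ'.d = σ.d) ∨
    (σ'.vars vChg = 1 ∧ ∃ c p, I.Good (I.xs e) p c ∧ (c : WithTop ℤ) < σ.d (I.xs e))

theorem relaxAll_spec {I : Inst} {C : Ctx} (hE : Enc I C) {σ : St} (hst : Static I σ)
    (hs : Sound I C σ) {e : ℕ} (he : e < I.m) (hve : σ.vars vE = e) :
    wp C relaxAll (fun σ' => σ'.clock ≤ σ.clock + (1 + 14 * I.n) ∧ RelaxedAll I C e I.n σ σ')
      σ := by
  have hA := hE.len_le_A
  have hnn : I.n ≤ I.n * I.n := Nat.le_mul_of_pos_left _ I.n_pos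
  refine wp_for hE.one_le_W I.n 13 (fun k σ' => RelaxedAll I C e k σ σ') (by omega) (by decide)
    hst.n rfl rfl ?_ ?_ ?_
  · exact ⟨hs.of_eq (by simp) rfl rfl rfl rfl (by simp), fun _ _ => rfl, fun _ => le_rfl,
      fun u hu => absurd hu (Nat.not_lt_zero _), .inl ⟨by simp, rfl⟩⟩
  · intro k hk σ' hf hvk hR
    refine wp_mono (relax_spec hE (hst.frame hf rfl) hR.sound he hk
      ((hf.var vE rfl).trans hve) hvk) ?_
    rintro σ'' ⟨hcl, hx⟩
    refine ⟨hcl, hx.sound.of_eq (by simp) rfl rfl rfl rfl (by simp), fun z hz => ?_, fun z => ?_,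
      fun u hu hadj => ?_, ?_⟩
    · exact (hx.d_off hz).trans (hR.off z hz)
    · exact (hx.d_le z).trans (hR.d_le z)
    · obtain hu | rfl := Nat.lt_succ_iff_lt_or_eq.1 hu
      · exact (hx.d_le _).trans (hR.le u hu hadj)
      · refine (hx.le hadj).trans ?_
        gcongr
        exact hR.d_le _
    · rw [setVar_vars, if_neg (by decide)]
      obtain ⟨h1, h2, h3⟩ | ⟨h1, _, _, c, p, h2, _, _, h3⟩ := hx.at_x
      · rw [h1]
        change (_ ∧ σ''.d = _) ∨ _
        rw [d_congr h2 h3]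
        exact hR.chg
      · exact .inr ⟨h1, c, p, h2, h3.trans_le (hR.d_le _)⟩
  · intro σ' _ hR hcl
    exact ⟨by omega, hR⟩

/-! ### Reading the input -/

def St.init : St := ⟨fun _ => 0, fun _ _ => 0, [], 0⟩

/-- The machine can neither multiply nor divide. Multiples of `n` are accumulated by addition, `n *
n` is the distance that the row pointer has moved, and the tables `aQof` and `aVof` split a node
into state and vertex. -/
def prologue : Cmd :=
  vN ≔ .inp 0 ⨟ vQ ≔ .inp 1 ⨟ vM ≔ .inp 2 ⨟ vQz ≔ .inp 3 ⨟ vS ≔ .inp 4 ⨟ vT ≔ .inp 5 ⨟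
  vTb ≔ 6 + ♯vQ ⨟ vAb ≔ ♯vTb + ♯vM + ♯vM + ♯vM ⨟
  vX ≔ ♯vAb ⨟
  .for vI vN (.write aRow ♯vI ♯vX ⨟ vX ≔ ♯vX + ♯vN) ⨟
  vNn ≔ ♯vX - ♯vAb ⨟
  vX ≔ 0 ⨟
  .for vI vQ (.write aQn ♯vI ♯vX ⨟
    .for vJ vN (.write aQof ♯vX ♯vI ⨟ .write aVof ♯vX ♯vJ ⨟ vX ≔ ♯vX + 1)) ⨟
  vNd ≔ ♯vX

theorem prologue_spec {I : Inst} {C : Ctx} (hE : Enc I C) :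
    wp C prologue (fun σ => σ.clock ≤ 26 * I.N ∧ Static I σ) St.init := by
  have hW := hE.one_le_W
  have hA := hE.len_le_A
  have hA' := hE.N_le_A
  have hn := I.n_pos
  have hnn : I.n ≤ I.n * I.n := Nat.le_mul_of_pos_left _ I.n_pos
  have b : ∀ (z : ℤ) (i : ℕ), 0 ≤ z → z ≤ C.A → |z| ≤ C.bd i := fun z i h1 h2 =>
    Ctx.le_bd hW _ (by omega) (by omega)
  have l1 := I.q0_lt; have l2 := I.s_lt; have l3 := I.t_lt
  have e1 : I.tb + I.m + I.m + I.m = I.ab := rfl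
  have e2 : 6 + (I.nq : ℤ) = I.tb := rfl
  have e3 : I.ab = 6 + I.nq + I.m + I.m + I.m := rfl
  have hN : I.N = I.nq * I.n := rfl
  have hN1 : I.nq ≤ I.N := Nat.le_mul_of_pos_right _ hn
  have hN2 : I.n ≤ I.N := Nat.le_mul_of_pos_left _ (by omega)
  -- The loops are treated from an arbitrary state after the nine initial assignments.
  have key : ∀ τ : St, τ.vars vN = I.n → τ.vars vQ = I.nq → τ.vars vM = I.m →
      τ.vars vQz = I.q0 → τ.vars vS = I.s → τ.vars vT = I.t → τ.vars vTb = I.tb →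
      τ.vars vAb = I.ab → τ.vars vX = I.ab → τ.clock = 9 →
      wp C (.for vI vN (.write aRow ♯vI ♯vX ⨟ vX ≔ ♯vX + ♯vN) ⨟
        vNn ≔ ♯vX - ♯vAb ⨟
        vX ≔ 0 ⨟
        .for vI vQ (.write aQn ♯vI ♯vX ⨟
          .for vJ vN (.write aQof ♯vX ♯vI ⨟ .write aVof ♯vX ♯vJ ⨟ vX ≔ ♯vX + 1)) ⨟
        vNd ≔ ♯vX) (fun σ => σ.clock ≤ 26 * I.N ∧ Static I σ) τ := by
    intro τ v0 v1 v2 v3 v4 v5 v6 v7 v12 hcl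
    rw [wp_seq]
    refine wp_for hW I.n 2 (fun k σ => σ.vars vX = I.row k ∧ ∀ v < k, σ.arr aRow v = I.row v)
      (by omega) (by decide) v0 rfl rfl ⟨by simp [Inst.row, v12], fun v hv =>
        absurd hv (Nat.not_lt_zero _)⟩ ?_ ?_
    · rintro k hk σ hf hi ⟨hx, hr⟩
      have h1 := I.row_nonneg k
      have h2 : I.row k + I.n = I.row (k + 1) := by unfold Inst.row; push_cast; ring
      have h3 : I.row (k + 1) ≤ C.A := by
        unfold Inst.row
        have : (k + 1) * I.n ≤ I.n * I.n := Nat.mul_le_mul_right _ hk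
        omega
      simp only [wp_seq, wp_assign, wp_write, Expr.ok, Expr.eval, Expr.ok_add, Expr.eval_add,
        setVar_vars, setVar_arr, setVar_clock, setArr_vars, setArr_arr, setArr_clock,
        Nat.reduceEqDiff, if_true, if_false, true_and, and_true, reduceIte, hi, hx,
        (hf.var vN rfl).trans v0, h2, Int.natCast_nonneg]
      refine ⟨b _ _ h1 (by omega), b _ _ (by omega) h3, le_rfl, fun v hv => ?_⟩
      obtain hv | rfl := Nat.lt_succ_iff_lt_or_eq.1 hv
      · have : (v : ℤ) ≠ k := by omega
        rw [Function.update_of_ne this, hr v hv]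
      · rw [Function.update_self]
    rintro σ₁ hf₁ ⟨hx₁, hr₁⟩ hcl₁
    have h1 : I.row I.n - I.ab = I.nn := by unfold Inst.row Inst.nn; push_cast; ring
    have h2 : I.nn ≤ C.A := by unfold Inst.nn; exact_mod_cast (by omega : I.n * I.n ≤ C.A)
    simp only [wp_seq, wp_assign, Expr.ok, Expr.eval, Expr.ok_sub, Expr.eval_sub, Expr.ok_ofNat,
      Expr.eval_zero, setVar_vars, setVar_arr, setVar_clock, Nat.reduceEqDiff, if_true, if_false,
      true_and, and_true, reduceIte, hx₁, (hf₁.var vAb rfl).trans v7, h1, Nat.cast_zero]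
    refine ⟨b _ _ I.nn_nonneg h2, b _ _ le_rfl (by omega), ?_⟩
    refine wp_for hW I.nq (4 * I.n + 2) (fun k σ => σ.vars vX = (I.nd k 0 : ℕ) ∧
      (∀ q < k, σ.arr aQn q = I.qn q) ∧ (∀ q < k, ∀ v < I.n, σ.arr aQof (I.nd q v : ℕ) = q) ∧
      (∀ q < k, ∀ v < I.n, σ.arr aVof (I.nd q v : ℕ) = v))
      (by omega) (by decide) (by simp [(hf₁.var vQ rfl).trans v1]) rfl rfl
      ⟨by simp [Inst.nd], fun v hv => absurd hv (Nat.not_lt_zero _),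
        fun v hv => absurd hv (Nat.not_lt_zero _), fun v hv => absurd hv (Nat.not_lt_zero _)⟩ ?_ ?_
    · rintro k hk σ hf hi ⟨hx, hr1, hr2, hr3⟩
      have hvn : σ.vars vN = I.n := (hf.var vN rfl).trans (by simp [(hf₁.var vN rfl).trans v0])
      have hnd : I.nd k 0 < I.N := I.nd_lt hk hn
      simp only [wp_seq, wp_write, Expr.ok, Expr.eval, true_and, hi, hx, Int.natCast_nonneg]
      refine ⟨b _ _ (by omega) (by omega), ?_⟩
      -- The entries filled so far are those of the nodes before `(k, j)` in lexicographic order.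
      refine wp_for hW I.n 3 (fun j σ' => σ'.vars vX = (I.nd k j : ℕ) ∧
        (∀ q ≤ k, ∀ v < I.n, (q < k ∨ v < j) → σ'.arr aQof (I.nd q v : ℕ) = q) ∧
        (∀ q ≤ k, ∀ v < I.n, (q < k ∨ v < j) → σ'.arr aVof (I.nd q v : ℕ) = v))
        (by omega) (by decide) (by simp [hvn]) rfl rfl
        ⟨by simp [hx], fun q _ v hv hq => ?_, fun q _ v hv hq => ?_⟩ ?_ ?_
      · simpa using hr2 q (by omega) v hv
      · simpa using hr3 q (by omega) v hv
      · rintro j hj σ' hf' hi' ⟨hx', hs2, hs3⟩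
        have hnd' : I.nd k j < I.N := I.nd_lt hk hj
        have e4 : ((I.nd k j : ℕ) : ℤ) + 1 = (I.nd k (j + 1) : ℕ) := by
          unfold Inst.nd; push_cast; ring
        have hvi : σ'.vars vI = k := (hf'.var vI rfl).trans (by simp [hi])
        simp only [wp_seq, wp_assign, wp_write, Expr.ok, Expr.eval, Expr.ok_add, Expr.eval_add,
          Expr.eval_one, Expr.ok_ofNat, Nat.cast_one,
          setVar_vars, setVar_arr, setVar_clock, setArr_vars, setArr_arr, setArr_clock,
          Nat.reduceEqDiff, Fin.reduceEq, if_true, if_false, true_and, and_true, reduceIte, hi',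
          hx', hvi, e4, Int.natCast_nonneg]
        refine ⟨b _ _ (by omega) (by omega), b _ _ (by omega) (by omega),
          b _ _ (by omega) (by omega), by omega, ?_, ?_⟩
        · intro q hq v hv h
          by_cases heq : q = k ∧ v = j
          · rw [heq.1, heq.2, Function.update_self]
          · have : ((I.nd q v : ℕ) : ℤ) ≠ (I.nd k j : ℕ) := by
              intro h
              exact heq (I.nd_inj hv hj (by exact_mod_cast h))
            rw [Function.update_of_ne this]
            exact hs2 q hq v hv (by omega)
        · intro q hq v hv h
          by_cases heq : q = k ∧ v = j
          · rw [heq.2, heq.1, Function.update_self]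
          · have : ((I.nd q v : ℕ) : ℤ) ≠ (I.nd k j : ℕ) := by
              intro h
              exact heq (I.nd_inj hv hj (by exact_mod_cast h))
            rw [Function.update_of_ne this]
            exact hs3 q hq v hv (by omega)
      · rintro σ' hf' ⟨hx', hs2, hs3⟩ hcl'
        simp only [setArr_clock] at hcl'
        refine ⟨by omega, ?_, fun q hq => ?_, fun q hq v hv => ?_, fun q hq v hv => ?_⟩
        · simp [hx', Inst.nd, add_mul]
        · rw [setVar_arr, hf'.arr aQn rfl, setArr_arr, if_pos rfl]
          obtain hq | rfl := Nat.lt_succ_iff_lt_or_eq.1 hq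
          · have : (q : ℤ) ≠ k := by omega
            rw [Function.update_of_ne this, hr1 q hq]
          · rw [Function.update_self]
            simp [Inst.nd, Inst.qn]
        · exact hs2 q (by omega) v hv (by omega)
        · exact hs3 q (by omega) v hv (by omega)
    · rintro σ hf ⟨hx, hr1, hr2, hr3⟩ hcl₂
      have hv : ∀ x, x ≠ vX → x ≠ vI → x ≠ vJ → x ≠ vNn → σ.vars x = τ.vars x := by
        intro x h1 h2 h3 h4
        rw [hf.var x (by simp [Cmd.for, Cmd.keepsVar, h1, h2, h3])]
        simp only [setVar_vars, h1, h4, if_false]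
        exact hf₁.var x (by simp [Cmd.for, Cmd.keepsVar, h1, h2])
      have hxN : ((I.nd I.nq 0 : ℕ) : ℤ) = I.N := by simp [Inst.nd, Inst.N]
      simp only [wp_assign, Expr.ok, Expr.eval, true_and, hx, setVar_clock] at hcl₂ ⊢
      have : I.nq * (4 * I.n + 2 + 1) = 4 * I.N + 3 * I.nq := by rw [hN]; ring
      refine ⟨b _ _ (by omega) (by omega), by omega, ?_⟩
      have h8 : σ.vars vNn = I.nn := by rw [hf.var vNn rfl]; simp
      have h0 : σ.arr aRow = σ₁.arr aRow := by rw [hf.arr aRow rfl]; simp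
      constructor
      case N => simp [hxN]
      case row => simpa [h0] using hr₁
      case qn => exact hr1
      case qof => exact hr2
      case vof => exact hr3
      case nn => simpa using h8
      all_goals
        simp only [setVar_vars, Nat.reduceEqDiff, if_false]
        rw [hv _ (by decide) (by decide) (by decide) (by decide)]
        assumption
  simp only [prologue, wp_seq, wp_assign, Expr.ok, Expr.eval, Expr.ok_add, Expr.eval_add,
    Expr.ok_ofNat, Expr.eval_zero, Expr.eval_one, Expr.eval_ofNat, setVar_vars, setVar_arr,
    setVar_clock,
    Nat.reduceEqDiff, if_true, if_false, Nat.add_assoc, Nat.reduceAdd, true_and, and_true,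
    reduceIte, hE.n, hE.nq, hE.m, hE.q0, hE.s, hE.t, e1, e2, Nat.cast_one, Nat.cast_ofNat,
    Nat.cast_zero] at key ⊢
  refine ⟨le_rfl, b _ _ ?_ ?_, by omega, b _ _ ?_ ?_, by omega, b _ _ ?_ ?_, by omega, b _ _ ?_ ?_,
    by omega, b _ _ ?_ ?_, by omega, b _ _ ?_ ?_, b _ _ ?_ ?_, b _ _ ?_ ?_, b _ _ ?_ ?_,
    key _ ?_ ?_ ?_ ?_ ?_ ?_ ?_ ?_ ?_ ?_⟩
  all_goals first
    | omega
    | simp [St.init]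

/-! ### Initial values, and output of the path of the root. -/

/-- A correct output for the instance. -/
def _root_.Inst.IsAnswer (I : Inst) (out : List ℤ) : Prop :=
  (∃ p c, I.Good I.root p c ∧ (∀ p' c', I.Good I.root p' c' → c ≤ c') ∧
    out = p.map fun v : ℕ => (v : ℤ)) ∨
  ((¬ ∃ p c, I.Good I.root p c ∧ ∀ p' c', I.Good I.root p' c' → c ≤ c') ∧ out = [])

/-- Assign value `0` to the nodes where the path may end. -/
def seed : Cmd :=
  .for vE vM (vA ≔ labOf ♯vE ⨟
    .cond (.inp (6 + tgtOf ♯vE))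
      (.cond (♯vA - ♯vT) .skip (.cond (♯vT - ♯vA) .skip
        (vX ≔ .get aQn (srcOf ♯vE) + ♯vA ⨟ vCand ≔ 0 ⨟ vNx ≔ 0 ⨟ improve)))
      .skip)

theorem seed_spec {I : Inst} {C : Ctx} (hE : Enc I C) {σ : St} (hst : Static I σ)
    (hs : Sound I C σ) :
    wp C seed (fun σ' => σ'.clock ≤ σ.clock + (1 + 13 * I.m) ∧ Sound I C σ' ∧ I.Based σ'.d)
      σ := by
  have hW := hE.one_le_W
  have hA := hE.len_le_A
  have hA' := hE.N_le_A
  have hnn : I.n ≤ I.n * I.n := Nat.le_mul_of_pos_left _ I.n_pos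
  have b : ∀ (z : ℤ) (i : ℕ), 0 ≤ z → z ≤ C.A → |z| ≤ C.bd i := fun z i h1 h2 =>
    Ctx.le_bd hW _ (by omega) (by omega)
  refine wp_for hW I.m 12 (fun k σ => Sound I C σ ∧ ∀ e < k, I.lab e = I.t → I.acc (I.tgt e) →
    σ.d (I.xs e) ≤ 0) (by omega) (by decide) hst.m rfl rfl
    ⟨hs.of_eq (by simp) rfl rfl rfl rfl (by simp), fun v hv => absurd hv (Nat.not_lt_zero _)⟩
    ?_ fun σ' _ h hcl => ⟨by omega, h⟩
  rintro e he σ hf hve ⟨hs, hb⟩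
  replace hst := hst.frame hf rfl
  have hl := I.lab_lt e he
  have hx := I.xs_lt he
  have hx0 : (0 : ℤ) ≤ (I.xs e : ℕ) := Int.natCast_nonneg _
  have e1 : I.qn (I.src e) + (I.lab e : ℕ) = (I.xs e : ℕ) := I.qn_add _ _
  have t1 := I.tb_nonneg
  have n1 : 0 ≤ I.tb + e + e + e := by omega
  have n2 : 0 ≤ I.tb + e + e + e + 1 := by omega
  have n3 : 0 ≤ I.tb + e + e + e + 2 := by omega
  have n4 : 0 ≤ 6 + ((I.tgt e : ℕ) : ℤ) := by omega
  have ht := I.t_lt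
  simp only [labOf, srcOf, tgtOf, wp_cond, wp_seq, wp_assign, wp_skip, Expr.ok, Expr.eval,
    Expr.ok_add, Expr.eval_add, Expr.ok_sub, Expr.eval_sub, Expr.ok_ofNat, Expr.eval_zero,
    Expr.eval_ofNat,
    Expr.eval_one, setVar_vars, setVar_arr, setVar_clock, Nat.reduceEqDiff, if_true, if_false,
    Nat.add_assoc, Nat.reduceAdd, true_and, and_true, reduceIte, Nat.cast_one, Nat.cast_ofNat,
    Nat.cast_zero, hst.tb, hst.t, hve, hE.src e he, hE.lab e he, hE.tgt e he,
    hst.qn _ (I.src_lt e he), e1, n1, n2, n3, n4, hx0,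
    Int.natCast_nonneg, hE.acc _ (I.tgt_lt e he)]
  have triv : ∀ τ : St, τ.vars vCnt = σ.vars vCnt → τ.arr = σ.arr → σ.clock ≤ τ.clock →
      ¬ (I.lab e = I.t ∧ I.acc (I.tgt e)) → Sound I C τ ∧ ∀ e' < e + 1, I.lab e' = I.t →
        I.acc (I.tgt e') → τ.d (I.xs e') ≤ 0 := by
    intro τ h1 h2 h3 h4
    refine ⟨hs.of_eq h1 (by rw [h2]) (by rw [h2]) (by rw [h2]) (by rw [h2]) h3,
      fun e' he' h5 h6 => ?_⟩
    have hd : τ.d = σ.d := d_congr (by rw [h2]) (by rw [h2])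
    rw [hd]
    obtain he' | rfl := Nat.lt_succ_iff_lt_or_eq.1 he'
    · exact hb e' he' h5 h6
    · exact absurd ⟨h5, h6⟩ h4
  refine ⟨b _ _ (by omega) (by omega), fun hacc => ⟨fun h1 => ⟨by omega, triv _ ?_ ?_ ?_ ?_⟩,
    fun h1 => ⟨fun h2 => ⟨by omega, triv _ ?_ ?_ ?_ ?_⟩, fun h2 => ⟨b _ _ (by omega) (by omega),
      b _ _ le_rfl (by omega), b _ _ le_rfl (by omega), ?_⟩⟩⟩,
    fun hacc => ⟨by omega, triv _ ?_ ?_ ?_ ?_⟩⟩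
  any_goals first
    | rfl
    | (simp; done)
    | (simp; omega)
    | omega
  -- Two sign tests establish equality. The path consists of `t` alone: its tail is the empty list,
  -- which is cell 0, and its weight is 0.
  · have hlt : I.lab e = I.t := by omega
    refine wp_mono (improve_spec hE (x := I.xs e) (a := I.lab e) (c := 0) (k := 0) (p := [])
      ?_ hx ?_ ?_ hl ?_ ?_ ?_ le_rfl rfl (.base e he hlt hacc) ?_) ?_
    · exact hs.of_eq (by simp) rfl rfl rfl rfl (by simp; omega)
    · simp
    · simp
    · simp
    · simp
    · simpa using hs.cnt_nonneg
    · rw [abs_zero]; positivity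
    · rintro τ ⟨hcl, hi⟩
      simp only [setVar_clock] at hcl
      refine ⟨by omega, hi.sound.of_eq (by simp) rfl rfl rfl rfl (by simp), fun e' he' h5 h6 => ?_⟩
      change τ.d _ ≤ _
      obtain he' | rfl := Nat.lt_succ_iff_lt_or_eq.1 he'
      · exact (hi.le _).trans (hb e' he' h5 h6)
      · exact hi.le_at
  · intro ⟨_, h⟩
    exact absurd ((hE.acc _ (I.tgt_lt e he)).2 h) (by omega)

/-- Print the path of the root. -/
def output : Cmd :=
  vX ≔ .get aQn ♯vQz + ♯vS ⨟ vP ≔ .get aPtr ♯vX ⨟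
  .loop ♯vP (.print (.get aCv ♯vP) ⨟ vP ≔ .get aCn ♯vP)

/-- The fixed point puts the value of the root below the weight of every accepted path. Pointer 0
therefore means that there is none, and otherwise the stored path attains the minimum. Lists begin
at the root, so they are printed in path order; cell numbers drop, so there are at most `vCnt`
rounds of two time units. -/
theorem output_spec {I : Inst} {C : Ctx} (hE : Enc I C) {σ : St} (hst : Static I σ)
    (hs : Sound I C σ) (ho : σ.out = []) {S : ℕ → Prop} (hS : I.Closed S) (hroot : S I.root)
    (hfix : I.Fixed S σ.d) (hb : I.Based σ.d) :
    wp C output (fun σ' => (σ'.clock : ℤ) ≤ σ.clock + 2 + 2 * σ.vars vCnt ∧ I.IsAnswer σ'.out)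
      σ := by
  have hW := hE.one_le_W
  have hA' := hE.N_le_A
  have hcnt := hs.cnt_le
  have hcnt0 := hs.cnt_nonneg
  have hr := I.root_lt
  have e1 : I.qn I.q0 + I.s = (I.root : ℕ) := I.qn_add _ _
  have hmin : ∀ p c, I.Good I.root p c → σ.d I.root ≤ (c : WithTop ℤ) := fun p c h =>
    h.le_of_fixed hS hfix hb hroot
  simp only [output, wp_seq, wp_assign, Expr.ok, Expr.eval, Expr.ok_add, Expr.eval_add,
    setVar_vars, setVar_arr, setVar_clock, Nat.reduceEqDiff, if_true, if_false,
    Nat.add_assoc, Nat.reduceAdd, true_and, and_true, reduceIte, hst.q0, hst.s,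
    hst.qn _ I.q0_lt, e1, Int.natCast_nonneg]
  have hptr : σ.arr aPtr I.root ≤ σ.vars vCnt ∧ 0 ≤ σ.arr aPtr I.root ∧
      ∃ p, Rep (σ.arr aCv) (σ.arr aCn) (σ.arr aPtr I.root) p ∧
        I.IsAnswer (p.map fun v : ℕ => (v : ℤ)) := by
    obtain h0 | ⟨h1, h2, _, p, h3, h4⟩ := hs.cell _ hr
    · refine ⟨by omega, by omega, [], h0, .inr ⟨?_, rfl⟩⟩
      rintro ⟨p, c, h, _⟩
      have := hmin p c h
      rw [St.d, if_pos h0] at this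
      exact absurd this (WithTop.coe_lt_top c).not_ge
    · refine ⟨h2, h1.le, p, h3, .inl ⟨p, _, h4, fun p' c' h' => ?_, rfl⟩⟩
      have := hmin p' c' h'
      rw [St.d, if_neg (by omega)] at this
      exact_mod_cast this
  obtain ⟨h1, h0, p, h2, h3⟩ := hptr
  refine ⟨Ctx.le_bd hW _ (by omega) (by omega), Ctx.le_bd hW _ h0 (by push_cast; omega), ?_⟩
  refine wp_loop (fun τ => τ.arr = σ.arr ∧ 0 ≤ τ.vars vP ∧ τ.vars vP ≤ σ.vars vCnt ∧
    (τ.clock : ℤ) + 2 * τ.vars vP ≤ σ.clock + 2 + 2 * σ.vars vCnt ∧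
    ∃ l, Rep (σ.arr aCv) (σ.arr aCn) (τ.vars vP) l ∧

          τ.out ++ l.map (fun v : ℕ => (v : ℤ)) = p.map fun v : ℕ => (v : ℤ)) (fun τ => (τ.vars vP).toNat)
    ⟨rfl, by simpa using h0, by simpa using h1, by simp; omega, p, by simpa using h2,
      by simp [ho]⟩ ?_ ?_
  · rintro τ hf ⟨k1, k2, k3, k4, l, k5, k6⟩
    have hfc := hf.clock
    simp only [setVar_clock] at hfc
    refine ⟨trivial, fun hpos => ?_⟩
    simp only [Expr.eval] at hpos
    cases l with
    | nil => exact absurd k5 (by simp only [Rep]; omega)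
    | cons v l =>
      obtain ⟨k7, k8, k9, k10, k11⟩ := k5
      simp only [wp_seq, wp_print, wp_assign, Expr.ok, Expr.eval, true_and, emit_vars, emit_arr,
        emit_clock, emit_out, setVar_vars, setVar_arr, setVar_clock, setVar_out, reduceIte, k1, k8]
      refine ⟨k2, k2, Ctx.le_bd hW _ k9 (by push_cast; omega), ⟨k9, by omega, ?_, l, k11, ?_⟩,
        by omega, by omega⟩
      · push_cast; omega
      · rw [← k6]; simp
  · rintro τ hf ⟨k1, k2, k3, k4, l, k5, k6⟩ hle
    simp only [Expr.eval] at hle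
    refine ⟨by omega, ?_⟩
    have : l = [] := by
      cases l with
      | nil => rfl
      | cons v l => obtain ⟨k7, _⟩ := k5; omega
    subst this
    rw [List.map_nil, List.append_nil] at k6
    rwa [k6]

end HL

/-! ### Arbitrary weights: Bellman-Ford -/

namespace Inst

variable {I : Inst}

/-- There is an accepted path from `x` of minimal weight with `k` vertices. -/
def Best (I : Inst) (x k : ℕ) : Prop :=
  ∃ p c, I.Good x p c ∧ (∀ p' c', I.Good x p' c' → c ≤ c') ∧ p.length = k

/-- `k` is the least number of vertices of an accepted path from `x` of minimal weight. -/
def Level (I : Inst) (x k : ℕ) : Prop := I.Best x k ∧ ∀ j < k, ¬ I.Best x j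

theorem Level.unique {x j k : ℕ} (hj : I.Level x j) (hk : I.Level x k) : j = k := by
  by_contra h
  obtain h | h := Nat.lt_or_gt_of_ne h
  · exact hk.2 _ h hj.1
  · exact hj.2 _ h hk.1

/-- The tail of a minimal path is minimal at its own node, and a minimal tail with fewer vertices
would shorten the whole path. -/
theorem Level.pred {M : ℕ → Prop} (hM : I.Closed M) {x k : ℕ} (hx : M x) (hk : 0 < k)
    (h : I.Level x (k + 1)) : ∃ y, M y ∧ I.Level y k := by
  obtain ⟨⟨p, c, hg, hmin, hlen⟩, hless⟩ := h
  cases hg with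
  | base e he h1 h2 => simp at hlen; omega
  | step e u p c he hu hadj hg =>
    have hlen' : p.length = k := by simpa using hlen
    have hmin' : ∀ p' c', I.Good (I.yt e u) p' c' → c ≤ c' := fun p' c' h => by
      have := hmin _ _ (.step e u p' c' he hu hadj h)
      omega
    refine ⟨I.yt e u, hM e he u hu hadj hx, ⟨p, c, hg, hmin', hlen'⟩, ?_⟩
    rintro j hj ⟨p', c', hg', hmin'', hlen''⟩
    have : c' = c := le_antisymm (hmin'' _ _ hg) (hmin' _ _ hg')
    subst this
    exact hless (j + 1) (by omega) ⟨_, _, .step e u p' c' he hu hadj hg', hmin, by simp [hlen'']⟩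

/-- Going down from `x`, all levels from `k` to 1 occur, and they belong to different nodes because
the level of a node is unique. This pigeonhole argument takes the place of cutting out cycles. -/
theorem Level.le_N {M : ℕ → Prop} (hM : I.Closed M) {x k : ℕ} (hx : M x) (h : I.Level x k) :
    k ≤ I.N := by
  have key : ∀ i j, i + j + 1 = k → ∃ y, M y ∧ I.Level y (j + 1) := by
    intro i
    induction i with
    | zero => intro j hj; exact ⟨x, hx, by rwa [show j + 1 = k by omega]⟩
    | succ i ih =>
      intro j hj
      obtain ⟨y, hy, hl⟩ := ih (j + 1) (by omega)
      exact hl.pred hM hy (Nat.succ_pos j)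
  have key' : ∀ j < k, ∃ y, I.Level y (j + 1) := fun j hj =>
    let ⟨y, _, h⟩ := key (k - 1 - j) j (by omega)
    ⟨y, h⟩
  choose! f hf using key'
  have := Finset.card_le_card_of_injOn (s := Finset.range k) (t := Finset.range I.N) f
    (fun j hj => by
      obtain ⟨⟨p, c, hg, _⟩, _⟩ := hf j (by simpa using hj)
      simpa using hg.lt_N)
    (fun i hi j hj hij => by
      have h1 := hf i (by simpa using hi)
      have h2 := hf j (by simpa using hj)
      rw [hij] at h1
      have := h1.unique h2
      omega)
  simpa using this

/-- Every accepted path from `x` extends to one from the root, with constant difference of the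
weights. -/
def Reach (I : Inst) (x : ℕ) : Prop :=
  ∃ δ : ℤ, ∀ p c, I.Good x p c → ∃ p', I.Good I.root p' (c + δ)

theorem reach_root : I.Reach I.root := ⟨0, fun p c h => ⟨p, by simpa using h⟩⟩

theorem closed_reach : I.Closed I.Reach := by
  rintro e he u hu hadj ⟨δ, h⟩
  refine ⟨I.w (I.lab e) u + δ, fun p c hg => ?_⟩
  obtain ⟨p', h'⟩ := h _ _ (.step e u p c he hu hadj hg)
  exact ⟨p', by rwa [← add_assoc]⟩

/-- If the root has an accepted path of minimal weight, then every node in reach that has an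
accepted path has one of minimal weight with at most `N` vertices. -/
theorem exists_short {M : ℕ → Prop} (hM : I.Closed M) (hR : ∀ x, M x → I.Reach x)
    (hroot : ∃ p c, I.Good I.root p c ∧ ∀ p' c', I.Good I.root p' c' → c ≤ c')
    {x : ℕ} (hx : M x) {p : List ℕ} {c : ℤ} (hg : I.Good x p c) :
    ∃ p' c', I.Good x p' c' ∧ c' ≤ c ∧ p'.length ≤ I.N := by
  classical
  obtain ⟨_, c₀, _, hmin⟩ := hroot
  obtain ⟨δ, hδ⟩ := hR x hx
  -- An accepted path from `x` extends to one from the root, so its weight is at least `c₀ - δ`;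
  -- integers that are bounded below have a least element.
  obtain ⟨b, ⟨p', hp'⟩, hb⟩ := Int.exists_least_of_bdd (P := fun c => ∃ p, I.Good x p c)
    ⟨c₀ - δ, fun z ⟨p, hp⟩ => by
      obtain ⟨p', h'⟩ := hδ p z hp
      have := hmin _ _ h'
      omega⟩ ⟨c, p, hg⟩
  have hbest : ∃ k, I.Best x k := ⟨_, p', b, hp', fun p'' c'' h => hb _ ⟨_, h⟩, rfl⟩
  have hlev : I.Level x (Nat.find hbest) := ⟨Nat.find_spec hbest, fun j hj => Nat.find_min hbest hj⟩
  obtain ⟨p₁, c₁, h1, h2, h3⟩ := hlev.1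
  exact ⟨p₁, c₁, h1, h2 _ _ hg, h3 ▸ hlev.le_N hM hx⟩

end Inst

namespace HL

open Inst

/-! ### Reachable nodes, and passes of relaxations. -/

def St.marked (σ : St) (x : ℕ) : Prop := 0 < σ.arr aMark x

theorem marked_congr {σ σ' : St} (h : σ'.arr aMark = σ.arr aMark) : σ'.marked = σ.marked := by
  funext x; unfold St.marked; rw [h]

/-- Mark the successors of the marked nodes. -/
def markPass : Cmd :=
  .for vE vM (.cond (.get aMark (.get aQn (srcOf ♯vE) + labOf ♯vE))
    (.for vU vN (.cond (.inp (.get aRow (labOf ♯vE) + ♯vU))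
      (.write aMark (.get aQn (tgtOf ♯vE) + ♯vU) 1) .skip)) .skip)

/-- Mark the nodes that are reachable from the root. -/
def mark : Cmd :=
  .write aMark (.get aQn ♯vQz + ♯vS) 1 ⨟ .for vR vNd markPass

/-- The marks are contained in every closed set that contains the root. -/
def St.MarkSound (σ : St) (I : Inst) : Prop :=
  ∀ S : ℕ → Prop, I.Closed S → S I.root → ∀ x, σ.marked x → S x

theorem markPass_spec {I : Inst} {C : Ctx} (hE : Enc I C) {σ : St} (hst : Static I σ)
    (hs : σ.MarkSound I) :
    wp C markPass (fun σ' => σ'.clock ≤ σ.clock + (1 + I.m * (2 * I.n + 2)) ∧ σ'.MarkSound I ∧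
      (∀ x, σ.marked x → σ'.marked x) ∧
      ∀ e < I.m, ∀ u < I.n, I.adj (I.lab e) u → σ.marked (I.xs e) → σ'.marked (I.yt e u)) σ := by
  have hW := hE.one_le_W
  have hA := hE.len_le_A
  have hA' := hE.N_le_A
  have hnn : I.n ≤ I.n * I.n := Nat.le_mul_of_pos_left _ I.n_pos
  have t1 := I.tb_nonneg
  refine wp_for hW I.m (2 * I.n + 1) (fun k τ => τ.MarkSound I ∧ (∀ x, σ.marked x → τ.marked x) ∧
    ∀ e < k, ∀ u < I.n, I.adj (I.lab e) u → σ.marked (I.xs e) → τ.marked (I.yt e u))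
    (by omega) (by decide) hst.m rfl rfl ⟨hs, fun _ h => h, fun v hv =>
      absurd hv (Nat.not_lt_zero _)⟩ ?_ fun τ _ h hcl => ⟨hcl.trans (by ring_nf; omega), h⟩
  rintro e he τ hf hve ⟨h1, h2, h3⟩
  replace hst := hst.frame hf rfl
  have hl := I.lab_lt e he
  have hx0 : (0 : ℤ) ≤ (I.xs e : ℕ) := Int.natCast_nonneg _
  have e1 : I.qn (I.src e) + (I.lab e : ℕ) = (I.xs e : ℕ) := I.qn_add _ _
  have n1 : 0 ≤ I.tb + e + e + e := by omega
  have n2 : 0 ≤ I.tb + e + e + e + 1 := by omega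
  have n3 : 0 ≤ I.tb + e + e + e + 2 := by omega
  rw [wp_cond]
  simp only [labOf, srcOf, tgtOf, Expr.ok, Expr.eval, Expr.ok_add, Expr.eval_add, Expr.ok_ofNat,
    Expr.eval_one, true_and, and_true, Nat.cast_one, hst.tb, hve, hE.src e he, hE.lab e he,
    hst.qn _ (I.src_lt e he), e1, n1, n2, hx0, Int.natCast_nonneg]
  refine ⟨fun hpos => ?_, fun hle => ?_⟩
  · refine wp_for hW I.n 1 (fun k τ' => τ'.MarkSound I ∧ (∀ x, τ.marked x → τ'.marked x) ∧
      ∀ u < k, I.adj (I.lab e) u → τ'.marked (I.yt e u))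
      (by omega) (by decide) hst.n rfl rfl ⟨h1, fun _ h => h, fun v hv =>
        absurd hv (Nat.not_lt_zero _)⟩ ?_ fun τ' hf' h hcl => ⟨by omega, h.1, fun x hx =>
          h.2.1 x (h2 x hx), ?_⟩
    · rintro u hu τ' hf' hvu ⟨k1, k2, k3⟩
      have hst' := hst.frame hf' rfl
      have hve' : τ'.vars vE = e := (hf'.var vE rfl).trans hve
      have t2 := I.row_nonneg (I.lab e)
      have n4 : 0 ≤ I.row (I.lab e) + u := by omega
      have e2 : I.qn (I.tgt e) + u = (I.yt e u : ℕ) := I.qn_add _ _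
      simp only [labOf, srcOf, tgtOf, wp_cond, wp_write, wp_skip, Expr.ok, Expr.eval, Expr.ok_add,
        Expr.eval_add, Expr.ok_ofNat, Expr.eval_ofNat, Expr.eval_one, true_and, and_true,
        Nat.cast_one, Nat.cast_ofNat, hst'.tb, hve',
        hvu, hE.tgt e he, hE.lab e he, hst'.qn _ (I.tgt_lt e he), hst'.row _ hl, e2, n2, n3, n4,
        Int.natCast_nonneg, hE.adj _ hl u hu, setArr_clock, le_refl]
      refine ⟨fun hadj => ⟨Ctx.le_bd hW _ (by omega) (by omega), ?_, ?_, ?_⟩,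
        fun hle => ⟨by omega, k1, k2, fun u' hu' hadj => ?_⟩⟩
      · intro S hS hr x hx
        simp only [St.marked, setVar_arr, setArr_arr, if_true, reduceIte] at hx
        by_cases h : (x : ℤ) = I.yt e u
        · have : x = I.yt e u := by exact_mod_cast h
          subst this
          exact hS e he u hu hadj (h1 S hS hr _ hpos)
        · rw [Function.update_of_ne h] at hx
          exact k1 S hS hr x hx
      · intro x hx
        have := k2 x hx
        simp only [St.marked, setVar_arr, setArr_arr, if_true, reduceIte] at this ⊢
        by_cases h : (x : ℤ) = I.yt e u
        · rw [h, Function.update_self]; exact one_pos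
        · rwa [Function.update_of_ne h]
      · intro u' hu' hadj'
        simp only [St.marked, setVar_arr, setArr_arr, if_true, reduceIte]
        by_cases h : ((I.yt e u' : ℕ) : ℤ) = I.yt e u
        · rw [h, Function.update_self]; exact one_pos
        · rw [Function.update_of_ne h]
          refine k3 u' ?_ hadj'
          have : u' ≠ u := fun h' => h (by rw [h'])
          omega
      · obtain hu' | rfl := Nat.lt_succ_iff_lt_or_eq.1 hu'
        · exact k3 u' hu' hadj
        · exact absurd ((hE.adj _ hl u' hu).2 hadj) (by omega)
    · intro e' he' u hu hadj hx
      obtain he' | rfl := Nat.lt_succ_iff_lt_or_eq.1 he'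
      · exact h.2.1 _ (h3 e' he' u hu hadj hx)
      · exact h.2.2 u hu hadj
  · rw [wp_skip]
    refine ⟨by omega, h1, h2, fun e' he' u hu hadj hx => ?_⟩
    obtain he' | rfl := Nat.lt_succ_iff_lt_or_eq.1 he'
    · exact h3 e' he' u hu hadj hx
    · have := h2 _ hx
      unfold St.marked at this
      omega

/-- A pass over a set that is not closed marks a new node. Once the set is closed, soundness
prevents any further mark. As the root is marked from the start, `N` passes without closure would
yield more than `N` nodes. -/
theorem mark_spec {I : Inst} {C : Ctx} (hE : Enc I C) {σ : St} (hst : Static I σ)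
    (h0 : σ.arr aMark = fun _ => 0) :
    wp C mark (fun σ' => σ'.clock ≤ σ.clock + (2 + I.N * (2 + I.m * (2 * I.n + 2))) ∧
      σ'.MarkSound I ∧ I.Closed σ'.marked ∧ σ'.marked I.root) σ := by
  classical
  have hW := hE.one_le_W
  have hA' := hE.N_le_A
  have e1 : I.qn I.q0 + I.s = (I.root : ℕ) := I.qn_add _ _
  have hone : |(1 : ℤ)| ≤ C.bd σ.clock := Ctx.le_bd hW _ (by omega) (by omega)
  simp only [mark, wp_seq, wp_write, Expr.ok, Expr.eval, Expr.ok_add, Expr.eval_add,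
    Expr.ok_ofNat, Expr.eval_one, true_and, and_true, hst.q0, hst.s, hst.qn _ I.q0_lt, e1,
    Int.natCast_nonneg, Nat.cast_one, hone]
  have hst' : Static I (σ.setArr aMark I.root 1) :=
    hst.frame (c := .write aMark 0 0) ⟨fun _ _ => rfl, fun k hk => by
      simp only [Cmd.keepsArr, bne_iff_ne] at hk
      simp [hk], fun _ => rfl, Nat.le_succ _⟩ rfl
  refine wp_for hW I.N (1 + I.m * (2 * I.n + 2)) (fun k τ => τ.MarkSound I ∧ τ.marked I.root ∧
    (I.Closed τ.marked ∨ k + 1 ≤ ((Finset.range I.N).filter τ.marked).card))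
    (by omega) (by decide) hst'.N rfl rfl ⟨?_, ?_, .inr ?_⟩ ?_ ?_
  · intro S hS hr x hx
    simp only [St.marked, setVar_arr, setArr_arr, if_true, reduceIte, h0] at hx
    by_cases h : (x : ℤ) = I.root
    · have : x = I.root := by exact_mod_cast h
      rwa [this]
    · rw [Function.update_of_ne h] at hx
      exact absurd hx (lt_irrefl _)
  · simp [St.marked]
  · rw [zero_add, Nat.one_le_iff_ne_zero, ← Nat.pos_iff_ne_zero, Finset.card_pos]
    exact ⟨I.root, by simp [St.marked, I.root_lt]⟩
  · rintro k hk τ hf hvk ⟨h1, h2, h3⟩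
    refine wp_mono (markPass_spec hE (hst'.frame hf rfl) h1) ?_
    rintro τ' ⟨hcl, k1, k2, k3⟩
    refine ⟨by omega, k1, k2 _ h2, ?_⟩
    change I.Closed τ'.marked ∨ k + 1 + 1 ≤ ((Finset.range I.N).filter τ'.marked).card
    by_cases hc : I.Closed τ.marked
    · left
      have : τ'.marked = τ.marked := by
        funext x
        exact propext ⟨k1 _ hc h2 x, k2 x⟩
      rwa [this]
    · right
      have h4 := h3.resolve_left hc
      have h5 : ∃ e < I.m, ∃ u < I.n, I.adj (I.lab e) u ∧ τ.marked (I.xs e) ∧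
          ¬ τ.marked (I.yt e u) := by
        unfold Closed at hc
        push Not at hc
        exact hc
      obtain ⟨e, he, u, hu, hadj, h6, h7⟩ := h5
      refine lt_of_le_of_lt h4 (Finset.card_lt_card ?_)
      refine ⟨fun x hx => ?_, fun hsub => h7 ?_⟩
      · simp only [Finset.mem_filter] at hx ⊢
        exact ⟨hx.1, k2 x hx.2⟩
      · have := hsub (Finset.mem_filter.2 ⟨Finset.mem_range.2 (I.yt_lt he hu),
            k3 e he u hu hadj h6⟩)
        exact (Finset.mem_filter.1 this).2
  · rintro τ hf ⟨h1, h2, h3⟩ hcl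
    simp only [setArr_clock] at hcl
    refine ⟨?_, h1, h3.resolve_right fun h => ?_, h2⟩
    · have : 1 + I.m * (2 * I.n + 2) + 1 = 2 + I.m * (2 * I.n + 2) := by ring
      rw [this] at hcl
      omega
    · have := Finset.card_filter_le (Finset.range I.N) τ.marked
      rw [Finset.card_range] at this
      omega

/-- Relax everything that is marked. -/
def bfPass : Cmd :=
  vChg ≔ 0 ⨟ .for vE vM (.cond (.get aMark (.get aQn (srcOf ♯vE) + labOf ♯vE)) relaxAll .skip)

/-- The bound is in terms of the values before the pass, so each pass accounts for one more vertex
of the paths. If nothing changes, the same inequalities say that the values are a fixed point on the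
marked nodes. -/
theorem bfPass_spec {I : Inst} {C : Ctx} (hE : Enc I C) {σ : St} (hst : Static I σ)
    (hs : Sound I C σ) :
    wp C bfPass (fun σ' => σ'.clock ≤ σ.clock + (2 + I.m * (2 + 14 * I.n)) ∧ Sound I C σ' ∧
      (∀ z, σ'.d z ≤ σ.d z) ∧
      (∀ e < I.m, ∀ u < I.n, I.adj (I.lab e) u → σ.marked (I.xs e) →
        σ'.d (I.xs e) ≤ σ.d (I.yt e u) + (I.w (I.lab e) u : ℤ)) ∧
      ((σ'.vars vChg = 0 ∧ σ'.d = σ.d) ∨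
        (σ'.vars vChg = 1 ∧ ∃ x p c, σ.marked x ∧ I.Good x p c ∧ (c : WithTop ℤ) < σ.d x))) σ := by
  have hW := hE.one_le_W
  have hA := hE.len_le_A
  have hnn : I.n ≤ I.n * I.n := Nat.le_mul_of_pos_left _ I.n_pos
  have t1 := I.tb_nonneg
  have hzero : |(0 : ℤ)| ≤ C.bd σ.clock := Ctx.le_bd hW _ (by omega) (by omega)
  simp only [bfPass, wp_seq, wp_assign, Expr.ok, Expr.ok_ofNat, Expr.eval_zero, Nat.cast_zero,
      hzero,
    true_and]
  have hst' : Static I (σ.setVar vChg 0) := hst.setVar _ _ (by decide)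
  refine wp_for hW I.m (1 + 14 * I.n) (fun k τ => Sound I C τ ∧ (∀ z, τ.d z ≤ σ.d z) ∧
      (∀ e < k, ∀ u < I.n, I.adj (I.lab e) u → σ.marked (I.xs e) →
        τ.d (I.xs e) ≤ σ.d (I.yt e u) + (I.w (I.lab e) u : ℤ)) ∧
      ((τ.vars vChg = 0 ∧ τ.d = σ.d) ∨
        (τ.vars vChg = 1 ∧ ∃ x p c, σ.marked x ∧ I.Good x p c ∧ (c : WithTop ℤ) < σ.d x)))
    (by omega) (by decide) hst'.m rfl rfl ⟨hs.of_eq (by simp) rfl rfl rfl rfl (by simp; omega),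
      fun _ => le_rfl, fun v hv => absurd hv (Nat.not_lt_zero _), .inl ⟨by simp, rfl⟩⟩ ?_ ?_
  · rintro e he τ hf hve ⟨h1, h2, h3, h4⟩
    replace hst := hst'.frame hf rfl
    have hl := I.lab_lt e he
    have hx0 : (0 : ℤ) ≤ (I.xs e : ℕ) := Int.natCast_nonneg _
    have e1 : I.qn (I.src e) + (I.lab e : ℕ) = (I.xs e : ℕ) := I.qn_add _ _
    have n1 : 0 ≤ I.tb + e + e + e := by omega
    have n2 : 0 ≤ I.tb + e + e + e + 1 := by omega
    have hmk : τ.marked = σ.marked := marked_congr (hf.arr aMark rfl)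
    simp only [labOf, srcOf, wp_cond, wp_skip, Expr.ok, Expr.eval, Expr.ok_add, Expr.eval_add,
      Expr.ok_ofNat,
      Expr.eval_one, true_and, and_true, Nat.cast_one, hst.tb, hve, hE.src e he, hE.lab e he,
      hst.qn _ (I.src_lt e he), e1, n1, n2, hx0, Int.natCast_nonneg]
    refine ⟨fun hpos => ?_, fun hle => ⟨by omega, h1.of_eq (by simp) rfl rfl rfl rfl (by simp),
      h2, fun e' he' u hu hadj hx => ?_, h4⟩⟩
    · have hpos' : σ.marked (I.xs e) := by rw [← hmk]; exact hpos
      refine wp_mono (relaxAll_spec hE hst h1 he hve) ?_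
      rintro τ' ⟨hcl, hR⟩
      refine ⟨by omega, hR.sound.of_eq (by simp) rfl rfl rfl rfl (by simp),
        fun z => (hR.d_le z).trans (h2 z), fun e' he' u hu hadj hx => ?_, ?_⟩
      · obtain he' | rfl := Nat.lt_succ_iff_lt_or_eq.1 he'
        · exact (hR.d_le _).trans (h3 e' he' u hu hadj hx)
        · refine (hR.le u hu hadj).trans ?_
          gcongr
          exact h2 _
      · rw [setVar_vars, if_neg (by decide)]
        obtain ⟨k1, k2⟩ | ⟨k1, c, p, k2, k3⟩ := hR.chg
        · rw [k1]
          change (_ ∧ τ'.d = _) ∨ _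
          rw [k2]
          exact h4
        · exact .inr ⟨k1, _, p, c, hpos', k2, k3.trans_le (h2 _)⟩
    · obtain he' | rfl := Nat.lt_succ_iff_lt_or_eq.1 he'
      · exact h3 e' he' u hu hadj hx
      · rw [← hmk] at hx
        unfold St.marked at hx
        omega
  · rintro τ hf h hcl
    simp only [setVar_clock] at hcl
    refine ⟨?_, h⟩
    have : 1 + 14 * I.n + 1 = 2 + 14 * I.n := by ring
    rw [this] at hcl
    omega

def bellmanFord : Cmd :=
  prologue ⨟ mark ⨟ seed ⨟ .for vR vNd bfPass ⨟ bfPass ⨟ .cond ♯vChg .skip output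

/-- After `k` passes the value of a marked node is at most the weight of each of its accepted paths
with at most `k + 1` vertices. The extra pass decides. Without a change there is a fixed point. A
change exhibits a path lighter than the value, whereas by `exists_short`, if the root had a minimum,
some path of at most `N` vertices would be as light and already accounted for. Because only marked
nodes are relaxed, negative cycles out of reach of the root do no harm. -/
theorem bellmanFord_spec {I : Inst} {C : Ctx} (hE : Enc I C) :
    wp C bellmanFord (fun σ => σ.clock ≤ 300 * (I.N * (1 + I.m * I.n)) ∧ I.IsAnswer σ.out)
      St.init := by
  have hW := hE.one_le_W
  have hA' := hE.N_le_A
  have hn := I.n_pos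
  have hN : 1 ≤ I.N := Nat.one_le_of_lt I.root_lt
  rw [bellmanFord, wp_seq]
  refine wp_frame (prologue_spec hE) ?_
  rintro σ₁ ⟨hcl₁, hst₁⟩ hf₁
  rw [wp_seq]
  refine wp_frame (mark_spec hE hst₁ (hf₁.arr aMark rfl)) ?_
  rintro σ₂ ⟨hcl₂, hms, hmc, hmr⟩ hf₂
  replace hf₁ := hf₁.seq hf₂
  have hst₂ := hst₁.frame hf₂ rfl
  have hs₂ : Sound I C σ₂ := by
    have hc : σ₂.vars vCnt = 0 := hf₁.var vCnt rfl
    refine ⟨by omega, by omega, fun x _ => .inl ?_⟩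
    rw [hf₁.arr aPtr rfl]; rfl
  rw [wp_seq]
  refine wp_frame (seed_spec hE hst₂ hs₂) ?_
  rintro σ₃ ⟨hcl₃, hs₃, hb₃⟩ hf₃
  have hst₃ := hst₂.frame hf₃ rfl
  replace hf₁ := hf₁.seq hf₃
  have hmk₃ : σ₃.marked = σ₂.marked := marked_congr (hf₃.arr aMark rfl)
  rw [wp_seq]
  refine wp_for hW I.N (2 + I.m * (2 + 14 * I.n)) (fun k τ => Sound I C τ ∧ I.Based τ.d ∧
    ∀ x p c, σ₂.marked x → I.Good x p c → p.length ≤ k + 1 → τ.d x ≤ (c : WithTop ℤ))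
    (by omega) (by decide) hst₃.N rfl rfl
    ⟨hs₃.of_eq (by simp) rfl rfl rfl rfl (by simp), hb₃, ?_⟩ ?_ ?_
  · intro x p c hx hg hlen
    cases hg with
    | base e he h1 h2 => exact hb₃ e he h1 h2
    | step e u p c he hu hadj hg =>
      have := hg.length_pos
      simp only [List.length_cons] at hlen
      omega
  · rintro k hk τ hf hvk ⟨h1, h2, h3⟩
    have hmk : τ.marked = σ₂.marked := (marked_congr (hf.arr aMark rfl)).trans hmk₃
    refine wp_mono (bfPass_spec hE (hst₃.frame hf rfl) h1) ?_
    rintro τ' ⟨hcl, k1, k2, k3, -⟩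
    refine ⟨by omega, k1.of_eq (by simp) rfl rfl rfl rfl (by simp),
      fun e he ha hb => (k2 _).trans (h2 e he ha hb), fun x p c hx hg hlen => ?_⟩
    cases hg with
    | base e he ha hb => exact (k2 _).trans (h2 e he ha hb)
    | step e u p c he hu hadj hg =>
      refine (k3 e he u hu hadj (by rwa [hmk])).trans ?_
      have := h3 _ p c (hmc e he u hu hadj hx) hg (by simpa using hlen)
      push_cast
      gcongr
  rintro σ₄ hf₄ ⟨hs₄, hb₄, hd₄⟩ hcl₄
  have hst₄ := hst₃.frame hf₄ rfl
  have hmk₄ : σ₄.marked = σ₂.marked := (marked_congr (hf₄.arr aMark rfl)).trans hmk₃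
  replace hf₁ := hf₁.seq hf₄
  rw [wp_seq]
  refine wp_frame (bfPass_spec hE hst₄ hs₄) ?_
  rintro σ₅ ⟨hcl₅, hs₅, hd₅, hfix₅, hch⟩ hf₅
  have hst₅ := hst₄.frame hf₅ rfl
  replace hf₁ := hf₁.seq hf₅
  -- Printing takes at most two time units per cell, and there are at most as many cells as clock
  -- units; with the time so far this makes the factor 3.
  have hcl : 3 * σ₅.clock + 2 ≤ 300 * (I.N * (1 + I.m * I.n)) := by
    have h1 : I.m ≤ I.m * I.n := Nat.le_mul_of_pos_right _ hn
    have h2 : I.N * I.m ≤ I.N * (I.m * I.n) := Nat.mul_le_mul_left _ h1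
    have h3 : I.m ≤ I.N * I.m := Nat.le_mul_of_pos_left _ hN
    have h4 : I.m * I.n ≤ I.N * (I.m * I.n) := Nat.le_mul_of_pos_left _ hN
    have e1 : I.N * (2 + I.m * (2 * I.n + 2)) =
      2 * I.N + 2 * (I.N * (I.m * I.n)) + 2 * (I.N * I.m) := by ring
    have e2 : I.N * (2 + I.m * (2 + 14 * I.n) + 1) =
      3 * I.N + 14 * (I.N * (I.m * I.n)) + 2 * (I.N * I.m) := by ring
    have e3 : I.m * (2 + 14 * I.n) = 2 * I.m + 14 * (I.m * I.n) := by ring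
    have e4 : I.N * (1 + I.m * I.n) = I.N + I.N * (I.m * I.n) := by ring
    rw [e1] at hcl₂
    rw [e2] at hcl₄
    rw [e3] at hcl₅
    rw [e4]
    omega
  have ho : σ₅.out = [] := hf₁.out rfl
  rw [wp_cond]
  refine ⟨trivial, fun hpos => ?_, fun hle => ?_⟩
  · rw [wp_skip]
    refine ⟨by omega, .inr ⟨fun hroot => ?_, ho⟩⟩
    simp only [Expr.eval] at hpos
    obtain ⟨h, _⟩ | ⟨_, x, p, c, hx, hg, hlt⟩ := hch
    · omega
    rw [hmk₄] at hx
    obtain ⟨p', c', hg', hc', hlen⟩ := I.exists_short hmc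
      (fun x hx => hms _ closed_reach reach_root x hx) hroot hx hg
    have h1 := hd₄ x p' c' hx hg' (by omega)
    have h2 : (c' : WithTop ℤ) ≤ c := by exact_mod_cast hc'
    exact absurd hlt (h1.trans h2).not_gt
  · simp only [Expr.eval] at hle
    obtain ⟨_, hd⟩ | ⟨h, _⟩ := hch
    swap
    · omega
    have hfix : I.Fixed σ₂.marked σ₅.d := by
      intro e he u hu hadj hx
      refine (hfix₅ e he u hu hadj (by rwa [hmk₄])).trans ?_
      rw [hd]
    have hb : I.Based σ₅.d := by rw [hd]; exact hb₄
    refine wp_mono (output_spec hE hst₅ hs₅ ho hmc hmr hfix hb) ?_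
    rintro σ₆ ⟨hcl₆, hans⟩
    have := hs₅.cnt_le
    exact ⟨by omega, hans⟩

end HL

/-! ### Lists of the transitions into a state -/

namespace Inst

variable (I : Inst)

/-- `e + 1` for the last transition `e < k` into `q`, or `0` if there is none. -/
def last (q : ℕ) : ℕ → ℕ
  | 0 => 0
  | k + 1 => if I.tgt k = q then k + 1 else last q k

/-- The number of transitions `e < k` into `q`. -/
def indeg (q k : ℕ) : ℕ := ((Finset.range k).filter fun e => I.tgt e = q).card

theorem last_le (q k : ℕ) : I.last q k ≤ k := by
  induction k with
  | zero => exact le_rfl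
  | succ k ih => unfold last; split <;> omega

/-- The fixed points of `last q` are 0 and the numbers `e + 1` with `e` a transition into `q`, that
is, the legitimate positions in the list of `q`. -/
theorem last_last (q k : ℕ) : I.last q (I.last q k) = I.last q k := by
  induction k with
  | zero => rfl
  | succ k ih =>
    by_cases h : I.tgt k = q
    · have : I.last q (k + 1) = k + 1 := by simp [last, h]
      rw [this, this]
    · have : I.last q (k + 1) = I.last q k := by simp [last, h]
      rw [this, ih]

theorem tgt_of_last_eq {q e : ℕ} (h : I.last q (e + 1) = e + 1) : I.tgt e = q := by
  by_contra h'
  have h1 : I.last q (e + 1) = I.last q e := by simp [last, h']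
  have := I.last_le q e
  omega

/-- Moves an invariant that is indexed by all transitions past those that the list of `q` leaves
out. -/
theorem last_induct {q : ℕ} {J : ℕ → Prop} (h : ∀ e < I.m, I.tgt e ≠ q → J (e + 1) → J e)
    {k : ℕ} (hk : k ≤ I.m) (hJ : J k) : J (I.last q k) := by
  induction k with
  | zero => exact hJ
  | succ k ih =>
    by_cases h' : I.tgt k = q
    · have : I.last q (k + 1) = k + 1 := by simp [last, h']
      rwa [this]
    · have : I.last q (k + 1) = I.last q k := by simp [last, h']
      rw [this]
      exact ih (by omega) (h k hk h' hJ)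

theorem indeg_succ (q e : ℕ) :
    I.indeg q (e + 1) = I.indeg q e + if I.tgt e = q then 1 else 0 := by
  unfold indeg
  rw [Finset.range_add_one, Finset.filter_insert]
  split
  · rw [Finset.card_insert_of_notMem (by simp)]
  · rfl

theorem indeg_last (q k : ℕ) : I.indeg q (I.last q k) = I.indeg q k := by
  induction k with
  | zero => rfl
  | succ k ih =>
    by_cases h' : I.tgt k = q
    · have : I.last q (k + 1) = k + 1 := by simp [last, h']
      rw [this]
    · have : I.last q (k + 1) = I.last q k := by simp [last, h']
      rw [this, ih, indeg_succ, if_neg h', add_zero]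

end Inst

namespace HL

open Inst

structure Lists (I : Inst) (σ : St) : Prop where
  head : ∀ q < I.nq, σ.arr aHead q = I.last q I.m
  next : ∀ e < I.m, σ.arr aNext e = I.last (I.tgt e) e

theorem Lists.frame {I : Inst} {σ σ' : St} {c : Cmd} (h : Lists I σ) (hf : Frame c σ σ')
    (h1 : c.keepsArr aHead = true) (h2 : c.keepsArr aNext = true) : Lists I σ' := by
  constructor
  · rw [hf.arr _ h1]; exact h.head
  · rw [hf.arr _ h2]; exact h.next

def buildLists : Cmd :=
  .for vE vM (vP ≔ tgtOf ♯vE ⨟ .write aNext ♯vE (.get aHead ♯vP) ⨟ .write aHead ♯vP (♯vE + 1))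

theorem buildLists_spec {I : Inst} {C : Ctx} (hE : Enc I C) {σ : St} (hst : Static I σ)
    (h0 : σ.arr aHead = fun _ => 0) :
    wp C buildLists (fun σ' => σ'.clock ≤ σ.clock + (1 + 4 * I.m) ∧ Lists I σ') σ := by
  have hW := hE.one_le_W
  have hA := hE.len_le_A
  have t1 := I.tb_nonneg
  refine wp_for hW I.m 3 (fun k τ => (∀ q < I.nq, τ.arr aHead q = I.last q k) ∧
    ∀ e < k, τ.arr aNext e = I.last (I.tgt e) e) (by omega) (by decide) hst.m rfl rfl
    ⟨fun q _ => by simp [h0, last], fun v hv => absurd hv (Nat.not_lt_zero _)⟩ ?_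
    fun τ _ h hcl => ⟨by omega, h.1, h.2⟩
  rintro e he τ hf hve ⟨h1, h2⟩
  replace hst := hst.frame hf rfl
  have n3 : 0 ≤ I.tb + e + e + e + 2 := by omega
  have ht := I.tgt_lt e he
  have hl := I.last_le (I.tgt e) e
  simp only [tgtOf, wp_seq, wp_assign, wp_write, Expr.ok, Expr.eval, Expr.ok_add,
    Expr.eval_add, Expr.ok_ofNat, Expr.eval_ofNat, Expr.eval_one, true_and, and_true,
    Nat.cast_one, Nat.cast_ofNat, setVar_vars, setVar_arr, setVar_clock, setArr_vars, setArr_arr,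
    setArr_clock, Nat.reduceEqDiff, Fin.reduceEq, if_true, if_false, reduceIte, hst.tb, hve,
    hE.tgt e he, n3, h1 _ ht, Int.natCast_nonneg, Nat.add_assoc, Nat.reduceAdd, le_refl]
  refine ⟨Ctx.le_bd hW _ (by omega) (by omega), Ctx.le_bd hW _ (by omega) (by omega),
    Ctx.le_bd hW _ (by omega) (by omega), fun q hq => ?_, fun e' he' => ?_⟩
  · unfold last
    by_cases h : I.tgt e = q
    · subst h; simp
    · have : (q : ℤ) ≠ I.tgt e := fun h' => h (by exact_mod_cast h'.symm)
      rw [if_neg h, Function.update_of_ne this, h1 q hq]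
  · obtain he' | rfl := Nat.lt_succ_iff_lt_or_eq.1 he'
    · have : (e' : ℤ) ≠ e := by omega
      rw [Function.update_of_ne this, h2 e' he']
    · rw [Function.update_self]

/-- For all transitions `vE` into the state `q` do `c`. -/
def inList (q : ℕ) (c : Cmd) : Cmd :=
  vL ≔ .get aHead ♯q ⨟ .loop ♯vL (vE ≔ ♯vL - 1 ⨟ c ⨟ vL ≔ .get aNext ♯vE)

/-- The list runs downwards, so `J k` should say that the transitions into `q` with numbers from `k`
on are done. The clock is charged `T + 2` for each transition: the body, the extraction of `vE` and
the step to the next cell. -/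
theorem wp_inList {I : Inst} {C : Ctx} (hE : Enc I C) {Q : St → Prop} {σ : St} {c : Cmd} {r : ℕ}
    (hli : Lists I σ) {q : ℕ} (hq : q < I.nq) (hr : σ.vars r = q) (T : ℕ) (J : ℕ → St → Prop)
    (hcE : c.keepsVar vE = true) (hcN : c.keepsArr aNext = true)
    (hset : ∀ k τ z, J k τ → J k (τ.setVar vL z) ∧ J k (τ.setVar vE z)) (h0 : J I.m σ)
    (hskip : ∀ τ, ∀ e < I.m, I.tgt e ≠ q → J (e + 1) τ → J e τ)
    (hstep : ∀ e < I.m, I.tgt e = q → ∀ τ, Frame (inList r c) σ τ → τ.vars vE = e →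
      J (e + 1) τ → wp C c (fun τ' => τ'.clock ≤ τ.clock + T ∧ J e τ') τ)
    (hQ : ∀ τ, Frame (inList r c) σ τ → J 0 τ →
      τ.clock ≤ σ.clock + (1 + I.indeg q I.m * (T + 2)) → Q τ) :
    wp C (inList r c) Q σ := by
  have hW := hE.one_le_W
  have hA := hE.len_le_A
  have hl := I.last_le q I.m
  have hfr : ∀ {z : ℤ} {τ}, Frame (.loop ♯vL (vE ≔ ♯vL - 1 ⨟ c ⨟ vL ≔ .get aNext ♯vE))
      (σ.setVar vL z) τ → Frame (inList r c) σ τ := fun {z} {τ} h =>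
    Frame.seq (c := vL ≔ .get aHead ♯r) (σ' := σ.setVar vL z) ⟨fun y hy => by
      simp only [Cmd.keepsVar, bne_iff_ne] at hy
      simp [hy], fun _ _ => rfl, fun _ => rfl, Nat.le_succ _⟩ h
  simp only [inList, wp_seq, wp_assign, Expr.ok, Expr.eval, true_and, hr, hli.head q hq,
    Int.natCast_nonneg]
  refine ⟨Ctx.le_bd hW _ (by omega) (by omega), ?_⟩
  refine wp_loop (fun τ => ∃ k ≤ I.m, τ.vars vL = k ∧ I.last q k = k ∧ J k τ ∧
    τ.clock + I.indeg q k * (T + 2) ≤ σ.clock + (1 + I.indeg q I.m * (T + 2)))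
    (fun τ => (τ.vars vL).toNat) ⟨I.last q I.m, hl, by simp, I.last_last _ _,
      (hset _ _ _ (I.last_induct (J := fun k => J k σ) (hskip σ) le_rfl h0)).1, ?_⟩ ?_ ?_
  · rw [indeg_last, setVar_clock]; omega
  · rintro τ hf ⟨k, hk, hvl, hlast, hJ, hcl⟩
    refine ⟨trivial, fun hpos => ?_⟩
    simp only [Expr.eval, hvl] at hpos
    obtain ⟨e, rfl⟩ : ∃ e, k = e + 1 := ⟨k - 1, by omega⟩
    have he : e < I.m := hk
    have htgt := I.tgt_of_last_eq hlast
    have hlt := I.last_le q e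
    have hz : τ.vars vL - 1 = e := by rw [hvl]; push_cast; omega
    rw [wp_seq, wp_assign]
    refine ⟨⟨trivial, trivial⟩, ?_⟩
    have he1 : (♯vL - 1 : Expr).eval C τ = e := hz
    rw [he1, wp_seq]
    refine ⟨Ctx.le_bd hW _ (by omega) (by omega), ?_⟩
    have hf' : Frame (inList r c) σ (τ.setVar vE e) := by
      refine hfr (hf.trans ⟨fun y hy => ?_, fun _ _ => rfl, fun _ => rfl, Nat.le_succ _⟩)
      simp only [Cmd.keepsVar, Bool.and_eq_true, bne_iff_ne] at hy
      simp [hy.1]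
    refine wp_frame (hstep e he htgt _ hf' (by simp) (hset _ _ _ hJ).2) ?_
    rintro τ' ⟨hcl', hJ'⟩ hfc
    have hfcl := hfc.clock
    have hve : τ'.vars vE = e := (hfc.var vE hcE).trans (by simp)
    have hnext : τ'.arr aNext e = I.last q e := by
      rw [hfc.arr aNext hcN, hf'.arr aNext (by simp [inList, Cmd.keepsArr, hcN]), hli.next e he,
        htgt]
    simp only [setVar_clock] at hcl' hfcl
    simp only [wp_assign, Expr.ok, Expr.eval, true_and, hve, hnext, Int.natCast_nonneg]
    refine ⟨Ctx.le_bd hW _ (by omega) (by omega), ⟨I.last q e, by omega, by simp,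
      I.last_last _ _, (hset _ _ _ (I.last_induct (J := fun k => J k τ')
        (hskip τ') (by omega) hJ')).1, ?_⟩, ?_, ?_⟩
    · rw [indeg_last, setVar_clock]
      rw [indeg_succ, if_pos htgt, add_mul, one_mul] at hcl
      omega
    · rw [setVar_vars, if_pos rfl, hvl]; omega
    · rw [setVar_clock]; omega
  · rintro τ hf ⟨k, hk, hvl, hlast, hJ, hcl⟩ hle
    simp only [Expr.eval, hvl] at hle
    obtain rfl : k = 0 := by omega
    exact hQ τ (hfr hf) hJ (le_trans (Nat.le_add_right _ _) hcl)

/-! ### Acyclic automata: processing the states in reverse topological order -/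

/-- Induction along the transitions, which is possible for acyclic automata. -/
def _root_.Inst.Acyclic (I : Inst) : Prop :=
  ∀ X : ℕ → Prop, (∀ q < I.nq, (∀ e < I.m, I.src e = q → X (I.tgt e)) → X q) → ∀ q < I.nq, X q

def St.pushed (σ : St) (t q : ℕ) : Prop := ∃ i < t, σ.arr aQu (i : ℕ) = q

/-- The invariant, where `P` is the set of the unprocessed transitions and `t` the number of states
that have been put into the queue. -/
structure Queue (I : Inst) (C : Ctx) (P : Finset ℕ) (t : ℕ) (σ : St) : Prop where
  tl : σ.vars vTl = t
  sound : Sound I C σ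
  based : I.Based σ.d
  out : ∀ q < I.nq, σ.arr aOut q = (P.filter fun e => I.src e = q).card
  sub : ∀ e ∈ P, e < I.m
  lt : ∀ i < t, ∃ q < I.nq, σ.arr aQu (i : ℕ) = q
  inj : ∀ i < t, ∀ j < t, σ.arr aQu (i : ℕ) = σ.arr aQu (j : ℕ) → i = j
  pushed_iff : ∀ q < I.nq, σ.pushed t q ↔ ∀ e ∈ P, I.src e ≠ q
  tgt_pushed : ∀ e < I.m, e ∉ P → σ.pushed t (I.tgt e)
  fixed : ∀ e < I.m, e ∉ P → ∀ u < I.n, I.adj (I.lab e) u →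
    σ.d (I.xs e) ≤ σ.d (I.yt e u) + (I.w (I.lab e) u : ℤ)

theorem Queue.le_nq {I : Inst} {C : Ctx} {P : Finset ℕ} {t : ℕ} {σ : St} (h : Queue I C P t σ) :
    t ≤ I.nq := by
  have hl := h.lt
  choose! f hf using hl
  have := Finset.card_le_card_of_injOn (s := Finset.range t) (t := Finset.range I.nq) f
    (fun i hi => by simpa using (hf i (by simpa using hi)).1)
    (fun i hi j hj hij => by
      have hi' : i < t := by simpa using hi
      have hj' : j < t := by simpa using hj
      exact h.inj i hi' j hj' (by rw [(hf i hi').2, (hf j hj').2, hij]))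
  simpa using this

/-- Process transition `vE`. -/
def kahnStep : Cmd :=
  relaxAll ⨟ vP ≔ srcOf ♯vE ⨟ .write aOut ♯vP (.get aOut ♯vP - 1) ⨟
  .cond (.get aOut ♯vP) .skip (.write aQu ♯vTl ♯vP ⨟ vTl ≔ ♯vTl + 1)

/-- Only values at the source state of `e` change. That state is not in the queue since `e` is
unprocessed, while processed transitions lead into queued states; so no inequality already achieved
is spoiled on its right-hand side. The source is queued as soon as its last transition is done, when
its values are final. -/
theorem kahnStep_spec {I : Inst} {C : Ctx} (hE : Enc I C) {σ : St} (hst : Static I σ)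
    {P : Finset ℕ} {t e : ℕ} (hq : Queue I C P t σ) (heP : e ∈ P) (hve : σ.vars vE = e)
    (htg : σ.pushed t (I.tgt e)) :
    wp C kahnStep (fun σ' => σ'.clock ≤ σ.clock + (14 * I.n + 5) ∧ ∃ t', t ≤ t' ∧
      (∀ i < t, σ'.arr aQu (i : ℕ) = σ.arr aQu (i : ℕ)) ∧ Queue I C (P.erase e) t' σ') σ := by
  have hW := hE.one_le_W
  have hA := hE.len_le_A
  have he := hq.sub e heP
  have hsrc := I.src_lt e he
  have t1 := I.tb_nonneg
  have n1 : 0 ≤ I.tb + e + e + e := by omega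
  have hnp : ¬ σ.pushed t (I.src e) := fun h => (hq.pushed_iff _ hsrc).1 h e heP rfl
  rw [kahnStep, wp_seq]
  refine wp_frame (relaxAll_spec hE hst hq.sound he hve) ?_
  rintro τ ⟨hcl, hR⟩ hf
  replace hst := hst.frame hf rfl
  have hve' : τ.vars vE = e := (hf.var vE rfl).trans hve
  have hout : τ.arr aOut = σ.arr aOut := hf.arr aOut rfl
  have hqu : τ.arr aQu = σ.arr aQu := hf.arr aQu rfl
  have htl : τ.vars vTl = t := (hf.var vTl rfl).trans hq.tl
  have hfi : ∀ q, ((P.erase e).filter fun e => I.src e = q) =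
      (P.filter fun e => I.src e = q).erase e := fun q => by
    rw [Finset.filter_erase]
  have hcard : ((P.filter fun e' => I.src e' = I.src e).card : ℤ) - 1 =
      ((P.erase e).filter fun e' => I.src e' = I.src e).card := by
    have hmem : e ∈ P.filter fun e' => I.src e' = I.src e := Finset.mem_filter.2 ⟨heP, rfl⟩
    rw [hfi, Finset.card_erase_of_mem hmem]
    have := Finset.card_pos.2 ⟨e, hmem⟩
    push_cast [Nat.cast_sub this]
    omega
  have hcle : ((P.erase e).filter fun e' => I.src e' = I.src e).card ≤ I.m := by
    have : ((P.erase e).filter fun e' => I.src e' = I.src e) ⊆ Finset.range I.m := fun x hx =>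
      Finset.mem_range.2 (hq.sub x (Finset.mem_of_mem_erase (Finset.mem_filter.1 hx).1))
    simpa using Finset.card_le_card this
  have htn := hq.le_nq
  simp only [srcOf, wp_seq, wp_assign, wp_write, wp_cond, wp_skip, Expr.ok, Expr.eval, Expr.ok_add,
    Expr.eval_add, Expr.ok_sub, Expr.eval_sub, Expr.ok_ofNat, Expr.eval_one, true_and, and_true,
    Nat.cast_one, setVar_vars, setVar_arr, setVar_clock, setArr_vars, setArr_arr,
    setArr_clock, Nat.reduceEqDiff, Fin.reduceEq, if_true, if_false, reduceIte, hst.tb, hve',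
    hE.src e he, n1, hout, hq.out _ hsrc, hcard, htl, Int.natCast_nonneg, Nat.add_assoc,
    Nat.reduceAdd, Function.update_self]
  have hd : ∀ e' < I.m, e' ∉ P.erase e → ∀ u < I.n, I.adj (I.lab e') u →
      τ.d (I.xs e') ≤ τ.d (I.yt e' u) + (I.w (I.lab e') u : ℤ) := by
    intro e' he' heP' u hu hadj
    have hp : σ.pushed t (I.tgt e') := by
      by_cases h : e' = e
      · rwa [h]
      · exact hq.tgt_pushed e' he' fun h' => heP' (Finset.mem_erase.2 ⟨h, h'⟩)
    have hne : I.yt e' u ≠ I.xs e := fun h => by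
      have := (I.nd_inj hu (I.lab_lt e he) h).1
      rw [this] at hp
      exact hnp hp
    rw [hR.off _ hne]
    by_cases h : e' = e
    · subst h; exact hR.le u hu hadj
    · exact (hR.d_le _).trans (hq.fixed e' he' (fun h' => heP' (Finset.mem_erase.2 ⟨h, h'⟩)) u hu
        hadj)
  have hoth : ∀ q < I.nq, q ≠ I.src e → (∀ e' ∈ P.erase e, I.src e' ≠ q) → σ.pushed t q := by
    intro q hqq hne h
    refine (hq.pushed_iff q hqq).2 fun e' he' h' => ?_
    by_cases hee : e' = e
    · subst hee; exact hne h'.symm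
    · exact h e' (Finset.mem_erase.2 ⟨hee, he'⟩) h'
  have hnew : ∀ q < I.nq, Function.update (σ.arr aOut) (I.src e : ℤ)
      (((P.erase e).filter fun e' => I.src e' = I.src e).card : ℤ) q =
      ((P.erase e).filter fun e' => I.src e' = q).card := by
    intro q hqq
    by_cases h : q = I.src e
    · subst h; rw [Function.update_self]
    · have : (q : ℤ) ≠ I.src e := by exact_mod_cast h
      rw [Function.update_of_ne this, hq.out q hqq, hfi, Finset.erase_eq_of_notMem]
      intro h'
      exact h (Finset.mem_filter.1 h').2.symm
  refine ⟨Ctx.le_bd hW _ (by omega) (by omega), Ctx.le_bd hW _ (by omega) (by omega),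
    fun hpos => ⟨by omega, t, le_rfl, by simp [hqu], ?_⟩,
    fun hle => ⟨Ctx.le_bd hW _ (by omega) (by omega), Ctx.le_bd hW _ (by omega) (by omega),
      by omega, t + 1, by omega, ?_, ?_⟩⟩
  · constructor
    case tl => simp [htl]
    case sound => exact hR.sound.of_eq (by simp) rfl rfl rfl rfl (by simp; omega)
    case based => exact fun e he ha hb => (hR.d_le _).trans (hq.based e he ha hb)
    case out =>
      intro q hqq
      simp only [setArr_arr, setVar_arr, reduceIte, hout]
      exact hnew q hqq
    case sub => exact fun e' he' => hq.sub e' (Finset.mem_of_mem_erase he')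
    case lt => simpa [hqu] using hq.lt
    case inj => simpa [hqu] using hq.inj
    case pushed_iff =>
      intro q hqq
      have : (((τ.setVar vP (I.src e)).setArr aOut (I.src e)
        ((P.erase e).filter fun e' => I.src e' = I.src e).card).pushed t q) ↔ σ.pushed t q := by
        simp [St.pushed, hqu]
      rw [this]
      constructor
      · exact fun h e' he' => (hq.pushed_iff q hqq).1 h e' (Finset.mem_of_mem_erase he')
      · intro h
        by_cases hqs : q = I.src e
        · subst hqs
          obtain ⟨e', he'⟩ := Finset.card_pos.1 (by exact_mod_cast hpos :
            0 < ((P.erase e).filter fun e' => I.src e' = I.src e).card)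
          rw [Finset.mem_filter] at he'
          exact absurd he'.2 (h e' he'.1)
        · exact hoth q hqq hqs h
    case tgt_pushed =>
      intro e' he' heP'
      have : (((τ.setVar vP (I.src e)).setArr aOut (I.src e)
        ((P.erase e).filter fun e' => I.src e' = I.src e).card).pushed t (I.tgt e')) ↔
          σ.pushed t (I.tgt e') := by
        simp [St.pushed, hqu]
      rw [this]
      by_cases h : e' = e
      · rwa [h]
      · exact hq.tgt_pushed e' he' fun h' => heP' (Finset.mem_erase.2 ⟨h, h'⟩)
    case fixed => exact hd
  · intro i hi
    have : (i : ℤ) ≠ t := by omega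
    simp [hqu, Function.update_of_ne this]
  · have hz : ((P.erase e).filter fun e' => I.src e' = I.src e).card = 0 := by omega
    have hself : ∀ e' ∈ P.erase e, I.src e' ≠ I.src e := by
      intro e' he' h
      rw [Finset.card_eq_zero] at hz
      have : e' ∈ ((P.erase e).filter fun e' => I.src e' = I.src e) :=
        Finset.mem_filter.2 ⟨he', h⟩
      rw [hz] at this
      exact absurd this (Finset.notMem_empty _)
    have hval : ∀ i < t, Function.update (σ.arr aQu) (t : ℤ) (I.src e : ℤ) (i : ℕ) =
        σ.arr aQu (i : ℕ) := fun i hi => Function.update_of_ne (by omega) _ _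
    have hvt : Function.update (σ.arr aQu) (t : ℤ) (I.src e : ℤ) (t : ℕ) = I.src e :=
      Function.update_self _ _ _
    have hpu : ∀ (σ' : St) q, σ'.arr aQu = Function.update (σ.arr aQu) (t : ℤ) (I.src e : ℤ) →
        (σ'.pushed (t + 1) q ↔ σ.pushed t q ∨ q = I.src e) := by
      intro σ' q hσ'
      unfold St.pushed
      rw [hσ']
      constructor
      · rintro ⟨i, hi, h⟩
        obtain hi | rfl := Nat.lt_succ_iff_lt_or_eq.1 hi
        · rw [hval i hi] at h; exact .inl ⟨i, hi, h⟩
        · rw [hvt] at h; exact .inr (by exact_mod_cast h.symm)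
      · rintro (⟨i, hi, h⟩ | rfl)
        · exact ⟨i, by omega, by rw [hval i hi, h]⟩
        · exact ⟨t, by omega, hvt⟩
    constructor
    case tl => simp
    case sound => exact hR.sound.of_eq (by simp) rfl rfl rfl rfl (by simp; omega)
    case based => exact fun e he ha hb => (hR.d_le _).trans (hq.based e he ha hb)
    case out =>
      intro q hqq
      simp only [setArr_arr, setVar_arr, reduceIte, hout, Fin.reduceEq]
      exact hnew q hqq
    case sub => exact fun e' he' => hq.sub e' (Finset.mem_of_mem_erase he')
    case lt =>
      intro i hi
      simp only [setArr_arr, setVar_arr, reduceIte, hqu, Fin.reduceEq]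
      obtain hi | rfl := Nat.lt_succ_iff_lt_or_eq.1 hi
      · rw [hval i hi]; exact hq.lt i hi
      · exact ⟨_, hsrc, hvt⟩
    case inj =>
      intro i hi j hj
      simp only [setArr_arr, setVar_arr, reduceIte, hqu, Fin.reduceEq]
      obtain hi | rfl := Nat.lt_succ_iff_lt_or_eq.1 hi <;>
        obtain hj | rfl := Nat.lt_succ_iff_lt_or_eq.1 hj
      · rw [hval i hi, hval j hj]; exact hq.inj i hi j hj
      · rw [hval i hi, hvt]; exact fun h => absurd ⟨i, hi, h⟩ hnp
      · rw [hval j hj, hvt]; exact fun h => absurd ⟨j, hj, h.symm⟩ hnp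
      · exact fun _ => rfl
    case pushed_iff =>
      intro q hqq
      rw [hpu _ q (by simp [hqu])]
      constructor
      · rintro (h | rfl)
        · exact fun e' he' => (hq.pushed_iff q hqq).1 h e' (Finset.mem_of_mem_erase he')
        · exact hself
      · intro h
        by_cases hqs : q = I.src e
        · exact .inr hqs
        · exact .inl (hoth q hqq hqs h)
    case tgt_pushed =>
      intro e' he' heP'
      rw [hpu _ _ (by simp [hqu])]
      left
      by_cases h : e' = e
      · rwa [h]
      · exact hq.tgt_pushed e' he' fun h' => heP' (Finset.mem_erase.2 ⟨h, h'⟩)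
    case fixed => exact hd

end HL

namespace HL

open Inst

/-! ### Filling and emptying the queue of states. -/

/-- Count the transitions out of every state. -/
def countOut : Cmd :=
  .for vE vM (vP ≔ srcOf ♯vE ⨟ .write aOut ♯vP (.get aOut ♯vP + 1))

theorem countOut_spec {I : Inst} {C : Ctx} (hE : Enc I C) {σ : St} (hst : Static I σ)
    (h0 : σ.arr aOut = fun _ => 0) :
    wp C countOut (fun σ' => σ'.clock ≤ σ.clock + (1 + 3 * I.m) ∧ ∀ q < I.nq,
      σ'.arr aOut q = ((Finset.range I.m).filter fun e => I.src e = q).card) σ := by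
  have hW := hE.one_le_W
  have hA := hE.len_le_A
  have t1 := I.tb_nonneg
  refine wp_for hW I.m 2 (fun k τ => ∀ q < I.nq,
      τ.arr aOut q = ((Finset.range k).filter fun e => I.src e = q).card) (by omega) (by decide)
    hst.m rfl rfl (fun q _ => by simp [h0]) ?_ fun τ _ h hcl => ⟨by omega, h⟩
  rintro e he τ hf hve h1
  replace hst := hst.frame hf rfl
  have n1 : 0 ≤ I.tb + e + e + e := by omega
  have hs := I.src_lt e he
  have hle : ((Finset.range e).filter fun e' => I.src e' = I.src e).card ≤ e := by
    simpa using Finset.card_filter_le (Finset.range e) fun e' => I.src e' = I.src e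
  simp only [srcOf, wp_seq, wp_assign, wp_write, Expr.ok, Expr.eval, Expr.ok_add,
    Expr.eval_add, Expr.ok_ofNat, Expr.eval_ofNat, Expr.eval_one, true_and, and_true,
    Nat.cast_one, Nat.cast_ofNat, setVar_vars, setVar_arr, setVar_clock, setArr_vars, setArr_arr,
    setArr_clock, Nat.reduceEqDiff, Fin.reduceEq, if_true, if_false, reduceIte, hst.tb, hve,
    hE.src e he, n1, h1 _ hs, Int.natCast_nonneg, Nat.add_assoc, Nat.reduceAdd, le_refl]
  refine ⟨Ctx.le_bd hW _ (by omega) (by omega), Ctx.le_bd hW _ (by omega) (by omega),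
    fun q hq => ?_⟩
  rw [Finset.range_add_one, Finset.filter_insert]
  by_cases h : I.src e = q
  · subst h
    rw [if_pos rfl, Function.update_self, Finset.card_insert_of_notMem (by simp)]
    push_cast; rfl
  · have : (q : ℤ) ≠ I.src e := fun h' => h (by exact_mod_cast h'.symm)
    rw [if_neg h, Function.update_of_ne this, h1 q hq]

/-- Put the states without transitions into the queue. -/
def initQueue : Cmd :=
  .for vI vQ (.cond (.get aOut ♯vI) .skip (.write aQu ♯vTl ♯vI ⨟ vTl ≔ ♯vTl + 1))

theorem initQueue_spec {I : Inst} {C : Ctx} (hE : Enc I C) {σ : St} (hst : Static I σ)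
    (hs : Sound I C σ) (hb : I.Based σ.d) (h0 : σ.vars vTl = 0)
    (hout : ∀ q < I.nq, σ.arr aOut q = ((Finset.range I.m).filter fun e => I.src e = q).card) :
    wp C initQueue (fun σ' => σ'.clock ≤ σ.clock + (1 + 3 * I.nq) ∧
      ∃ t, Queue I C (Finset.range I.m) t σ') σ := by
  have hW := hE.one_le_W
  have hA := hE.len_le_A
  refine wp_for hW I.nq 2 (fun k τ => ∃ t ≤ k, τ.vars vTl = t ∧
      (∀ i < t, ∃ q < k, τ.arr aQu (i : ℕ) = q) ∧
      (∀ i < t, ∀ j < t, τ.arr aQu (i : ℕ) = τ.arr aQu (j : ℕ) → i = j) ∧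
      ∀ q < k, (τ.pushed t q ↔ σ.arr aOut q = 0)) (by omega) (by decide)
    hst.nq rfl rfl ⟨0, le_rfl, by simp [h0], by simp, by simp, by simp⟩ ?_ ?_
  · rintro k hk τ hf hvk ⟨t, htk, h1, h2, h3, h4⟩
    have ho : τ.arr aOut = σ.arr aOut := hf.arr aOut rfl
    have hn0 : 0 ≤ σ.arr aOut k := by rw [hout k hk]; exact Int.natCast_nonneg _
    have hnk : ¬ τ.pushed t k := by
      rintro ⟨i, hi, h⟩
      obtain ⟨q, hq, h'⟩ := h2 i hi
      omega
    simp only [wp_seq, wp_assign, wp_write, wp_cond, wp_skip, Expr.ok, Expr.eval, Expr.ok_add,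
      Expr.eval_add, Expr.ok_ofNat, Expr.eval_one, true_and, and_true,
      Nat.cast_one, setVar_vars, setVar_arr, setVar_clock, setArr_vars, setArr_arr,
      setArr_clock, Nat.reduceEqDiff, Fin.reduceEq, if_true, if_false, reduceIte, hvk, h1, ho,
      Int.natCast_nonneg, Nat.add_assoc, Nat.reduceAdd, le_refl]
    refine ⟨fun hpos => ⟨by omega, t, by omega, rfl, fun i hi => ?_, h3, fun q hq => ?_⟩,
      fun hle => ⟨Ctx.le_bd hW _ (by omega) (by omega), Ctx.le_bd hW _ (by omega) (by omega),
      t + 1, by omega, by push_cast; rfl, ?_⟩⟩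
    · obtain ⟨q, hq, h⟩ := h2 i hi
      exact ⟨q, by omega, h⟩
    · change τ.pushed t q ↔ _
      obtain hq | rfl := Nat.lt_succ_iff_lt_or_eq.1 hq
      · exact h4 q hq
      · exact ⟨fun h => absurd h hnk, fun h => absurd h (by omega)⟩
    · have hval : ∀ i < t, Function.update (τ.arr aQu) (t : ℤ) (k : ℤ) (i : ℕ) =
        τ.arr aQu (i : ℕ) := fun i hi => Function.update_of_ne (by omega) _ _
      have hvt : Function.update (τ.arr aQu) (t : ℤ) (k : ℤ) (t : ℕ) = k :=
        Function.update_self _ _ _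
      refine ⟨fun i hi => ?_, fun i hi j hj => ?_, fun q hq => ?_⟩
      · obtain hi | rfl := Nat.lt_succ_iff_lt_or_eq.1 hi
        · obtain ⟨q, hq, h⟩ := h2 i hi
          exact ⟨q, by omega, by rw [hval i hi, h]⟩
        · exact ⟨k, by omega, hvt⟩
      · obtain hi | rfl := Nat.lt_succ_iff_lt_or_eq.1 hi <;>
          obtain hj | rfl := Nat.lt_succ_iff_lt_or_eq.1 hj
        · rw [hval i hi, hval j hj]; exact h3 i hi j hj
        · rw [hval i hi, hvt]; exact fun h => absurd ⟨i, hi, h⟩ hnk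
        · rw [hval j hj, hvt]; exact fun h => absurd ⟨j, hj, h.symm⟩ hnk
        · exact fun _ => rfl
      · unfold St.pushed
        simp only [setVar_arr, setArr_arr, reduceIte]
        constructor
        · rintro ⟨i, hi, h⟩
          obtain hi | rfl := Nat.lt_succ_iff_lt_or_eq.1 hi
          · rw [hval i hi] at h
            obtain ⟨q', hq', h'⟩ := h2 i hi
            exact (h4 q (by omega)).1 ⟨i, hi, h⟩
          · rw [hvt] at h
            have : k = q := by exact_mod_cast h
            subst this
            omega
        · intro h
          obtain hq | rfl := Nat.lt_succ_iff_lt_or_eq.1 hq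
          · obtain ⟨i, hi, h'⟩ := (h4 q hq).2 h
            exact ⟨i, by omega, by rw [hval i hi, h']⟩
          · exact ⟨t, by omega, hvt⟩
  · rintro τ hf ⟨t, htk, h1, h2, h3, h4⟩ hcl
    have hd : τ.d = σ.d := d_congr (hf.arr aPtr rfl) (hf.arr aD rfl)
    refine ⟨by omega, t, h1, hs.frame hf rfl, by rwa [hd], ?_, fun e he => Finset.mem_range.1 he,
      h2, h3, fun q hq => ?_, fun e he h => absurd (Finset.mem_range.2 he) h,
      fun e he h => absurd (Finset.mem_range.2 he) h⟩
    · rw [hf.arr aOut rfl]; exact hout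
    · rw [h4 q hq, hout q hq, Int.natCast_eq_zero, Finset.card_eq_zero, Finset.filter_eq_empty_iff]

/-- Process the states in the queue. -/
def runQueue : Cmd :=
  .loop (♯vTl - ♯vHd) (vR ≔ .get aQu ♯vHd ⨟ vHd ≔ ♯vHd + 1 ⨟ inList vR kahnStep)

/-- `P τ h` consists of the transitions whose target is not among the first `h` entries of the
queue. When the queue is exhausted, no transition into a queued state is left. A state all of whose
transitions lead to queued states has then no unprocessed transition and is queued itself, so by
acyclicity all states are queued. Each transition is handled once, together with its target. -/
theorem runQueue_spec {I : Inst} {C : Ctx} (hE : Enc I C) {σ : St} (hst : Static I σ)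
    (hli : Lists I σ) {t : ℕ} (hq : Queue I C (Finset.range I.m) t σ) (h0 : σ.vars vHd = 0)
    (hac : I.Acyclic) :
    wp C runQueue (fun σ' => σ'.clock ≤ σ.clock + (3 * I.nq + I.m * (14 * I.n + 7)) ∧
      Sound I C σ' ∧ I.Based σ'.d ∧ I.Fixed (fun _ => True) σ'.d) σ := by
  classical
  have hW := hE.one_le_W
  have hA := hE.len_le_A
  let P : St → ℕ → Finset ℕ := fun τ h =>
    (Finset.range I.m).filter fun e => ∀ i < h, τ.arr aQu (i : ℕ) ≠ I.tgt e
  refine wp_loop (fun τ => ∃ h t : ℕ, h ≤ t ∧ τ.vars vHd = h ∧ Queue I C (P τ h) t τ ∧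
      τ.clock + (3 * (I.nq - h) + (P τ h).card * (14 * I.n + 7)) ≤
        σ.clock + (3 * I.nq + I.m * (14 * I.n + 7)))
    (fun τ => I.nq - (τ.vars vHd).toNat) ?_ ?_ ?_
  · have : P σ 0 = Finset.range I.m := by simp [P]
    exact ⟨0, t, Nat.zero_le _, h0, by rwa [this], by rw [this, Finset.card_range, Nat.sub_zero]⟩
  · rintro τ hf ⟨h, t, hht, hvh, hQ, hcl⟩
    refine ⟨⟨trivial, trivial⟩, fun hpos => ?_⟩
    simp only [Expr.eval_sub, Expr.eval, hvh, hQ.tl] at hpos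
    have hlt : h < t := by omega
    have htn := hQ.le_nq
    obtain ⟨q, hqn, hqv⟩ := hQ.lt h hlt
    simp only [wp_seq, wp_assign, Expr.ok, Expr.eval, Expr.ok_add, Expr.eval_add, Expr.ok_ofNat,
      Expr.eval_one, true_and, and_true, Nat.cast_one, setVar_vars, setVar_arr, setVar_clock,
      Nat.reduceEqDiff, if_true, if_false, reduceIte, hvh, hqv, Int.natCast_nonneg]
    refine ⟨Ctx.le_bd hW _ (by omega) (by omega), Ctx.le_bd hW _ (by omega) (by omega), ?_⟩
    set τ₀ := (τ.setVar vR (q : ℤ)).setVar vHd ((h : ℤ) + 1) with hτ₀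
    have hst₀ : Static I τ₀ := ((hst.frame hf rfl).setVar _ _ (by decide)).setVar _ _ (by decide)
    have hli₀ : Lists I τ₀ := by
      have := hli.frame hf rfl rfl
      exact ⟨this.head, this.next⟩
    have hPp : ∀ {k t' : ℕ} {τ' : St}, Queue I C ((P τ h).filter fun e => I.tgt e = q → e < k) t' τ'
        → ∀ z, Queue I C ((P τ h).filter fun e => I.tgt e = q → e < k) t' (τ'.setVar vL z) ∧
          Queue I C ((P τ h).filter fun e => I.tgt e = q → e < k) t' (τ'.setVar vE z) := by
      intro k t' τ' hQ' z
      constructor <;>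
      exact ⟨by simpa using hQ'.tl, hQ'.sound.of_eq (by simp) rfl rfl rfl rfl (by simp), hQ'.based,
        hQ'.out, hQ'.sub, hQ'.lt, hQ'.inj, hQ'.pushed_iff, hQ'.tgt_pushed, hQ'.fixed⟩
    -- At position `k` of the list, the transitions into `q` from `k` on have left `P τ h`; at `k =
    -- 0` what remains is the set for `h + 1`.
    refine wp_inList (r := vR) hE hli₀ hqn (by simp [hτ₀]) (14 * I.n + 5) (fun k τ' => ∃ t',
        t ≤ t' ∧
      (∀ i < t, τ'.arr aQu (i : ℕ) = τ.arr aQu (i : ℕ)) ∧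
      Queue I C ((P τ h).filter fun e => I.tgt e = q → e < k) t' τ') rfl rfl ?_ ?_ ?_ ?_ ?_
    · rintro k τ' z ⟨t', h1, h2, h3⟩
      exact ⟨⟨t', h1, h2, (hPp h3 z).1⟩, ⟨t', h1, h2, (hPp h3 z).2⟩⟩
    · refine ⟨t, le_rfl, fun i _ => rfl, ?_⟩
      have : ((P τ h).filter fun e => I.tgt e = q → e < I.m) = P τ h :=
        Finset.filter_true_of_mem fun e he _ => hQ.sub e he
      rw [this]
      exact ⟨by simpa [hτ₀] using hQ.tl, hQ.sound.of_eq (by simp [hτ₀]) rfl rfl rfl rfl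
        (by simp [hτ₀]; omega), hQ.based,
        hQ.out, hQ.sub, hQ.lt, hQ.inj, hQ.pushed_iff, hQ.tgt_pushed, hQ.fixed⟩
    · rintro τ' e he hne ⟨t', h1, h2, h3⟩
      refine ⟨t', h1, h2, ?_⟩
      have : ((P τ h).filter fun e' => I.tgt e' = q → e' < e) =
          (P τ h).filter fun e' => I.tgt e' = q → e' < e + 1 := by
        refine Finset.filter_congr fun e' _ => ?_
        constructor
        · intro k1 k2; have := k1 k2; omega
        · intro k1 k2
          have := k1 k2
          have : e' ≠ e := fun k3 => hne (k3 ▸ k2)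
          omega
      rwa [this]
    · rintro e he htg τ' hf' hve ⟨t', h1, h2, h3⟩
      have hmem : e ∈ (P τ h).filter fun e' => I.tgt e' = q → e' < e + 1 := by
        refine Finset.mem_filter.2 ⟨Finset.mem_filter.2 ⟨Finset.mem_range.2 he, ?_⟩,
            fun _ => by omega⟩
        intro i hi hh
        rw [htg, ← hqv] at hh
        have := hQ.inj i (by omega) h hlt hh
        omega
      refine wp_mono (kahnStep_spec hE (hst₀.frame hf' rfl) h3 hmem hve
        ⟨h, by omega, by rw [h2 h hlt, hqv, htg]⟩) ?_
      rintro τ'' ⟨hcl'', t'', k1, k2, k3⟩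
      refine ⟨hcl'', t'', h1.trans k1, fun i hi => (k2 i (by omega)).trans (h2 i hi), ?_⟩
      have : ((P τ h).filter fun e' => I.tgt e' = q → e' < e) =
          ((P τ h).filter fun e' => I.tgt e' = q → e' < e + 1).erase e := by
        ext e'
        simp only [Finset.mem_filter, Finset.mem_erase]
        constructor
        · rintro ⟨k4, k5⟩
          refine ⟨fun k6 => ?_, k4, fun k6 => ?_⟩
          · subst k6; exact absurd (k5 htg) (lt_irrefl _)
          · have := k5 k6; omega
        · rintro ⟨k4, k5, k6⟩
          refine ⟨k5, fun k7 => ?_⟩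
          have := k6 k7
          omega
      rwa [this]
    · rintro τ' hf' ⟨t', h1, h2, h3⟩ hcl'
      have hPe : P τ' (h + 1) = (P τ h).filter fun e => I.tgt e = q → e < 0 := by
        ext e
        simp only [P, Finset.mem_filter, Finset.mem_range]
        constructor
        · rintro ⟨k1, k2⟩
          refine ⟨⟨k1, fun i hi hh => k2 i (by omega) ?_⟩, fun k3 => absurd ?_ (k2 h (by omega))⟩
          · rw [h2 i (by omega), hh]
          · rw [h2 h hlt, hqv, k3]
        · rintro ⟨⟨k1, k2⟩, k3⟩
          refine ⟨k1, fun i hi hh => ?_⟩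
          obtain hi | rfl := Nat.lt_succ_iff_lt_or_eq.1 hi
          · exact k2 i hi (by rw [← h2 i (by omega), hh])
          · rw [h2 i hlt, hqv] at hh
            exact absurd (k3 (by exact_mod_cast hh.symm)) (Nat.not_lt_zero _)
      have hcard : (P τ h).card = (P τ' (h + 1)).card + I.indeg q I.m := by
        rw [hPe]
        have : I.indeg q I.m = ((P τ h).filter fun e => ¬ (I.tgt e = q → e < 0)).card := by
          unfold indeg
          congr 1
          ext e
          simp only [P, Finset.mem_filter, Finset.mem_range]
          constructor
          · rintro ⟨k1, k2⟩
            refine ⟨⟨k1, fun i hi hh => ?_⟩, fun k3 => absurd (k3 k2) (Nat.not_lt_zero _)⟩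
            rw [k2, ← hqv] at hh
            have := hQ.inj i (by omega) h hlt hh
            omega
          · rintro ⟨⟨k1, k2⟩, k3⟩
            refine ⟨k1, ?_⟩
            by_contra k4
            exact k3 fun k5 => absurd k5 k4
        rw [this]
        exact (Finset.card_filter_add_card_filter_not _).symm
      have hvh' : τ'.vars vHd = h + 1 := (hf'.var vHd rfl).trans (by simp [hτ₀])
      have hc0 := hf'.clock
      simp only [hτ₀, setVar_clock] at hcl' hc0
      refine ⟨⟨h + 1, t', by omega, by rw [hvh']; push_cast; rfl, by rwa [hPe], ?_⟩, ?_, by omega⟩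
      · rw [hcard, add_mul] at hcl
        have e1 : 14 * I.n + 5 + 2 = 14 * I.n + 7 := by ring
        rw [e1] at hcl'
        omega
      · rw [hvh']; omega
  · rintro τ hf ⟨h, t, hht, hvh, hQ, hcl⟩ hle
    simp only [Expr.eval_sub, Expr.eval, hvh, hQ.tl] at hle
    obtain rfl : h = t := by omega
    have hP : ∀ q, τ.pushed h q → ∀ e, I.tgt e = q → e ∉ P τ h := by
      rintro q ⟨i, hi, hh⟩ e he hmem
      exact (Finset.mem_filter.1 hmem).2 i hi (by rw [hh, he])
    have hall : ∀ q < I.nq, τ.pushed h q := hac _ fun q hq hX => by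
      refine (hQ.pushed_iff q hq).2 fun e he hs => ?_
      exact hP _ (hX e (hQ.sub e he) hs) e rfl he
    refine ⟨by omega, hQ.sound, hQ.based, fun e he u hu hadj _ => ?_⟩
    exact hQ.fixed e he (hP _ (hall _ (I.tgt_lt e he)) e rfl) u hu hadj

def kahn : Cmd :=
  prologue ⨟ buildLists ⨟ seed ⨟ countOut ⨟ initQueue ⨟ runQueue ⨟ output

theorem kahn_spec {I : Inst} {C : Ctx} (hE : Enc I C) (hac : I.Acyclic) :
    wp C kahn (fun σ => σ.clock ≤ 200 * (I.N + I.m * I.n) ∧ I.IsAnswer σ.out) St.init := by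
  have hn := I.n_pos
  have hN : 1 ≤ I.N := Nat.one_le_of_lt I.root_lt
  rw [kahn, wp_seq]
  refine wp_frame (prologue_spec hE) ?_
  rintro σ₁ ⟨hcl₁, hst₁⟩ hf₁
  rw [wp_seq]
  refine wp_frame (buildLists_spec hE hst₁ (hf₁.arr aHead rfl)) ?_
  rintro σ₂ ⟨hcl₂, hli₂⟩ hf₂
  replace hf₁ := hf₁.seq hf₂
  have hst₂ := hst₁.frame hf₂ rfl
  have hs₂ : Sound I C σ₂ := by
    have hc : σ₂.vars vCnt = 0 := hf₁.var vCnt rfl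
    refine ⟨by omega, by omega, fun x _ => .inl ?_⟩
    rw [hf₁.arr aPtr rfl]; rfl
  rw [wp_seq]
  refine wp_frame (seed_spec hE hst₂ hs₂) ?_
  rintro σ₃ ⟨hcl₃, hs₃, hb₃⟩ hf₃
  have hst₃ := hst₂.frame hf₃ rfl
  have hli₃ := hli₂.frame hf₃ rfl rfl
  replace hf₁ := hf₁.seq hf₃
  rw [wp_seq]
  refine wp_frame (countOut_spec hE hst₃ (hf₁.arr aOut rfl)) ?_
  rintro σ₄ ⟨hcl₄, hout₄⟩ hf₄
  have hst₄ := hst₃.frame hf₄ rfl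
  have hli₄ := hli₃.frame hf₄ rfl rfl
  have hb₄ : I.Based σ₄.d := by
    rw [d_congr (hf₄.arr aPtr rfl) (hf₄.arr aD rfl)]; exact hb₃
  replace hf₁ := hf₁.seq hf₄
  rw [wp_seq]
  refine wp_frame (initQueue_spec hE hst₄ (hs₃.frame hf₄ rfl) hb₄ (hf₁.var vTl rfl) hout₄) ?_
  rintro σ₅ ⟨hcl₅, t, hQ⟩ hf₅
  have hst₅ := hst₄.frame hf₅ rfl
  have hli₅ := hli₄.frame hf₅ rfl rfl
  replace hf₁ := hf₁.seq hf₅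
  rw [wp_seq]
  refine wp_frame (runQueue_spec hE hst₅ hli₅ hQ (hf₁.var vHd rfl) hac) ?_
  rintro σ₆ ⟨hcl₆, hs₆, hb₆, hfix₆⟩ hf₆
  have hst₆ := hst₅.frame hf₆ rfl
  replace hf₁ := hf₁.seq hf₆
  have ho : σ₆.out = [] := hf₁.out rfl
  refine wp_mono (output_spec hE hst₆ hs₆ ho (S := fun _ => True) (fun _ _ _ _ _ _ => trivial)
    trivial hfix₆ hb₆) ?_
  rintro σ₇ ⟨hcl₇, hans⟩
  have := hs₆.cnt_le
  have h1 : I.m ≤ I.m * I.n := Nat.le_mul_of_pos_right _ hn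
  have h2 : I.nq ≤ I.N := Nat.le_mul_of_pos_right _ hn
  have e1 : I.m * (14 * I.n + 7) = 14 * (I.m * I.n) + 7 * I.m := by ring
  rw [e1] at hcl₆
  exact ⟨by omega, hans⟩

end HL

/-! ### Nonnegative weights: Dijkstra's algorithm with a tournament tree -/

namespace HL

open Inst

/-- `j` is `i` or above `i` in the binary tree. -/
def Anc (j i : ℕ) : Prop := ∃ k, i / 2 ^ k = j

theorem Anc.refl (i : ℕ) : Anc i i := ⟨0, by simp⟩

theorem anc_iff {j i : ℕ} : Anc j i ↔ j = i ∨ Anc j (i / 2) := by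
  constructor
  · rintro ⟨k, hk⟩
    cases k with
    | zero => left; simpa using hk.symm
    | succ k => right; exact ⟨k, by rw [Nat.div_div_eq_div_mul, ← pow_succ', hk]⟩
  · rintro (rfl | ⟨k, hk⟩)
    · exact .refl _
    · exact ⟨k + 1, by rw [pow_succ', ← Nat.div_div_eq_div_mul, hk]⟩

theorem Anc.half {j i : ℕ} (h : Anc j i) : Anc (j / 2) i := by
  obtain ⟨k, hk⟩ := h
  exact ⟨k + 1, by rw [pow_succ, ← Nat.div_div_eq_div_mul, hk]⟩

/-- Makes `Heap I 0` the statement that the tree is correct throughout, since the proper indices are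
positive. -/
theorem anc_zero {j : ℕ} (h : Anc j 0) : j = 0 := by
  obtain ⟨k, hk⟩ := h
  simpa using hk.symm

/-- The entry `k` of the tree. -/
def St.tr (σ : St) (k : ℕ) : ℤ := σ.arr aTree k

/-- The entry `j` of the tree is the better one of the two entries below it. -/
structure St.Winner (σ : St) (j : ℕ) : Prop where
  mem : σ.tr j = σ.tr (2 * j) ∨ σ.tr j = σ.tr (2 * j + 1)
  left : 0 < σ.tr (2 * j) → 0 < σ.tr j ∧ σ.arr aD (σ.tr j - 1) ≤ σ.arr aD (σ.tr (2 * j) - 1)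
  right : 0 < σ.tr (2 * j + 1) →
    0 < σ.tr j ∧ σ.arr aD (σ.tr j - 1) ≤ σ.arr aD (σ.tr (2 * j + 1) - 1)

theorem St.Winner.congr {σ σ' : St} {j : ℕ} (h : σ.Winner j) (h0 : σ'.tr j = σ.tr j)
    (h1 : σ'.tr (2 * j) = σ.tr (2 * j)) (h2 : σ'.tr (2 * j + 1) = σ.tr (2 * j + 1))
    (hd : ∀ k, (k = j ∨ k = 2 * j ∨ k = 2 * j + 1) → 0 < σ.tr k →
      σ'.arr aD (σ.tr k - 1) = σ.arr aD (σ.tr k - 1)) : σ'.Winner j := by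
  refine ⟨by rw [h0, h1, h2]; exact h.mem, ?_, ?_⟩
  · rw [h0, h1]
    intro hp
    obtain ⟨h3, h4⟩ := h.left hp
    exact ⟨h3, by rwa [hd j (.inl rfl) h3, hd _ (.inr (.inl rfl)) hp]⟩
  · rw [h0, h2]
    intro hp
    obtain ⟨h3, h4⟩ := h.right hp
    exact ⟨h3, by rwa [hd j (.inl rfl) h3, hd _ (.inr (.inr rfl)) hp]⟩

/-- The tournament tree is correct except at the nodes from `i` upwards. The leaf `N + x` has
the entry `x + 1` or `0`. -/
structure Heap (I : Inst) (i : ℕ) (σ : St) : Prop where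
  range : ∀ k, 0 ≤ σ.tr k ∧ σ.tr k ≤ I.N
  leaf : ∀ x < I.N, σ.tr (I.N + x) = 0 ∨ σ.tr (I.N + x) = x + 1
  win : ∀ j, 0 < j → j < I.N → ¬ Anc j i → σ.Winner j

theorem Heap.congr {I : Inst} {i : ℕ} {σ σ' : St} (h : Heap I i σ)
    (h1 : σ'.arr aTree = σ.arr aTree) (h2 : σ'.arr aD = σ.arr aD) : Heap I i σ' := by
  have ht : σ'.tr = σ.tr := by funext k; unfold St.tr; rw [h1]
  refine ⟨by rw [ht]; exact h.range, by rw [ht]; exact h.leaf, fun j h3 h4 h5 => ?_⟩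
  exact (h.win j h3 h4 h5).congr (by rw [ht]) (by rw [ht]) (by rw [ht]) fun _ _ _ => by rw [h2]

theorem Heap.win' {I : Inst} {σ : St} (h : Heap I 0 σ) {j : ℕ} (h0 : 0 < j) (hj : j < I.N) :
    σ.Winner j :=
  h.win j h0 hj fun h => by have := anc_zero h; omega

/-- Every entry of the tree comes from a leaf. -/
theorem Heap.own {I : Inst} {σ : St} (h : Heap I 0 σ) {j : ℕ} (h0 : 0 < j) (hj : j < 2 * I.N)
    (hp : 0 < σ.tr j) : ∃ x < I.N, σ.tr j = x + 1 ∧ σ.tr (I.N + x) = x + 1 ∧ Anc j (I.N + x) := by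
  by_cases hjN : j < I.N
  · obtain h1 | h1 := (h.win' h0 hjN).mem
    · rw [h1] at hp ⊢
      obtain ⟨x, h2, h3, h4, h5⟩ := h.own (j := 2 * j) (by omega) (by omega) hp
      have := h5.half
      rw [show 2 * j / 2 = j by omega] at this
      exact ⟨x, h2, h3, h4, this⟩
    · rw [h1] at hp ⊢
      obtain ⟨x, h2, h3, h4, h5⟩ := h.own (j := 2 * j + 1) (by omega) (by omega) hp
      have := h5.half
      rw [show (2 * j + 1) / 2 = j by omega] at this
      exact ⟨x, h2, h3, h4, this⟩
  · obtain ⟨x, rfl⟩ : ∃ x, j = I.N + x := ⟨j - I.N, by omega⟩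
    have := (h.leaf x (by omega)).resolve_left (by omega)
    exact ⟨x, by omega, this, this, .refl _⟩
termination_by 2 * I.N - j

/-- The entry at the root of the tree has minimal value. -/
theorem Heap.top {I : Inst} {σ : St} (h : Heap I 0 σ) {j : ℕ} (h0 : 0 < j) (hj : j < 2 * I.N)
    (hp : 0 < σ.tr j) : 0 < σ.tr 1 ∧ σ.arr aD (σ.tr 1 - 1) ≤ σ.arr aD (σ.tr j - 1) := by
  by_cases h1 : j = 1
  · subst h1; exact ⟨hp, le_rfl⟩
  · have hw := h.win' (j := j / 2) (by omega) (by omega)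
    have : 0 < σ.tr (j / 2) ∧ σ.arr aD (σ.tr (j / 2) - 1) ≤ σ.arr aD (σ.tr j - 1) := by
      obtain h2 | h2 : j = 2 * (j / 2) ∨ j = 2 * (j / 2) + 1 := by omega
      · have := hw.left (by rwa [← h2]); rwa [← h2] at this
      · have := hw.right (by rwa [← h2]); rwa [← h2] at this
    obtain ⟨h3, h4⟩ := h.top (j := j / 2) (by omega) (by omega) this.1
    exact ⟨h3, h4.trans this.2⟩
termination_by j

/-- Changing a leaf and its value. -/
theorem Heap.change {I : Inst} {σ σ' : St} (h : Heap I 0 σ) {x : ℕ} (hx : x < I.N)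
    (h1 : ∀ k, k ≠ I.N + x → σ'.tr k = σ.tr k)
    (h2 : σ'.tr (I.N + x) = 0 ∨ σ'.tr (I.N + x) = x + 1)
    (hd : ∀ z : ℕ, z ≠ x → σ'.arr aD z = σ.arr aD z) : Heap I ((I.N + x) / 2) σ' := by
  refine ⟨fun k => ?_, fun z hz => ?_, fun j h0 hj hanc => ?_⟩
  · by_cases hk : k = I.N + x
    · subst hk; omega
    · rw [h1 k hk]; exact h.range k
  · by_cases hk : z = x
    · subst hk; exact h2
    · rw [h1 _ (by omega)]; exact h.leaf z hz
  · have e1 : 2 * j ≠ I.N + x := fun h' =>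
      hanc (by rw [← h', show 2 * j / 2 = j by omega]; exact .refl j)
    have e2 : 2 * j + 1 ≠ I.N + x := fun h' =>
      hanc (by rw [← h', show (2 * j + 1) / 2 = j by omega]; exact .refl j)
    refine (h.win' h0 hj).congr (h1 _ (by omega)) (h1 _ e1) (h1 _ e2) fun k hk hp => ?_
    -- An entry comes from a leaf below it. If the changed node occurred in a comparison at `j`,
    -- then `j` would be above its leaf, which is excluded.
    obtain ⟨z, h3, h4, _, h5⟩ := h.own (j := k) (by omega) (by omega) hp
    rw [h4, add_sub_cancel_right]
    refine hd z fun hzx => hanc ?_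
    subst hzx
    have h6 : Anc k ((I.N + z) / 2) := (anc_iff.1 h5).resolve_left (by omega)
    obtain rfl | rfl | rfl := hk
    · exact h6
    · have := h6.half; rwa [show 2 * j / 2 = j by omega] at this
    · have := h6.half; rwa [show (2 * j + 1) / 2 = j by omega] at this

/-! ### Repairing the tree along a branch. -/

/-- Recompute the entry `vI` of the tree. -/
def recompute : Cmd :=
  vJ ≔ .get aTree (♯vI + ♯vI) ⨟ vP ≔ .get aTree (♯vI + ♯vI + 1) ⨟
  .cond ♯vJ (.cond ♯vP (.cond (.get aD (♯vJ - 1) - .get aD (♯vP - 1)) (vJ ≔ ♯vP) .skip) .skip)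
    (vJ ≔ ♯vP) ⨟
  .write aTree ♯vI ♯vJ

/-- Entry `i` takes part only in the comparisons at `i` and at its parent, so correcting it moves
the possible errors up to `i / 2`. -/
theorem recompute_spec {I : Inst} {C : Ctx} (hE : Enc I C) {σ : St} {i : ℕ} (hi0 : 0 < i)
    (hi : i < I.N) (hvi : σ.vars vI = i) (hh : Heap I i σ) :
    wp C recompute (fun σ' => σ'.clock ≤ σ.clock + 4 ∧ σ.clock < σ'.clock ∧
      (∀ x, σ'.tr (I.N + x) = σ.tr (I.N + x)) ∧ Heap I (i / 2) σ') σ := by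
  have hW := hE.one_le_W
  have hA := hE.N_le_A
  have r1 := hh.range (2 * i)
  have r2 := hh.range (2 * i + 1)
  have e1 : σ.arr aTree ((i : ℤ) + i) = σ.tr (2 * i) := by
    unfold St.tr; congr 1; push_cast; ring
  have e2 : σ.arr aTree ((i : ℤ) + i + 1) = σ.tr (2 * i + 1) := by
    unfold St.tr; congr 1; push_cast; ring
  have n1 : (0 : ℤ) ≤ i + i := by omega
  have n2 : (0 : ℤ) ≤ i + i + 1 := by omega
  have main : ∀ σ' : St, ∀ v : ℤ, σ'.arr aTree = Function.update (σ.arr aTree) (i : ℤ) v →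
      σ'.arr aD = σ.arr aD → (v = σ.tr (2 * i) ∨ v = σ.tr (2 * i + 1)) →
      (0 < σ.tr (2 * i) → 0 < v ∧ σ.arr aD (v - 1) ≤ σ.arr aD (σ.tr (2 * i) - 1)) →
      (0 < σ.tr (2 * i + 1) → 0 < v ∧ σ.arr aD (v - 1) ≤ σ.arr aD (σ.tr (2 * i + 1) - 1)) →
      (∀ x, σ'.tr (I.N + x) = σ.tr (I.N + x)) ∧ Heap I (i / 2) σ' := by
    intro σ' v h1 h2 h3 h4 h5
    have t1 : ∀ k, k ≠ i → σ'.tr k = σ.tr k := fun k hk => by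
      unfold St.tr
      rw [h1, Function.update_of_ne (by exact_mod_cast hk)]
    have t2 : σ'.tr i = v := by
      unfold St.tr
      rw [h1, Function.update_self]
    refine ⟨fun x => t1 _ (by omega), fun k => ?_, fun x hx => ?_, fun j h0 hj hanc => ?_⟩
    · by_cases hk : k = i
      · subst hk; rw [t2]; omega
      · rw [t1 k hk]; exact hh.range k
    · rw [t1 _ (by omega)]; exact hh.leaf x hx
    · by_cases hji : j = i
      · subst hji
        have t3 := t1 (2 * j) (by omega)
        have t4 := t1 (2 * j + 1) (by omega)
        refine ⟨?_, ?_, ?_⟩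
        · rwa [t2, t3, t4]
        · rwa [t2, t3, h2]
        · rwa [t2, t4, h2]
      · have hne : j ≠ i / 2 := fun h => hanc (h ▸ .refl _)
        refine (hh.win j h0 hj fun h => hanc ((anc_iff.1 h).resolve_left hji)).congr (t1 _ hji)
          (t1 _ (by omega)) (t1 _ (by omega)) fun _ _ _ => by rw [h2]
  have b1 : ∀ τ : ℕ, |σ.tr (2 * i)| ≤ C.bd τ := fun τ => Ctx.le_bd hW _ (by omega) (by omega)
  have b2 : ∀ τ : ℕ, |σ.tr (2 * i + 1)| ≤ C.bd τ := fun τ => Ctx.le_bd hW _ (by omega) (by omega)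
  simp only [recompute, wp_seq, wp_assign, wp_write, wp_cond, wp_skip, Expr.ok, Expr.eval,
    Expr.ok_add, Expr.eval_add, Expr.ok_sub, Expr.eval_sub, Expr.ok_ofNat, Expr.eval_one,
    true_and, and_true, setVar_vars, setVar_arr, setVar_clock, setArr_clock, Nat.reduceEqDiff,
    if_true, if_false, reduceIte, hvi, e1, e2, n1, n2, b1, b2, Int.natCast_nonneg, Nat.add_assoc,
    Nat.reduceAdd, Nat.cast_one]
  refine ⟨fun h1 => ⟨fun h2 => ⟨by omega, fun h3 => ⟨by omega, by omega,
      main _ (σ.tr (2 * i + 1)) (by simp) (by simp)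
    (.inr rfl) ?_ ?_⟩, fun h3 => ⟨by omega, by omega,
    main _ (σ.tr (2 * i)) (by simp) (by simp) (.inl rfl) ?_ ?_⟩⟩,
    fun h2 => ⟨by omega, by omega, main _ (σ.tr (2 * i)) (by simp) (by simp) (.inl rfl) ?_ ?_⟩⟩,
    fun h1 => ⟨by omega, by omega, main _ (σ.tr (2 * i + 1)) (by simp) (by simp) (.inr rfl) ?_ ?_⟩⟩
  all_goals
    intro h4
    omega

/-- Update the tree above the leaf of the node `vX`. -/
def climb : Cmd :=
  vI ≔ .get aPar (♯vNd + ♯vX) ⨟ .loop ♯vI (recompute ⨟ vI ≔ .get aPar ♯vI)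

/-- The table `aPar` replaces halving. An index below `2 ^ k` is at most `k` rounds away from 0, and
a round takes four time units for the entry and one for the step upwards. -/
theorem climb_spec {I : Inst} {C : Ctx} (hE : Enc I C) {σ : St} (hst : Static I σ)
    (hpar : ∀ k < 2 * I.N, σ.arr aPar (k : ℕ) = (k / 2 : ℕ)) {L : ℕ} (hL : I.N ≤ 2 ^ L) {x : ℕ}
    (hx : x < I.N) (hvx : σ.vars vX = x) (hh : Heap I ((I.N + x) / 2) σ) :
    wp C climb (fun σ' => σ'.clock ≤ σ.clock + (1 + 5 * L) ∧
      (∀ x, σ'.tr (I.N + x) = σ.tr (I.N + x)) ∧ Heap I 0 σ') σ := by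
  have hW := hE.one_le_W
  have hA := hE.N_le_A
  have e1 : ((I.N : ℕ) : ℤ) + x = (I.N + x : ℕ) := by push_cast; rfl
  simp only [climb, wp_seq, wp_assign, Expr.ok, Expr.eval, Expr.ok_add, Expr.eval_add, true_and,
    hst.N, hvx, e1, hpar (I.N + x) (by omega), Int.natCast_nonneg]
  refine ⟨Ctx.le_bd hW _ (by omega) (by omega), ?_⟩
  refine wp_loop (fun τ => ∃ i k : ℕ, τ.vars vI = i ∧ i < I.N ∧ i < 2 ^ k ∧
    τ.clock + 5 * k ≤ σ.clock + (1 + 5 * L) ∧ (∀ x, τ.tr (I.N + x) = σ.tr (I.N + x)) ∧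
    Heap I i τ) (fun τ => (τ.vars vI).toNat) ⟨(I.N + x) / 2, L, by simp, by omega, by omega,
      by simp; omega, fun _ => rfl, hh.congr rfl rfl⟩ ?_ ?_
  · rintro τ hf ⟨i, k, h1, h2, h3, h4, h5, h6⟩
    refine ⟨trivial, fun hpos => ?_⟩
    simp only [Expr.eval, h1] at hpos
    have hi0 : 0 < i := by omega
    rw [wp_seq]
    refine wp_frame (recompute_spec hE hi0 h2 h1 h6) ?_
    rintro τ' ⟨k1, k2, k3, k4⟩ hf'
    have hvi : τ'.vars vI = i := (hf'.var vI rfl).trans h1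
    have hp : τ'.arr aPar (i : ℕ) = (i / 2 : ℕ) := by
      rw [hf'.arr aPar rfl, hf.arr aPar rfl]
      exact hpar i (by omega)
    simp only [wp_assign, Expr.ok, Expr.eval, true_and, hvi, hp, Int.natCast_nonneg]
    obtain ⟨k, rfl⟩ : ∃ k', k = k' + 1 := by
      cases k with
      | zero => simp at h3; omega
      | succ k => exact ⟨k, rfl⟩
    rw [pow_succ] at h3
    refine ⟨Ctx.le_bd hW _ (by omega) (by omega), ⟨i / 2, k, by simp, by omega, by omega,
      by simp; omega, fun z => (k3 z).trans (h5 z), k4.congr rfl rfl⟩, ?_, ?_⟩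
    · simp [h1]; omega
    · simp; omega
  · rintro τ hf ⟨i, k, h1, h2, h3, h4, h5, h6⟩ hle
    simp only [Expr.eval, h1] at hle
    obtain rfl : i = 0 := by omega
    exact ⟨by omega, h5, h6⟩

/-- Activate the leaf of the node `vX`, and update the tree. -/
def insert : Cmd := .write aTree (♯vNd + ♯vX) (♯vX + 1) ⨟ climb

/-- Here `σ` is the last state with a correct tree, whereas `τ` may already have a new value at `x`.
The leaf and its value thus count as a single change to be repaired. -/
theorem insert_spec {I : Inst} {C : Ctx} (hE : Enc I C) {σ τ : St} (hst : Static I τ)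
    (hpar : ∀ k < 2 * I.N, τ.arr aPar (k : ℕ) = (k / 2 : ℕ)) {L : ℕ} (hL : I.N ≤ 2 ^ L) {x : ℕ}
    (hx : x < I.N) (hvx : τ.vars vX = x) (hh : Heap I 0 σ) (h1 : τ.arr aTree = σ.arr aTree)
    (hd : ∀ z : ℕ, z ≠ x → τ.arr aD z = σ.arr aD z) :
    wp C insert (fun σ' => σ'.clock ≤ τ.clock + (2 + 5 * L) ∧ σ'.tr (I.N + x) = x + 1 ∧
      (∀ z, z ≠ x → σ'.tr (I.N + z) = σ.tr (I.N + z)) ∧ Heap I 0 σ') τ := by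
  have hW := hE.one_le_W
  have hA := hE.N_le_A
  have e1 : ((I.N : ℕ) : ℤ) + x = (I.N + x : ℕ) := by push_cast; rfl
  simp only [insert, wp_seq, wp_write, Expr.ok, Expr.eval, Expr.ok_add, Expr.eval_add,
    Expr.ok_ofNat, Expr.eval_one, true_and, and_true, hst.N, hvx, e1, Int.natCast_nonneg]
  refine ⟨Ctx.le_bd hW _ (by omega) (by omega), ?_⟩
  have t1 : ∀ k, k ≠ I.N + x → (τ.setArr aTree (I.N + x : ℕ) (x + 1)).tr k = σ.tr k :=
    fun k hk => by
      unfold St.tr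
      rw [setArr_arr, if_pos rfl, Function.update_of_ne (by exact_mod_cast hk), h1]
  have t2 : (τ.setArr aTree (I.N + x : ℕ) (x + 1)).tr (I.N + x) = x + 1 := by
    unfold St.tr
    rw [setArr_arr, if_pos rfl, Function.update_self]
  refine wp_mono (climb_spec hE ?_ ?_ hL hx (by simpa using hvx)
    (hh.change hx t1 (.inr t2) (by simpa using hd))) ?_
  · exact hst.frame (c := .write aTree 0 0) ⟨fun _ _ => rfl, fun k hk => by
      simp only [Cmd.keepsArr, bne_iff_ne] at hk
      simp [hk], fun _ => rfl, Nat.le_succ _⟩ rfl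
  · simpa using hpar
  · rintro σ' ⟨k1, k2, k3⟩
    simp only [setArr_clock] at k1
    exact ⟨by omega, (k2 x).trans t2, fun z hz => (k2 z).trans (t1 _ (by omega)), k3⟩

def parTable : Cmd :=
  .for vI vNd (.write aPar (♯vI + ♯vI) ♯vI ⨟ .write aPar (♯vI + ♯vI + 1) ♯vI)

theorem parTable_spec {I : Inst} {C : Ctx} (hE : Enc I C) {σ : St} (hst : Static I σ) :
    wp C parTable (fun σ' => σ'.clock ≤ σ.clock + (1 + 3 * I.N) ∧
      ∀ k < 2 * I.N, σ'.arr aPar (k : ℕ) = (k / 2 : ℕ)) σ := by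
  have hW := hE.one_le_W
  have hA := hE.N_le_A
  refine wp_for hW I.N 2 (fun j τ => ∀ k < 2 * j, τ.arr aPar (k : ℕ) = (k / 2 : ℕ)) (by omega)
    (by decide) hst.N rfl rfl (fun k hk => absurd hk (by omega)) ?_
    fun τ _ h hcl => ⟨by omega, h⟩
  rintro j hj τ hf hvj h1
  have n1 : (0 : ℤ) ≤ j + j := by omega
  have n2 : (0 : ℤ) ≤ j + j + 1 := by omega
  simp only [wp_seq, wp_write, Expr.ok, Expr.eval, Expr.ok_add, Expr.eval_add, Expr.ok_ofNat,
    Expr.eval_one, true_and, and_true, Nat.cast_one, setVar_vars, setVar_arr, setArr_vars,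
    setArr_arr, setArr_clock, if_true, reduceIte, hvj, n1, n2, Nat.add_assoc, Nat.reduceAdd,
    le_refl]
  refine ⟨Ctx.le_bd hW _ (by omega) (by omega), Ctx.le_bd hW _ (by omega) (by omega),
    fun k hk => ?_⟩
  by_cases k1 : k = 2 * j + 1
  · have : (k : ℤ) = j + j + 1 := by omega
    rw [this, Function.update_self]
    omega
  · rw [Function.update_of_ne (by omega)]
    by_cases k2 : k = 2 * j
    · have : (k : ℤ) = j + j := by omega
      rw [this, Function.update_self]
      omega
    · rw [Function.update_of_ne (by omega), h1 k (by omega)]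

/-- Activate all nodes with finite value. -/
def insertAll : Cmd := .for vX vNd (.cond (.get aPtr ♯vX) insert .skip)

theorem insertAll_spec {I : Inst} {C : Ctx} (hE : Enc I C) {σ : St} (hst : Static I σ)
    (hs : Sound I C σ)
    (hpar : ∀ k < 2 * I.N, σ.arr aPar (k : ℕ) = (k / 2 : ℕ)) {L : ℕ} (hL : I.N ≤ 2 ^ L)
    (h0 : σ.arr aTree = fun _ => 0) :
    wp C insertAll (fun σ' => σ'.clock ≤ σ.clock + (1 + I.N * (3 + 5 * L)) ∧ Heap I 0 σ' ∧
      ∀ x < I.N, σ'.tr (I.N + x) = 0 ↔ σ'.arr aPtr x = 0) σ := by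
  have hW := hE.one_le_W
  have hA := hE.N_le_A
  refine wp_for hW I.N (2 + 5 * L) (fun k τ => Heap I 0 τ ∧
      (∀ x < k, τ.tr (I.N + x) = 0 ↔ σ.arr aPtr x = 0) ∧ ∀ x, k ≤ x → τ.tr (I.N + x) = 0) (by omega)
    (by decide) hst.N rfl rfl ⟨⟨fun k => ?_, fun x _ => .inl ?_, fun j _ _ _ => ?_⟩,
      fun x hx => absurd hx (Nat.not_lt_zero _), fun x _ => ?_⟩ ?_ fun τ hf h hcl => ⟨?_, h.1, ?_⟩
  · simp [St.tr, h0]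
  · simp [St.tr, h0]
  · exact ⟨by simp [St.tr, h0], by simp [St.tr, h0], by simp [St.tr, h0]⟩
  · simp [St.tr, h0]
  · rintro x hx τ hf hvx ⟨h1, h2, h3⟩
    have hp : τ.arr aPtr = σ.arr aPtr := hf.arr aPtr rfl
    simp only [wp_cond, wp_skip, Expr.ok, Expr.eval, true_and, hvx, hp, Int.natCast_nonneg]
    refine ⟨fun hpos => ?_, fun hle => ⟨by omega, h1.congr rfl rfl, fun z hz => ?_,
      fun z hz => h3 z (by omega)⟩⟩
    · refine wp_mono (insert_spec hE (hst.frame hf rfl) ?_ hL hx hvx h1 rfl fun _ _ => rfl) ?_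
      · rw [hf.arr aPar rfl]; exact hpar
      rintro τ' ⟨k1, k2, k3, k4⟩
      refine ⟨k1, k4.congr rfl rfl, fun z hz => ?_, fun z hz => ?_⟩
      · change τ'.tr _ = 0 ↔ _
        obtain hz | rfl := Nat.lt_succ_iff_lt_or_eq.1 hz
        · rw [k3 z (by omega)]; exact h2 z hz
        · rw [k2]; constructor <;> intro <;> omega
      · exact (k3 z (by omega)).trans (h3 z (by omega))
    · change τ.tr _ = 0 ↔ _
      obtain hz | rfl := Nat.lt_succ_iff_lt_or_eq.1 hz
      · exact h2 z hz
      · have := hs.cell z hx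
        rw [h3 z le_rfl]
        constructor <;> intro <;> omega
  · have : 2 + 5 * L + 1 = 3 + 5 * L := by ring
    rw [this] at hcl; omega
  · rw [hf.arr aPtr rfl]; exact h.2.1

/-! ### Final nodes and the main loop of Dijkstra's algorithm. -/

/-- The value of `x` is final. -/
def St.fin (I : Inst) (σ : St) (x : ℕ) : Prop := σ.arr aPtr x ≠ 0 ∧ σ.tr (I.N + x) = 0

/-- The invariant of Dijkstra's algorithm; the relaxations with `P e u` are not yet done. -/
structure Settled (I : Inst) (C : Ctx) (P : ℕ → ℕ → Prop) (σ : St) : Prop where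
  sound : Sound I C σ
  based : I.Based σ.d
  heap : Heap I 0 σ
  act : ∀ x < I.N, σ.tr (I.N + x) ≠ 0 → σ.arr aPtr x ≠ 0
  ord : ∀ y < I.N, σ.fin I y → ∀ x < I.N, ¬ σ.fin I x → σ.d y ≤ σ.d x
  relaxed : ∀ e < I.m, ∀ u < I.n, I.adj (I.lab e) u → σ.fin I (I.yt e u) → ¬ P e u →
    σ.d (I.xs e) ≤ σ.d (I.yt e u) + (I.w (I.lab e) u : ℤ)

theorem fin_congr {I : Inst} {σ σ' : St} (h1 : σ'.arr aPtr = σ.arr aPtr)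
    (h2 : ∀ x, σ'.tr (I.N + x) = σ.tr (I.N + x)) : σ'.fin I = σ.fin I := by
  funext x
  unfold St.fin
  rw [h1, h2]

theorem Settled.setVar {I : Inst} {C : Ctx} {P : ℕ → ℕ → Prop} {σ : St} (h : Settled I C P σ)
    (x : ℕ) (z : ℤ) (hx : x ≠ vCnt) : Settled I C P (σ.setVar x z) :=
  ⟨h.sound.of_eq (by simp [hx.symm]) rfl rfl rfl rfl (by simp), h.based, h.heap.congr rfl rfl,
    h.act, h.ord, h.relaxed⟩

/-- Relax transition `vE` with the next vertex `vU`, and update the tree. -/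
def settleStep : Cmd := vChg ≔ 0 ⨟ relax ⨟ .cond ♯vChg insert .skip

/-- As weights are non-negative, the candidate is at least the value of the node being settled,
which by `hmax` is at least every final value. A strict improvement therefore only affects a node
that is not final; final values persist and stay below the others. -/
theorem settleStep_spec {I : Inst} {C : Ctx} (hE : Enc I C)
    (hw : ∀ v < I.n, ∀ u < I.n, I.adj v u → 0 ≤ I.w v u) {σ : St} (hst : Static I σ)
    (hpar : ∀ k < 2 * I.N, σ.arr aPar (k : ℕ) = (k / 2 : ℕ)) {L : ℕ} (hL : I.N ≤ 2 ^ L)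
    {P : ℕ → ℕ → Prop} (hs : Settled I C P σ) {e u : ℕ} (he : e < I.m) (hu : u < I.n)
    (hve : σ.vars vE = e) (hvu : σ.vars vU = u) (hfin : σ.fin I (I.yt e u))
    (hmax : ∀ x < I.N, σ.fin I x → σ.d x ≤ σ.d (I.yt e u)) :
    wp C settleStep (fun σ' => σ'.clock ≤ σ.clock + (16 + 5 * L) ∧
      Settled I C (fun e' u' => P e' u' ∧ ¬ (e' = e ∧ u' = u)) σ' ∧
      (∀ x < I.N, σ'.fin I x ↔ σ.fin I x) ∧
      (∀ x < I.N, σ.fin I x → σ'.d x = σ.d x)) σ := by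
  have hW := hE.one_le_W
  have hA := hE.N_le_A
  have hx := I.xs_lt he
  have hy := I.yt_lt he hu
  rw [settleStep, wp_seq, wp_assign]
  refine ⟨trivial, Ctx.le_bd hW _ le_rfl (by positivity), ?_⟩
  rw [Expr.eval_zero, wp_seq]
  have hst₀ := hst.setVar vChg 0 (by decide)
  have hs₀ := hs.setVar vChg 0 (by decide)
  refine wp_frame (relax_spec hE hst₀ hs₀.sound he hu (by simpa using hve) (by simpa using hvu)) ?_
  rintro τ ⟨hcl, hR⟩ hf
  replace hst := hst₀.frame hf rfl
  have htree : τ.arr aTree = σ.arr aTree := hf.arr aTree rfl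
  have htr : τ.tr = σ.tr := by funext k; unfold St.tr; rw [htree]
  have hpar' : τ.arr aPar = σ.arr aPar := hf.arr aPar rfl
  have hle : ∀ z, τ.d z ≤ σ.d z := hR.d_le
  have hoff : ∀ z, z ≠ I.xs e → τ.d z = σ.d z := fun z hz => hR.d_off hz
  simp only [setVar_clock] at hcl
  simp only [wp_cond, wp_skip, Expr.ok, Expr.eval, true_and]
  obtain ⟨h1, h2, h3⟩ | ⟨h1, h2, hadj, c, p, h3, h4, h5, h6⟩ := hR.at_x
  · have h1' : τ.vars vChg = 0 := h1.trans (by simp)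
    have hd : τ.d = σ.d := d_congr h2 h3
    have hfe : τ.fin I = σ.fin I := fin_congr h2 fun x => by rw [htr]
    refine ⟨fun h => by omega, fun _ => ⟨by omega, ⟨hR.sound, by rw [hd]; exact hs.based,
      hs.heap.congr htree h3, by rw [htr, h2]; exact hs.act, by rw [hfe, hd]; exact hs.ord,
      fun e' he' u' hu' hadj' hf' hP => ?_⟩, fun x _ => by rw [hfe], fun x _ _ => by rw [hd]⟩⟩
    by_cases h : e' = e ∧ u' = u
    · obtain ⟨rfl, rfl⟩ := h
      rw [hd]
      have := hR.le hadj'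
      rwa [hd] at this
    · rw [hd]
      rw [hfe] at hf'
      exact hs.relaxed e' he' u' hu' hadj' hf' fun h' => hP ⟨h', h⟩
  · refine ⟨fun _ => ?_, fun h => by omega⟩
    have hdy : σ.d (I.yt e u) ≤ (c : WithTop ℤ) := by
      rw [h4]
      exact le_add_of_nonneg_right (by exact_mod_cast hw _ (I.lab_lt e he) u hu hadj)
    have hnf : ¬ σ.fin I (I.xs e) := fun h => (h6.trans_le (hmax _ hx h)).not_ge hdy
    refine wp_frame (insert_spec hE hst (by rw [hpar']; exact hpar) hL hx hR.x hs.heap htree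
      fun z hz => (hR.off z hz).2) ?_
    rintro τ' ⟨k1, k2, k3, k4⟩ hf'
    have hptr : τ'.arr aPtr = τ.arr aPtr := hf'.arr aPtr rfl
    have hd : τ'.d = τ.d := d_congr hptr (hf'.arr aD rfl)
    have hfe : ∀ x < I.N, τ'.fin I x ↔ σ.fin I x := by
      intro x hxN
      by_cases hxe : x = I.xs e
      · subst hxe
        refine ⟨fun h => absurd h.2 (by rw [k2]; omega), fun h => absurd h hnf⟩
      · unfold St.fin
        rw [k3 x hxe, hptr, (hR.off x hxe).1]
        rfl
    refine ⟨by omega, ⟨hR.sound.frame hf' rfl, fun e' he' ha hb => ?_, k4, fun x hxN hx' => ?_,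
      fun y hyN hfy x hxN hfx => ?_, fun e' he' u' hu' hadj' hf₁ hP => ?_⟩, hfe,
      fun x hxN hfx => ?_⟩
    · rw [hd]; exact (hle _).trans (hs.based e' he' ha hb)
    · rw [hptr]
      by_cases hxe : x = I.xs e
      · rw [hxe]; exact h2
      · rw [(hR.off x hxe).1]
        rw [k3 x hxe] at hx'
        exact hs.act x hxN hx'
    · rw [hfe y hyN] at hfy
      rw [hfe x hxN] at hfx
      have hye : y ≠ I.xs e := fun h => hnf (h ▸ hfy)
      rw [hd, hoff y hye]
      by_cases hxe : x = I.xs e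
      · rw [hxe, h5]
        exact (hmax y hyN hfy).trans hdy
      · rw [hoff x hxe]
        exact hs.ord y hyN hfy x hxN hfx
    · rw [hfe _ (I.yt_lt he' hu')] at hf₁
      have hye : I.yt e' u' ≠ I.xs e := fun h => hnf (h ▸ hf₁)
      rw [hd, hoff _ hye]
      by_cases h : e' = e ∧ u' = u
      · obtain ⟨rfl, rfl⟩ := h
        exact hR.le hadj
      · exact (hle _).trans (hs.relaxed e' he' u' hu' hadj' hf₁ fun h' => hP ⟨h', h⟩)
    · rw [hd, hoff x fun h => hnf (h ▸ hfx)]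

/-- Settle the active node of minimal value. -/
def settle : Cmd :=
  vX ≔ .get aTree 1 - 1 ⨟ .write aTree (♯vNd + ♯vX) 0 ⨟ vR ≔ .get aQof ♯vX ⨟
  vU ≔ .get aVof ♯vX ⨟ climb ⨟ inList vR settleStep

/-- The top of the tree names an active node of minimal value, and nodes that are neither active nor
final have value `⊤`, so this node may become final. The product edges into it come from the
transitions into its state, with its vertex as the next vertex. They form the exception set `P`,
which shrinks to nothing along the list. -/
theorem settle_spec {I : Inst} {C : Ctx} (hE : Enc I C)
    (hw : ∀ v < I.n, ∀ u < I.n, I.adj v u → 0 ≤ I.w v u) {σ : St} (hst : Static I σ)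
    (hli : Lists I σ)
    (hpar : ∀ k < 2 * I.N, σ.arr aPar (k : ℕ) = (k / 2 : ℕ)) {L : ℕ} (hL : I.N ≤ 2 ^ L)
    (hs : Settled I C (fun _ _ => False) σ) (hpos : 0 < σ.tr 1) :
    wp C settle (fun σ' => σ.clock < σ'.clock ∧ ∃ y < I.N, ¬ σ.fin I y ∧
      σ'.clock ≤ σ.clock + (6 + 5 * L + I.indeg (y / I.n) I.m * (18 + 5 * L)) ∧
      Settled I C (fun _ _ => False) σ' ∧ ∀ x < I.N, σ'.fin I x ↔ σ.fin I x ∨ x = y) σ := by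
  have hW := hE.one_le_W
  have hA := hE.N_le_A
  have hA' := hE.len_le_A
  have hN : 0 < I.N := (Nat.zero_le _).trans_lt I.root_lt
  have hnn : I.n ≤ I.n * I.n := Nat.le_mul_of_pos_left _ I.n_pos
  obtain ⟨y, hy, t1, t2, -⟩ := hs.heap.own one_pos (by omega) hpos
  have hact := hs.act y hy (by omega)
  have hmin : ∀ x < I.N, ¬ σ.fin I x → σ.d y ≤ σ.d x := by
    intro x hx hnf
    by_cases hp : σ.arr aPtr x = 0
    · have : σ.d x = ⊤ := by rw [St.d, if_pos hp]
      rw [this]; exact le_top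
    · have h1 : σ.tr (I.N + x) ≠ 0 := fun h => hnf ⟨hp, h⟩
      have h2 := (hs.heap.leaf x hx).resolve_left h1
      have h3 := (hs.heap.top (j := I.N + x) (by omega) (by omega) (by omega)).2
      rw [t1, h2, add_sub_cancel_right, add_sub_cancel_right] at h3
      rw [St.d, St.d, if_neg hp, if_neg hact]
      exact_mod_cast h3
  obtain ⟨q, hq, u, hu, rfl⟩ := I.exists_nd hy
  have hqd : I.nd q u / I.n = q := by
    unfold nd
    rw [mul_comm, Nat.mul_add_div I.n_pos, Nat.div_eq_of_lt hu, add_zero]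
  have e0 : σ.arr aTree 1 - 1 = (I.nd q u : ℕ) := by
    have : σ.arr aTree 1 = σ.tr 1 := by unfold St.tr; rw [Nat.cast_one]
    rw [this, t1]; ring
  have e1 : ((I.N : ℕ) : ℤ) + (I.nd q u : ℕ) = (I.N + I.nd q u : ℕ) := by push_cast; rfl
  simp only [settle, wp_seq, wp_assign, wp_write, Expr.ok, Expr.eval, Expr.ok_add, Expr.eval_add,
    Expr.ok_sub, Expr.eval_sub, Expr.ok_ofNat, Expr.eval_one, Expr.eval_zero, true_and, and_true,
    setVar_vars, setVar_arr, setVar_clock, setArr_vars, setArr_arr, setArr_clock,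
    Nat.reduceEqDiff, Fin.reduceEq, if_true, if_false, reduceIte, hst.N, e0, e1,
    hst.qof q hq u hu, hst.vof q hq u hu, Int.natCast_nonneg, Nat.add_assoc, Nat.reduceAdd,
    Nat.cast_one, zero_le_one, Nat.cast_zero]
  refine ⟨Ctx.le_bd hW _ (by omega) (by omega), Ctx.le_bd hW _ (by omega) (by omega),
    Ctx.le_bd hW _ (by omega) (by omega), Ctx.le_bd hW _ (by omega) (by omega), ?_⟩
  set τ := (((σ.setVar vX (I.nd q u : ℕ)).setArr aTree (I.N + I.nd q u : ℕ) 0).setVar vR q).setVar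
    vU u with hτ
  have hfr : Frame (vX ≔ 0 ⨟ .write aTree 0 0 ⨟ vR ≔ 0 ⨟ vU ≔ 0) σ τ := by
    refine ⟨fun x hx => ?_, fun k hk => ?_, fun _ => rfl, by simp [hτ]; omega⟩
    · simp only [Cmd.keepsVar, Bool.and_eq_true, bne_iff_ne] at hx
      simp [hτ, hx.1, hx.2.2.1, hx.2.2.2]
    · simp only [Cmd.keepsArr, Bool.and_eq_true, bne_iff_ne] at hk
      simp [hτ, hk.2.1]
  have hstτ : Static I τ := hst.frame hfr rfl
  have hliτ : Lists I τ := hli.frame hfr rfl rfl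
  have k1 : ∀ k, k ≠ I.N + I.nd q u → τ.tr k = σ.tr k := fun k hk => by
    unfold St.tr
    simp only [hτ, setVar_arr, setArr_arr, reduceIte]
    exact Function.update_of_ne (by exact_mod_cast hk) _ _
  have k2 : τ.tr (I.N + I.nd q u) = 0 := by
    unfold St.tr
    simp only [hτ, setVar_arr, setArr_arr, reduceIte]
    exact Function.update_self _ _ _
  refine wp_frame (climb_spec hE hstτ (by rw [hfr.arr aPar rfl]; exact hpar) hL hy (by simp [hτ])
    (hs.heap.change hy k1 (.inl k2) fun _ _ => rfl)) ?_
  rintro τ₁ ⟨hcl₁, htr₁, hh₁⟩ hf₁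
  have hst₁ := hstτ.frame hf₁ rfl
  have hli₁ := hliτ.frame hf₁ rfl rfl
  have hptr : τ₁.arr aPtr = σ.arr aPtr := (hf₁.arr aPtr rfl).trans (hfr.arr aPtr rfl)
  have hd : τ₁.d = σ.d := d_congr hptr ((hf₁.arr aD rfl).trans (hfr.arr aD rfl))
  have hpar₁ : τ₁.arr aPar = σ.arr aPar := (hf₁.arr aPar rfl).trans (hfr.arr aPar rfl)
  have hfin : ∀ x, τ₁.fin I x ↔ σ.fin I x ∨ x = I.nd q u := by
    intro x
    unfold St.fin
    rw [hptr, htr₁]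
    by_cases hx : x = I.nd q u
    · subst hx; simp [k2, hact]
    · rw [k1 _ (by omega)]; simp [hx]
  have hnf : ¬ σ.fin I (I.nd q u) := fun h => by have := h.2; omega
  have hmax : ∀ x < I.N, τ₁.fin I x → τ₁.d x ≤ τ₁.d (I.nd q u) := by
    intro x hx h
    rw [hd]
    obtain h | rfl := (hfin x).1 h
    · exact hs.ord x hx h _ hy hnf
    · exact le_rfl
  have hs₁ : Settled I C (fun e u' => I.tgt e = q ∧ e < I.m ∧ u' = u) τ₁ := by
    refine ⟨(hs.sound.frame hfr rfl).frame hf₁ rfl, by rw [hd]; exact hs.based, hh₁,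
      fun x hx h => ?_, fun z hz hfz x hx hfx => ?_, fun e he u' hu' hadj h hP => ?_⟩
    · rw [hptr]
      by_cases hxy : x = I.nd q u
      · rw [hxy]; exact hact
      · rw [htr₁, k1 _ (by omega)] at h
        exact hs.act x hx h
    · rw [hd]
      have hfx' : ¬ σ.fin I x := fun h => hfx ((hfin x).2 (.inl h))
      obtain h | rfl := (hfin z).1 hfz
      · exact hs.ord z hz h x hx hfx'
      · exact hmin x hx hfx'
    · rw [hd]
      obtain h | h := (hfin _).1 h
      · exact hs.relaxed e he u' hu' hadj h id
      · obtain ⟨h1, h2⟩ := I.nd_inj hu' hu h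
        exact absurd ⟨h1, he, h2⟩ hP
  refine wp_inList (r := vR) hE hli₁ hq (by rw [hf₁.var vR rfl]; simp [hτ]) (16 + 5 * L)
    (fun k τ' => Settled I C (fun e u' => I.tgt e = q ∧ e < k ∧ u' = u) τ' ∧
      (∀ x < I.N, τ'.fin I x ↔ τ₁.fin I x) ∧ ∀ x < I.N, τ₁.fin I x → τ'.d x = τ₁.d x)
    rfl rfl ?_ ⟨hs₁, fun _ _ => Iff.rfl, fun _ _ _ => rfl⟩ ?_ ?_ ?_
  · rintro k τ' z ⟨h1, h2, h3⟩
    exact ⟨⟨h1.setVar _ _ (by decide), h2, h3⟩, ⟨h1.setVar _ _ (by decide), h2, h3⟩⟩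
  · rintro τ' e he hne ⟨h1, h2⟩
    refine ⟨⟨h1.sound, h1.based, h1.heap, h1.act, h1.ord, fun e' he' u' hu' hadj h hP =>
      h1.relaxed e' he' u' hu' hadj h fun ⟨h3, h4, h5⟩ => hP ⟨h3, ?_, h5⟩⟩, h2⟩
    have : e' ≠ e := fun h => hne (h ▸ h3)
    omega
  · rintro e he htg τ' hf' hve ⟨h1, h2, h3⟩
    have hyt : I.yt e u = I.nd q u := by unfold yt; rw [htg]
    have hfy : τ₁.fin I (I.nd q u) := (hfin _).2 (.inr rfl)
    refine wp_mono (settleStep_spec hE hw (hst₁.frame hf' rfl) ?_ hL h1 he hu hve ?_ ?_ ?_) ?_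
    · rw [hf'.arr aPar rfl, hpar₁]; exact hpar
    · rw [hf'.var vU rfl, hf₁.var vU rfl]; simp [hτ]
    · rw [hyt]; exact (h2 _ hy).2 hfy
    · intro x hx h
      rw [hyt, h3 x hx ((h2 x hx).1 h), h3 _ hy hfy]
      exact hmax x hx ((h2 x hx).1 h)
    · rintro τ'' ⟨c1, c2, c3, c4⟩
      refine ⟨c1, ⟨c2.sound, c2.based, c2.heap, c2.act, c2.ord, fun e' he' u' hu' hadj h hP =>
        c2.relaxed e' he' u' hu' hadj h fun ⟨⟨h4, h5, h6⟩, h7⟩ => hP ⟨h4, ?_, h6⟩⟩,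
        fun x hx => (c3 x hx).trans (h2 x hx),
        fun x hx h => (c4 x hx ((h2 x hx).2 h)).trans (h3 x hx h)⟩
      have : e' ≠ e := fun h => h7 ⟨h, h6⟩
      omega
  · rintro τ' hf' ⟨h1, h2, h3⟩ hcl'
    have hc1 := hf'.clock
    have hc2 := hf₁.clock
    have hcτ : τ.clock = σ.clock + 4 := by simp [hτ]
    have e3 : 16 + 5 * L + 2 = 18 + 5 * L := by ring
    rw [e3] at hcl'
    refine ⟨by omega, I.nd q u, hy, hnf, by rw [hqd]; omega, ⟨h1.sound, h1.based, h1.heap, h1.act,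
        h1.ord,
      fun e' he' u' hu' hadj h _ => h1.relaxed e' he' u' hu' hadj h fun ⟨_, h4, _⟩ =>
        Nat.not_lt_zero _ h4⟩, fun x hx => (h2 x hx).trans (hfin x)⟩

/-- Double counting: a transition is counted once for each of the `n` nodes of its target state. -/
theorem sum_indeg_le (I : Inst) :
    ∑ x ∈ Finset.range I.N, I.indeg (x / I.n) I.m ≤ I.m * I.n := by
  have h := Finset.sum_card_bipartiteAbove_eq_sum_card_bipartiteBelow
    (s := Finset.range I.N) (t := Finset.range I.m) fun x e => I.tgt e = x / I.n
  unfold Finset.bipartiteAbove Finset.bipartiteBelow at h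
  unfold indeg
  rw [h]
  refine (Finset.sum_le_card_nsmul _ _ I.n fun e _ => ?_).trans (by simp)
  have : (Finset.range I.N).filter (fun x => I.tgt e = x / I.n) ⊆
      (Finset.range I.n).image fun v => I.n * I.tgt e + v := by
    intro x hx
    have h := (Finset.mem_filter.1 hx).2
    refine Finset.mem_image.2 ⟨x % I.n, Finset.mem_range.2 (Nat.mod_lt _ I.n_pos), ?_⟩
    rw [h]
    exact Nat.div_add_mod x I.n
  exact (Finset.card_le_card this).trans (Finset.card_image_le.trans (by simp))

def settleAll : Cmd := .loop (.get aTree 1) settle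

/-- Each round is charged to the node that it makes final. At the end the top entry is 0, hence by
`Heap.top` all leaves are 0 and all nodes of finite value are final, with their relaxations done;
successors of value `⊤` impose no condition. -/
theorem settleAll_spec {I : Inst} {C : Ctx} (hE : Enc I C)
    (hw : ∀ v < I.n, ∀ u < I.n, I.adj v u → 0 ≤ I.w v u) {σ : St} (hst : Static I σ)
    (hli : Lists I σ)
    (hpar : ∀ k < 2 * I.N, σ.arr aPar (k : ℕ) = (k / 2 : ℕ)) {L : ℕ} (hL : I.N ≤ 2 ^ L)
    (hs : Settled I C (fun _ _ => False) σ) :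
    wp C settleAll (fun σ' => σ'.clock ≤ σ.clock + (I.N * (6 + 5 * L) + I.m * I.n * (18 + 5 * L)) ∧
      Sound I C σ' ∧ I.Based σ'.d ∧ I.Fixed (fun _ => True) σ'.d) σ := by
  classical
  let F : St → Finset ℕ := fun τ => (Finset.range I.N).filter fun x => τ.fin I x
  let cost : ℕ → ℕ := fun x => 6 + 5 * L + I.indeg (x / I.n) I.m * (18 + 5 * L)
  refine wp_loop (fun τ => Settled I C (fun _ _ => False) τ ∧
      τ.clock ≤ σ.clock + ∑ x ∈ F τ, cost x)
    (fun τ => I.N - (F τ).card) ⟨hs, Nat.le_add_right _ _⟩ ?_ ?_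
  · rintro τ hf ⟨h1, h2⟩
    refine ⟨⟨trivial, zero_le_one⟩, fun hpos => ?_⟩
    refine wp_mono (settle_spec hE hw (hst.frame hf rfl) (hli.frame hf rfl rfl)
      (by rw [hf.arr aPar rfl]; exact hpar) hL h1 hpos) ?_
    rintro τ' ⟨k1, y, hy, hnf, k2, k3, k4⟩
    have hF : F τ' = Insert.insert y (F τ) := by
      ext x
      simp only [F, Finset.mem_filter, Finset.mem_insert, Finset.mem_range]
      constructor
      · rintro ⟨hx, h⟩
        obtain h | h := (k4 x hx).1 h
        · exact .inr ⟨hx, h⟩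
        · exact .inl h
      · rintro (rfl | ⟨hx, h⟩)
        · exact ⟨hy, (k4 x hy).2 (.inr rfl)⟩
        · exact ⟨hx, (k4 x hx).2 (.inl h)⟩
    have hyF : y ∉ F τ := fun h => hnf (Finset.mem_filter.1 h).2
    have hcard : (F τ').card ≤ I.N := by
      simpa using Finset.card_filter_le (Finset.range I.N) fun x => τ'.fin I x
    have hc2 : (F τ').card = (F τ).card + 1 := by rw [hF, Finset.card_insert_of_notMem hyF]
    refine ⟨⟨k3, ?_⟩, by omega, k1⟩
    rw [hF, Finset.sum_insert hyF]
    have : cost y = 6 + 5 * L + I.indeg (y / I.n) I.m * (18 + 5 * L) := rfl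
    omega
  · rintro τ hf ⟨h1, h2⟩ hle
    have hsum : ∑ x ∈ F τ, cost x ≤ I.N * (6 + 5 * L) + I.m * I.n * (18 + 5 * L) := by
      refine (Finset.sum_le_sum_of_subset (Finset.filter_subset _ _)).trans ?_
      simp only [cost]
      rw [Finset.sum_add_distrib, ← Finset.sum_mul]
      refine Nat.add_le_add (by simp) (Nat.mul_le_mul_right _ (sum_indeg_le I))
    have hact : ∀ x < I.N, τ.tr (I.N + x) = 0 := by
      intro x hx
      by_contra h
      have h3 := (h1.heap.leaf x hx).resolve_left h
      exact absurd hle (not_le.2 (h1.heap.top (j := I.N + x) (by omega) (by omega) (by omega)).1)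
    refine ⟨by omega, h1.sound, h1.based, fun e he u hu hadj _ => ?_⟩
    by_cases hp : τ.arr aPtr (I.yt e u : ℕ) = 0
    · have : τ.d (I.yt e u) = ⊤ := by rw [St.d, if_pos hp]
      rw [this, WithTop.top_add]
      exact le_top
    · exact h1.relaxed e he u hu hadj ⟨hp, hact _ (I.yt_lt he hu)⟩ id

def dijkstra : Cmd :=
  prologue ⨟ buildLists ⨟ seed ⨟ parTable ⨟ insertAll ⨟ settleAll ⨟ output

/-- `L` belongs to the analysis only: the program does not compute the depth of the tree. -/
theorem dijkstra_spec {I : Inst} {C : Ctx} (hE : Enc I C)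
    (hw : ∀ v < I.n, ∀ u < I.n, I.adj v u → 0 ≤ I.w v u) {L : ℕ} (hL : I.N ≤ 2 ^ L) :
    wp C dijkstra (fun σ => σ.clock ≤ 200 * ((I.N + I.m * I.n) * (L + 1)) ∧ I.IsAnswer σ.out)
      St.init := by
  have hn := I.n_pos
  have hN : 1 ≤ I.N := Nat.one_le_of_lt I.root_lt
  rw [dijkstra, wp_seq]
  refine wp_frame (prologue_spec hE) ?_
  rintro σ₁ ⟨hcl₁, hst₁⟩ hf₁
  rw [wp_seq]
  refine wp_frame (buildLists_spec hE hst₁ (hf₁.arr aHead rfl)) ?_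
  rintro σ₂ ⟨hcl₂, hli₂⟩ hf₂
  replace hf₁ := hf₁.seq hf₂
  have hst₂ := hst₁.frame hf₂ rfl
  have hs₂ : Sound I C σ₂ := by
    have hc : σ₂.vars vCnt = 0 := hf₁.var vCnt rfl
    refine ⟨by omega, by omega, fun x _ => .inl ?_⟩
    rw [hf₁.arr aPtr rfl]; rfl
  rw [wp_seq]
  refine wp_frame (seed_spec hE hst₂ hs₂) ?_
  rintro σ₃ ⟨hcl₃, hs₃, hb₃⟩ hf₃
  have hst₃ := hst₂.frame hf₃ rfl
  have hli₃ := hli₂.frame hf₃ rfl rfl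
  replace hf₁ := hf₁.seq hf₃
  rw [wp_seq]
  refine wp_frame (parTable_spec hE hst₃) ?_
  rintro σ₄ ⟨hcl₄, hpar₄⟩ hf₄
  have hst₄ := hst₃.frame hf₄ rfl
  have hli₄ := hli₃.frame hf₄ rfl rfl
  have hs₄ := hs₃.frame hf₄ rfl
  replace hf₁ := hf₁.seq hf₄
  rw [wp_seq]
  refine wp_frame (insertAll_spec hE hst₄ hs₄ hpar₄ hL (hf₁.arr aTree rfl)) ?_
  rintro σ₅ ⟨hcl₅, hh₅, hact₅⟩ hf₅
  have hst₅ := hst₄.frame hf₅ rfl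
  have hli₅ := hli₄.frame hf₅ rfl rfl
  have hs₅ := hs₄.frame hf₅ rfl
  have hb₅ : I.Based σ₅.d := by
    rw [d_congr (hf₅.arr aPtr rfl) (hf₅.arr aD rfl), d_congr (hf₄.arr aPtr rfl) (hf₄.arr aD rfl)]
    exact hb₃
  have hnf : ∀ x < I.N, ¬ σ₅.fin I x := fun x hx h => h.1 ((hact₅ x hx).1 h.2)
  replace hf₁ := hf₁.seq hf₅
  rw [wp_seq]
  refine wp_frame (settleAll_spec hE hw hst₅ hli₅ (by rw [hf₅.arr aPar rfl]; exact hpar₄) hL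
    ⟨hs₅, hb₅, hh₅, fun x hx h h' => h ((hact₅ x hx).2 h'), fun y hy h => absurd h (hnf y hy),
      fun e he u hu _ h => absurd h (hnf _ (I.yt_lt he hu))⟩) ?_
  rintro σ₆ ⟨hcl₆, hs₆, hb₆, hfix₆⟩ hf₆
  have hst₆ := hst₅.frame hf₆ rfl
  replace hf₁ := hf₁.seq hf₆
  have ho : σ₆.out = [] := hf₁.out rfl
  refine wp_mono (output_spec hE hst₆ hs₆ ho (S := fun _ => True) (fun _ _ _ _ _ _ => trivial)
    trivial hfix₆ hb₆) ?_
  rintro σ₇ ⟨hcl₇, hans⟩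
  have := hs₆.cnt_le
  have h1 : I.m ≤ I.m * I.n := Nat.le_mul_of_pos_right _ hn
  have e1 : I.N * (3 + 5 * L) = 3 * I.N + 5 * (I.N * L) := by ring
  have e2 : I.N * (6 + 5 * L) = 6 * I.N + 5 * (I.N * L) := by ring
  have e3 : I.m * I.n * (18 + 5 * L) = 18 * (I.m * I.n) + 5 * (I.m * I.n * L) := by ring
  have e4 : 200 * ((I.N + I.m * I.n) * (L + 1)) =
    200 * (I.N * L) + 200 * (I.m * I.n * L) + 200 * I.N + 200 * (I.m * I.n) := by ring
  rw [e1] at hcl₅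
  rw [e2, e3] at hcl₆
  exact ⟨by omega, hans⟩

end HL

/-! ### The instance of the automaton and the graph -/

section bridge

variable {n : ℕ}

/-- The instance of numbers that the automaton, the graph and the two vertices describe. -/
def toInst (M : FinNFA n) (G : Digraph (Fin n)) (w : Fin n → Fin n → ℤ) (s t : Fin n) : Inst where
  n := n
  nq := M.numStates
  m := M.trans.length
  q0 := M.start
  s := s
  t := t
  src e := if h : e < M.trans.length then M.trans[e].1 else 0
  lab e := if h : e < M.trans.length then M.trans[e].2.1 else 0
  tgt e := if h : e < M.trans.length then M.trans[e].2.2 else 0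
  acc q := ∃ h : q < M.numStates, ⟨q, h⟩ ∈ M.accept
  adj v u := ∃ (hv : v < n) (hu : u < n), G.Adj ⟨v, hv⟩ ⟨u, hu⟩
  w v u := if h : v < n ∧ u < n then w ⟨v, h.1⟩ ⟨u, h.2⟩ else 0
  q0_lt := M.start.2
  s_lt := s.2
  t_lt := t.2
  src_lt e he := by rw [dif_pos he]; exact Fin.is_lt _
  lab_lt e he := by rw [dif_pos he]; exact Fin.is_lt _
  tgt_lt e he := by rw [dif_pos he]; exact Fin.is_lt _

variable (M : FinNFA n) (G : Digraph (Fin n)) (w : Fin n → Fin n → ℤ) (s t : Fin n)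

theorem toInst_trans {e : ℕ} (he : e < M.trans.length) :
    (toInst M G w s t).src e = M.trans[e].1 ∧ (toInst M G w s t).lab e = M.trans[e].2.1 ∧
      (toInst M G w s t).tgt e = M.trans[e].2.2 := by
  refine ⟨dif_pos he, dif_pos he, dif_pos he⟩

theorem toInst_acc (q : Fin M.numStates) : (toInst M G w s t).acc q ↔ q ∈ M.accept :=
  ⟨fun ⟨_, h⟩ => h, fun h => ⟨q.2, h⟩⟩

theorem toInst_adj (u v : Fin n) : (toInst M G w s t).adj u v ↔ G.Adj u v :=
  ⟨fun ⟨_, _, h⟩ => h, fun h => ⟨u.2, v.2, h⟩⟩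

theorem toInst_w (u v : Fin n) : (toInst M G w s t).w u v = w u v := dif_pos ⟨u.2, v.2⟩

/-- Replaces sets of states by a single run, so that acceptance can be matched with `Good` one
transition at a time. -/
theorem NFA.cons_mem_acceptsFrom_singleton {α σ : Type*} (A : NFA α σ) (q : σ) (a : α)
    (p : List α) :
    a :: p ∈ A.acceptsFrom {q} ↔ ∃ r ∈ A.step q a, p ∈ A.acceptsFrom {r} := by
  rw [NFA.cons_mem_acceptsFrom, NFA.stepSet_singleton, NFA.mem_acceptsFrom]
  constructor
  · rintro ⟨f, hf, h⟩
    obtain ⟨r, hr, h'⟩ := NFA.mem_evalFrom_iff_exists.1 h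
    exact ⟨r, hr, NFA.mem_acceptsFrom.2 ⟨f, hf, h'⟩⟩
  · rintro ⟨r, hr, h⟩
    obtain ⟨f, hf, h'⟩ := NFA.mem_acceptsFrom.1 h
    exact ⟨f, hf, NFA.mem_evalFrom_iff_exists.2 ⟨r, hr, h'⟩⟩

variable {M G w s t}

theorem pathWeight_cons_cons (u v : Fin n) (p : List (Fin n)) :
    pathWeight w (u :: v :: p) = w u v + pathWeight w (v :: p) := by
  simp [pathWeight]

theorem good_of_path {v : Fin n} {p : List (Fin n)} (hp : IsPath G v t p) {q : Fin M.numStates}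
    (ha : p ∈ M.toNFA.acceptsFrom {q}) :
    (toInst M G w s t).Good ((toInst M G w s t).nd q v) (p.map fun v => (v : ℕ))
      (pathWeight w p) := by
  induction p generalizing v q with
  | nil => simp [IsPath] at hp
  | cons v' p ih =>
    obtain ⟨hc, hh, hl⟩ := hp
    obtain rfl : v' = v := by simpa using hh
    obtain ⟨r, hr, har⟩ := (NFA.cons_mem_acceptsFrom_singleton _ _ _ _).1 ha
    obtain ⟨e, he, htr⟩ := List.getElem_of_mem (show (q, v', r) ∈ M.trans from hr)
    obtain ⟨e1, e2, e3⟩ := toInst_trans M G w s t he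
    rw [htr] at e1 e2 e3
    have hx : (toInst M G w s t).nd q v' = (toInst M G w s t).xs e := by
      unfold Inst.xs; rw [e1, e2]
    rw [hx]
    cases p with
    | nil =>
      obtain rfl : v' = t := by simpa using hl
      have hacc : r ∈ M.accept := by
        obtain ⟨r', h1, h2⟩ := (NFA.nil_mem_acceptsFrom _).1 har
        obtain rfl : r' = r := h1
        exact h2
      have := Inst.Good.base (I := toInst M G w s v') e he e2
        (by rw [e3]; exact (toInst_acc M G w s v' r).2 hacc)
      rw [e2] at this
      simpa [pathWeight] using this
    | cons u p =>
      rw [List.isChain_cons_cons] at hc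
      have h := ih (v := u) (q := r) ⟨hc.2, rfl, by simpa using hl⟩ har
      have hy : (toInst M G w s t).nd r u = (toInst M G w s t).yt e u := by
        unfold Inst.yt; rw [e3]
      rw [hy] at h
      have := Inst.Good.step (I := toInst M G w s t) e u _ _ he u.2
        (by rw [e2]; exact (toInst_adj M G w s t _ _).2 hc.1) h
      rw [e2, toInst_w, add_comm, ← pathWeight_cons_cons] at this
      exact this

theorem path_of_good {x : ℕ} {l : List ℕ} {c : ℤ} (h : (toInst M G w s t).Good x l c)
    {v : Fin n} {q : Fin M.numStates} (hx : x = (toInst M G w s t).nd q v) :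
    ∃ p : List (Fin n), l = (p.map fun v => (v : ℕ)) ∧ IsPath G v t p ∧
      p ∈ M.toNFA.acceptsFrom {q} ∧ pathWeight w p = c := by
  induction h generalizing v q with
  | base e he h1 h2 =>
    obtain ⟨e1, e2, e3⟩ := toInst_trans M G w s t he
    obtain ⟨h3, h4⟩ := (toInst M G w s t).nd_inj ((toInst M G w s t).lab_lt e he) v.2 hx
    have h5 : M.trans[e] = (q, v, M.trans[e].2.2) :=
      Prod.ext (Fin.ext (e1.symm.trans h3)) (Prod.ext (Fin.ext (e2.symm.trans h4)) rfl)
    obtain rfl : v = t := Fin.ext (h4.symm.trans h1)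
    refine ⟨[v], by simp [h4], ⟨by simp, rfl, rfl⟩, ?_, by simp [pathWeight]⟩
    refine (NFA.cons_mem_acceptsFrom_singleton _ _ _ _).2 ⟨M.trans[e].2.2, ?_, ?_⟩
    · change (q, v, M.trans[e].2.2) ∈ M.trans
      rw [← h5]
      exact List.getElem_mem _
    · refine (NFA.nil_mem_acceptsFrom _).2 ⟨_, rfl, ?_⟩
      rw [e3] at h2
      exact (toInst_acc M G w s v _).1 h2
  | step e u l c he hu hadj hg ih =>
    obtain ⟨e1, e2, e3⟩ := toInst_trans M G w s t he
    obtain ⟨h3, h4⟩ := (toInst M G w s t).nd_inj ((toInst M G w s t).lab_lt e he) v.2 hx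
    have h5 : M.trans[e] = (q, v, M.trans[e].2.2) :=
      Prod.ext (Fin.ext (e1.symm.trans h3)) (Prod.ext (Fin.ext (e2.symm.trans h4)) rfl)
    obtain ⟨p, h6, ⟨hc, hh, hl⟩, h8, h9⟩ := ih (v := ⟨u, hu⟩) (q := M.trans[e].2.2)
      (by unfold Inst.yt; rw [e3])
    rw [h4] at hadj ⊢
    have hadj' := (toInst_adj M G w s t v ⟨u, hu⟩).1 hadj
    have hw := toInst_w M G w s t v ⟨u, hu⟩
    cases p with
    | nil => simp at hh
    | cons u' p =>
      obtain rfl : u' = ⟨u, hu⟩ := by simpa using hh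
      refine ⟨v :: ⟨u, hu⟩ :: p, by rw [h6]; rfl, ⟨List.isChain_cons_cons.2 ⟨hadj', hc⟩, rfl,
        by simpa using hl⟩, (NFA.cons_mem_acceptsFrom_singleton _ _ _ _).2
        ⟨M.trans[e].2.2, ?_, h8⟩, ?_⟩
      · change (q, v, M.trans[e].2.2) ∈ M.trans
        rw [← h5]
        exact List.getElem_mem _
      · rw [pathWeight_cons_cons, h9, ← hw]
        exact add_comm _ _

theorem isAnswer_of_toInst {out : List ℤ} (h : (toInst M G w s t).IsAnswer out) :
    IsAnswer M G w s t out := by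
  have good : ∀ p, IsPath G s t p → p ∈ M.toNFA.accepts →
      (toInst M G w s t).Good (toInst M G w s t).root (p.map fun v => (v : ℕ))
        (pathWeight w p) := fun p hp ha => good_of_path hp ha
  obtain ⟨l, c, h1, h2, rfl⟩ | ⟨h1, rfl⟩ := h
  · obtain ⟨p, rfl, h3, h4, rfl⟩ := path_of_good h1 (v := s) (q := M.start) rfl
    exact .inl ⟨p, ⟨h3, h4, fun p' h5 h6 => h2 _ _ (good p' h5 h6)⟩, by simp⟩
  · refine .inr ⟨?_, rfl⟩
    rintro ⟨p, h2, h3, h4⟩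
    refine h1 ⟨_, _, good p h2 h3, fun l c h => ?_⟩
    obtain ⟨p', -, h5, h6, rfl⟩ := path_of_good h (v := s) (q := M.start) rfl
    exact h4 p' h5 h6

/-- On a finite set a transitive irreflexive relation is well-founded. Applied to the reversed
transitive closure of the transitions, this is induction starting from the states without
successors. -/
theorem toInst_acyclic (h : M.IsAcyclic) : (toInst M G w s t).Acyclic := by
  intro X hX
  have hwf : WellFounded fun a b : Fin M.numStates => Relation.TransGen M.Edge b a := by
    have : IsTrans (Fin M.numStates) fun a b => Relation.TransGen M.Edge b a :=
      ⟨fun a b c h1 h2 => h2.trans h1⟩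
    have : Std.Irrefl fun a b : Fin M.numStates => Relation.TransGen M.Edge b a := ⟨h⟩
    exact Finite.wellFounded_of_trans_of_irrefl _
  have key : ∀ q : Fin M.numStates, X q := by
    intro q
    induction q using hwf.induction with
    | _ q ih =>
      refine hX q q.2 fun e he hs => ?_
      obtain ⟨e1, e2, e3⟩ := toInst_trans M G w s t he
      rw [e3]
      refine ih _ (.single ⟨M.trans[e].2.1, ?_⟩)
      have : M.trans[e].1 = q := Fin.ext (e1.symm.trans hs)
      rw [← this]
      exact List.getElem_mem _
  exact fun q hq => key ⟨q, hq⟩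

/-! ### Reading the encoded input -/

theorem List.getElem?_append_of_eq_some {α : Type*} {l l' : List α} {i : ℕ} {a : α}
    (h : l[i]? = some a) : (l ++ l')[i]? = some a := by
  rw [List.getElem?_append_left (List.getElem?_eq_some_iff.1 h).1, h]

theorem List.getElem?_append_length_add {α : Type*} {l l' : List α} {i k : ℕ}
    (h : l.length = k) : (l ++ l')[k + i]? = l'[i]? := by
  rw [List.getElem?_append_right (by omega)]
  congr 1
  omega

theorem List.length_flatMap_const {α β : Type*} {l : List α} {f : α → List β} {k : ℕ}
    (hf : ∀ a, (f a).length = k) : (l.flatMap f).length = l.length * k := by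
  induction l with
  | nil => simp
  | cons a l ih => rw [List.flatMap_cons, List.length_append, ih, hf, List.length_cons]; ring

theorem List.getElem?_flatMap_const {α β : Type*} {l : List α} {f : α → List β} {k : ℕ}
    (hf : ∀ a, (f a).length = k) {i j : ℕ} {a : α} {b : β} (ha : l[i]? = some a)
    (hb : (f a)[j]? = some b) : (l.flatMap f)[i * k + j]? = some b := by
  induction l generalizing i with
  | nil => simp at ha
  | cons a' l ih =>
    rw [List.flatMap_cons]
    cases i with
    | zero =>
      obtain rfl : a' = a := by simpa using ha
      rw [zero_mul, zero_add]
      exact List.getElem?_append_of_eq_some hb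
    | succ i =>
      rw [show (i + 1) * k + j = k + (i * k + j) by ring,
        List.getElem?_append_length_add (hf a')]
      exact ih (by simpa using ha)

theorem State.init_mem {l : List ℤ} {i : ℕ} {z : ℤ} (h : l[i]? = some z) :
    (RAM.State.init l).mem i = z := by
  simp [RAM.State.init, List.getD, h]

variable (M G w s t)

open Classical in
/-- The sections of the encoded input. -/
theorem encodeInput_eq : ∃ l₁ l₂ l₃ l₄ l₅ : List ℤ,
    encodeInput M G w s t = l₁ ++ l₂ ++ l₃ ++ l₄ ++ l₅ ∧
    l₁ = [(n : ℤ), (M.numStates : ℤ), (M.trans.length : ℤ), ((M.start : ℕ) : ℤ), ((s : ℕ) : ℤ),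
      ((t : ℕ) : ℤ)] ∧
    (l₂.length = M.numStates ∧
      ∀ q : Fin M.numStates, l₂[(q : ℕ)]? = some (if q ∈ M.accept then 1 else 0)) ∧
    (l₃.length = M.trans.length * 3 ∧ ∀ e (he : e < M.trans.length),
      l₃[e * 3 + 0]? = some ((M.trans[e].1 : ℕ) : ℤ) ∧
      l₃[e * 3 + 1]? = some ((M.trans[e].2.1 : ℕ) : ℤ) ∧
      l₃[e * 3 + 2]? = some ((M.trans[e].2.2 : ℕ) : ℤ)) ∧
    (l₄.length = n * n ∧ ∀ u v : Fin n,
      l₄[(u : ℕ) * n + v]? = some (if G.Adj u v then 1 else 0)) ∧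
    (l₅.length = n * n ∧ ∀ u v : Fin n,
      l₅[(u : ℕ) * n + v]? = some (if G.Adj u v then w u v else 0)) := by
  have fin : ∀ {k : ℕ} (i : Fin k), (List.finRange k)[(i : ℕ)]? = some i := fun i => by simp
  refine ⟨_, _, _, _, _, rfl, rfl, ⟨by simp, fun q => by simp⟩, ⟨?_, fun e he => ?_⟩,
    ⟨?_, fun u v => ?_⟩, ⟨?_, fun u v => ?_⟩⟩
  · exact List.length_flatMap_const fun _ => rfl
  · refine ⟨List.getElem?_flatMap_const (k := 3) (i := e) (j := 0) (fun _ => rfl)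
      (List.getElem?_eq_getElem he) ?_, List.getElem?_flatMap_const (k := 3) (i := e) (j := 1)
      (fun _ => rfl) (List.getElem?_eq_getElem he) ?_, List.getElem?_flatMap_const (k := 3) (i := e)
      (j := 2) (fun _ => rfl) (List.getElem?_eq_getElem he) ?_⟩ <;> rfl
  · rw [List.length_flatMap_const (k := n) fun _ => by simp]; simp
  · exact List.getElem?_flatMap_const (fun _ => by simp) (fin u) (by simp)
  · rw [List.length_flatMap_const (k := n) fun _ => by simp]; simp
  · exact List.getElem?_flatMap_const (fun _ => by simp) (fin u) (by simp)

theorem length_encodeInput : (encodeInput M G w s t).length =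
    6 + M.numStates + 3 * M.trans.length + 2 * (n * n) := by
  obtain ⟨l₁, l₂, l₃, l₄, l₅, h, rfl, ⟨h2, -⟩, ⟨h3, -⟩, ⟨h4, -⟩, ⟨h5, -⟩⟩ :=
      encodeInput_eq M G w s t
  rw [h]
  simp only [List.length_append, h2, h3, h4, h5, List.length_cons, List.length_nil]
  ring

/-- A bound on the sizes in the input. -/
def sizeBound : ℕ :=
  24 + M.numStates + 3 * M.trans.length + 2 * (n * n) + 4 * (M.numStates * n)

open Classical in
/-- The least admissible bound on the weights. -/
noncomputable def weightBound : ℕ :=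
  max 1 (Finset.univ.sup fun e : Fin n × Fin n => if G.Adj e.1 e.2 then (w e.1 e.2).natAbs else 0)

theorem le_weightBound {u v : Fin n} (h : G.Adj u v) : |w u v| ≤ weightBound G w := by
  classical
  have := Finset.le_sup (f := fun e : Fin n × Fin n =>
    if G.Adj e.1 e.2 then (w e.1 e.2).natAbs else 0) (Finset.mem_univ (u, v))
  simp only [h, if_true] at this
  rw [Int.abs_eq_natAbs]
  unfold weightBound
  exact_mod_cast this.trans (le_max_right _ _)

theorem weightBound_le {W : ℕ} (hW : 1 ≤ W) (h : ∀ u v, G.Adj u v → |w u v| ≤ (W : ℤ)) :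
    weightBound G w ≤ W := by
  classical
  refine max_le hW (Finset.sup_le fun e _ => ?_)
  split_ifs with he
  · have := h _ _ he
    rw [Int.abs_eq_natAbs] at this
    exact_mod_cast this
  · exact Nat.zero_le _

/-- Taking the least admissible weight bound lets one verification, with one output, serve all `W`
in the claim on word time. -/
noncomputable def toCtx : HL.Ctx where
  inp i := (RAM.State.init (encodeInput M G w s t)).mem i
  A := sizeBound M
  W := weightBound G w

theorem toCtx_enc : HL.Enc (toInst M G w s t) (toCtx M G w s t) := by
  obtain ⟨l₁, l₂, l₃, l₄, l₅, h, rfl, ⟨h2, h2'⟩, ⟨h3, h3'⟩, ⟨h4, h4'⟩, ⟨h5, h5'⟩⟩ :=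
    encodeInput_eq M G w s t
  set l₁ : List ℤ := [(n : ℤ), (M.numStates : ℤ), (M.trans.length : ℤ), ((M.start : ℕ) : ℤ),
    ((s : ℕ) : ℤ), ((t : ℕ) : ℤ)] with hl₁
  have hd : ∀ {i : ℕ} {z : ℤ}, l₁[i]? = some z → (toCtx M G w s t).inp i = z := fun h' =>
    State.init_mem (by
      rw [h]
      exact List.getElem?_append_of_eq_some (List.getElem?_append_of_eq_some
        (List.getElem?_append_of_eq_some (List.getElem?_append_of_eq_some h'))))
  have c2 : (l₁ ++ l₂).length = 6 + M.numStates := by simp [hl₁, h2]; omega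
  have c3 : (l₁ ++ l₂ ++ l₃).length = 6 + M.numStates + M.trans.length * 3 := by
    rw [List.length_append, c2, h3]
  have c4 : (l₁ ++ l₂ ++ l₃ ++ l₄).length = 6 + M.numStates + M.trans.length * 3 + n * n := by
    rw [List.length_append, c3, h4]
  have d3 : ∀ {i : ℕ} {z : ℤ}, l₃[i]? = some z →
      (toCtx M G w s t).inp (6 + M.numStates + i : ℕ) = z := fun h' =>
    State.init_mem (by
      rw [h]
      refine List.getElem?_append_of_eq_some (List.getElem?_append_of_eq_some ?_)
      rw [List.getElem?_append_length_add c2, h'])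
  have d2 : ∀ {i : ℕ} {z : ℤ}, l₂[i]? = some z →
      (toCtx M G w s t).inp (6 + i : ℕ) = z := fun h' =>
    State.init_mem (by
      rw [h]
      refine List.getElem?_append_of_eq_some (List.getElem?_append_of_eq_some
        (List.getElem?_append_of_eq_some ?_))
      rw [List.getElem?_append_length_add (by rfl), h'])
  have d4 : ∀ {i : ℕ} {z : ℤ}, l₄[i]? = some z →
      (toCtx M G w s t).inp (6 + M.numStates + M.trans.length * 3 + i : ℕ) = z := fun h' =>
    State.init_mem (by
      rw [h]
      refine List.getElem?_append_of_eq_some ?_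
      rw [List.getElem?_append_length_add c3, h'])
  have d5 : ∀ {i : ℕ} {z : ℤ}, l₅[i]? = some z →
      (toCtx M G w s t).inp (6 + M.numStates + M.trans.length * 3 + n * n + i : ℕ) = z := fun h' =>
    State.init_mem (by rw [h, List.getElem?_append_length_add c4, h'])
  have htr := fun e (he : e < M.trans.length) => toInst_trans M G w s t he
  have hab : (toInst M G w s t).ab = (6 + M.numStates + M.trans.length * 3 : ℕ) := by
    simp only [Inst.ab, Inst.tb, toInst]; push_cast; ring
  constructor
  case n => exact hd (i := 0) rfl
  case nq => exact hd (i := 1) rfl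
  case m => exact hd (i := 2) rfl
  case q0 => exact hd (i := 3) rfl
  case s => exact hd (i := 4) rfl
  case t => exact hd (i := 5) rfl
  case acc =>
    intro q hq
    have hq' : q < M.numStates := hq
    have e1 : (6 : ℤ) + q = (6 + q : ℕ) := by push_cast; rfl
    rw [e1, d2 (h2' ⟨q, hq'⟩)]
    refine Iff.trans ?_ (toInst_acc M G w s t ⟨q, hq'⟩).symm
    split_ifs <;> simp_all
  case src =>
    intro e he
    have e1 : (toInst M G w s t).tb + e + e + e = (6 + M.numStates + (e * 3 + 0) : ℕ) := by
      simp only [Inst.tb, toInst]; push_cast; ring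
    rw [e1, d3 (h3' e he).1, (htr e he).1]
  case lab =>
    intro e he
    have e1 : (toInst M G w s t).tb + e + e + e + 1 = (6 + M.numStates + (e * 3 + 1) : ℕ) := by
      simp only [Inst.tb, toInst]; push_cast; ring
    rw [e1, d3 (h3' e he).2.1, (htr e he).2.1]
  case tgt =>
    intro e he
    have e1 : (toInst M G w s t).tb + e + e + e + 2 = (6 + M.numStates + (e * 3 + 2) : ℕ) := by
      simp only [Inst.tb, toInst]; push_cast; ring
    rw [e1, d3 (h3' e he).2.2, (htr e he).2.2]
  case adj =>
    intro v hv u hu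
    have hv' : v < n := hv
    have hu' : u < n := hu
    have e1 : (toInst M G w s t).row v + u =
        (6 + M.numStates + M.trans.length * 3 + (v * n + u) : ℕ) := by
      unfold Inst.row; rw [hab]; simp only [toInst]; push_cast; ring
    rw [e1, d4 (h4' ⟨v, hv'⟩ ⟨u, hu'⟩)]
    have := toInst_adj M G w s t ⟨v, hv'⟩ ⟨u, hu'⟩
    simp only at this
    rw [this]
    split_ifs <;> simp_all
  case w =>
    intro v hv u hu hadj
    have hv' : v < n := hv
    have hu' : u < n := hu
    have e1 : (toInst M G w s t).row v + (toInst M G w s t).nn + u =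
        (6 + M.numStates + M.trans.length * 3 + n * n + (v * n + u) : ℕ) := by
      unfold Inst.row Inst.nn; rw [hab]; simp only [toInst]; push_cast; ring
    rw [e1, d5 (h5' ⟨v, hv'⟩ ⟨u, hu'⟩), if_pos ((toInst_adj M G w s t ⟨v, hv'⟩ ⟨u, hu'⟩).1 hadj)]
    exact (toInst_w M G w s t ⟨v, hv'⟩ ⟨u, hu'⟩).symm
  case w_le =>
    intro v hv u hu hadj
    have := (toInst_adj M G w s t ⟨v, hv⟩ ⟨u, hu⟩).1 hadj
    have h' := le_weightBound G w this
    rwa [← toInst_w M G w s t] at h'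
  case one_le_W => exact le_max_left _ _
  case len_le_A =>
    change 20 + M.numStates + 3 * M.trans.length + 2 * (n * n) ≤ sizeBound M
    unfold sizeBound
    omega
  case N_le_A =>
    change 4 * (M.numStates * n) + 4 ≤ sizeBound M
    unfold sizeBound
    omega

theorem abs_le_of_mem_encodeInput {z : ℤ} (hz : z ∈ encodeInput M G w s t) :
    |z| ≤ weightBound G w * sizeBound M := by
  have hW : (1 : ℤ) ≤ weightBound G w := by exact_mod_cast le_max_left _ _
  have hA : (24 + M.numStates + 3 * M.trans.length + 2 * (n * n) + 4 * (M.numStates * n) : ℤ) =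
    sizeBound M := by unfold sizeBound; push_cast; rfl
  have hn : 0 < n := s.pos
  have hnn : (n : ℤ) ≤ n * n := by exact_mod_cast Nat.le_mul_of_pos_left n hn
  have hN : (0 : ℤ) ≤ M.numStates * n := by positivity
  have key : ∀ z : ℤ, 0 ≤ z → z ≤ sizeBound M → |z| ≤ weightBound G w * sizeBound M :=
    fun z h1 h2 => by rw [abs_of_nonneg h1]; nlinarith
  have hs := s.2; have ht := t.2; have hq := M.start.2
  simp only [encodeInput, List.mem_append, List.mem_cons, List.not_mem_nil, or_false,
    List.mem_map, List.mem_flatMap] at hz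
  obtain (((h | ⟨q, -, rfl⟩) | ⟨e, -, h⟩) | ⟨u, -, v, -, rfl⟩) | ⟨u, -, v, -, rfl⟩ := hz
  · obtain rfl | rfl | rfl | rfl | rfl | rfl := h <;> exact key _ (by omega) (by omega)
  · split_ifs <;> exact key _ (by omega) (by omega)
  · have h1 := e.1.2; have h2 := e.2.1.2; have h3 := e.2.2.2
    obtain rfl | rfl | rfl := h <;> exact key _ (by omega) (by omega)
  · split_ifs <;> exact key _ (by omega) (by omega)
  · split_ifs with h
    · have := le_weightBound G w h
      have h3 : (1 : ℤ) ≤ sizeBound M := by omega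
      nlinarith
    · exact key _ (by omega) (by omega)

theorem toCtx_bounded : HL.Bounded (toCtx M G w s t) HL.St.init ((toCtx M G w s t).bd 0) := by
  have hW : (1 : ℤ) ≤ weightBound G w := by exact_mod_cast le_max_left _ _
  have hA : (1 : ℤ) ≤ sizeBound M := by
    exact_mod_cast (by unfold sizeBound; omega : 1 ≤ sizeBound M)
  have hb : (toCtx M G w s t).bd 0 = weightBound G w * sizeBound M := by
    simp [HL.Ctx.bd, toCtx]
  have h0 : (0 : ℤ) ≤ weightBound G w * sizeBound M := by positivity
  rw [hb]
  refine ⟨by nlinarith, fun x => by simpa [HL.St.init] using h0, fun i hi => ?_,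
    fun k i => by simpa [HL.St.init] using h0⟩
  simp only [toCtx, RAM.State.init, if_pos hi, List.getD]
  cases h : (encodeInput M G w s t)[i.toNat]? with
  | none => simpa using h0
  | some z => exact abs_le_of_mem_encodeInput M G w s t (List.mem_of_getElem? h)

/-- Arrays occupy the negative addresses, where the initial memory is 0; the input is at the others.
-/
theorem toCtx_rel : HL.Rel (toCtx M G w s t) HL.St.init
    (RAM.State.init (encodeInput M G w s t)) := by
  refine ⟨fun _ => rfl, fun _ _ => rfl, fun k i hi => ?_, rfl⟩
  simp only [RAM.State.init, HL.St.init]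
  rw [if_neg (by omega)]

/-! ### Word cost and the time constants. -/

/-- Integers of polynomial size times a power of the input length occupy few machine words. -/
theorem words_le {L W κ k : ℕ} (hL : 0 < L) (hW : 1 ≤ W) {z : ℤ} (hz : |z| ≤ (κ * W * L ^ k : ℕ)) :
    RAM.words L.size z ≤ (κ.size + k + 3) * Nat.log 2 (W + 1) := by
  have hl : 0 < L.size := Nat.size_pos.2 hL
  -- The power of `L` contributes `k * L.size` bits, which is just `k` words; division by the word
  -- length is essential only for this term.
  have h1 : z.natAbs.size ≤ κ.size + W.size + k * L.size := by
    rw [Nat.size_le]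
    have hz' : z.natAbs ≤ κ * W * L ^ k := by
      rw [Int.abs_eq_natAbs] at hz
      exact_mod_cast hz
    refine hz'.trans_lt ?_
    rw [pow_add, pow_add, mul_comm k, pow_mul]
    have a1 := Nat.lt_size_self κ
    have a2 := Nat.lt_size_self W
    have a3 : L ^ k ≤ (2 ^ L.size) ^ k := Nat.pow_le_pow_left (Nat.lt_size_self L).le k
    exact Nat.mul_lt_mul_of_lt_of_le (Nat.mul_lt_mul_of_lt_of_le a1 a2.le (by positivity)) a3
      (by positivity)
  -- Since `W ≥ 1`, the rounded logarithm is at least 1 and absorbs the extra bit.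
  have h2 : W.size ≤ 2 * Nat.log 2 (W + 1) := by
    have h3 : 1 ≤ Nat.log 2 (W + 1) := Nat.log_pos (by norm_num) (by omega)
    have h4 : W.size ≤ Nat.log 2 (W + 1) + 1 := by
      rw [Nat.size_le]
      exact (Nat.lt_succ_self W).trans (Nat.lt_pow_succ_log_self (by norm_num) _)
    omega
  have h3 : 1 ≤ Nat.log 2 (W + 1) := Nat.log_pos (by norm_num) (by omega)
  have h4 : z.natAbs.size / L.size ≤ κ.size + W.size + k := by
    refine (Nat.div_le_div_right h1).trans ?_
    rw [Nat.add_mul_div_right _ _ hl]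
    exact Nat.add_le_add_right (Nat.div_le_self _ _) _
  unfold RAM.words
  nlinarith [Nat.zero_le (κ.size + k)]

/-- The time constant of a program that takes at most `C₀` times a given number of steps. -/
def timeConst (c : HL.Cmd) (C₀ : ℕ) : ℕ :=
  c.cost * (C₀ + 1) * (1 + 3 * ((c.wt * (C₀ + 6)).size + 5 + 3))

theorem sizeBound_le : sizeBound M ≤ 6 * (encodeInput M G w s t).length ^ 5 := by
  have hL := length_encodeInput M G w s t
  set L := (encodeInput M G w s t).length
  have h1 : n ≤ L := by nlinarith [Nat.zero_le n]
  have h2 : M.numStates * n ≤ L * L := Nat.mul_le_mul (by omega) h1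
  have h3 : L * L ≤ L ^ 5 := by
    rw [← pow_two]
    exact Nat.pow_le_pow_right (by omega) (by norm_num)
  have h4 : 6 * L ≤ L * L := Nat.mul_le_mul_right _ (by omega)
  unfold sizeBound
  omega

/-- Since `B ≥ 1`, `clock + 1` is at most `(C₀ + 1) * B`. With `L` the input length, the size bound
is at most `6 * L ^ 5` and the clock at most `C₀ * L ^ 5`, so all integers are at most `c.wt * (C₀ +
6) * W * L ^ 5`, and `words_le` applies with exponent 5. -/
theorem solvesWithin_of_wp {c : HL.Cmd} {C₀ B : ℕ} (hB : 1 ≤ B)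
    (hBL : B ≤ (encodeInput M G w s t).length ^ 5)
    (h : HL.wp (toCtx M G w s t) c (fun σ => σ.clock ≤ C₀ * B ∧
      (toInst M G w s t).IsAnswer σ.out) HL.St.init) :
    SolvesWithin c.compile M G w s t (timeConst c C₀ * B) := by
  obtain ⟨σ, hx, hcl, hans⟩ := h
  have hL : 0 < (encodeInput M G w s t).length := by
    rw [length_encodeInput]; omega
  obtain ⟨ρ, hρ, hrun⟩ := hx.compile_runs _ (toCtx_rel M G w s t) (toCtx_bounded M G w s t) le_rfl
  have hc0 : HL.St.init.clock = 0 := rfl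
  rw [hc0, Nat.sub_zero] at hrun
  have hT : c.cost * (σ.clock + 1) ≤ c.cost * (C₀ + 1) * B := by
    rw [mul_assoc]
    refine Nat.mul_le_mul_left _ ?_
    rw [add_mul]
    omega
  have hb : ∀ W : ℕ, weightBound G w ≤ W → ∀ z : ℤ,
      |z| ≤ c.wt * (toCtx M G w s t).bd σ.clock →
      |z| ≤ (c.wt * (C₀ + 6) * W * (encodeInput M G w s t).length ^ 5 : ℕ) := by
    intro W hW z hz
    refine hz.trans ?_
    have h1 := sizeBound_le M G w s t
    have h2 : C₀ * B ≤ C₀ * (encodeInput M G w s t).length ^ 5 := Nat.mul_le_mul_left _ hBL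
    have h3 : (toCtx M G w s t).bd σ.clock = (weightBound G w * (sizeBound M + σ.clock) : ℕ) := by
      simp [HL.Ctx.bd, toCtx]
    rw [h3]
    norm_cast
    rw [mul_assoc, mul_assoc, mul_comm (C₀ + 6), mul_assoc]
    refine Nat.mul_le_mul_left _ (Nat.mul_le_mul hW ?_)
    rw [mul_comm, add_mul]
    omega
  refine ⟨σ.out, isAnswer_of_toInst hans, ?_, fun W hW hw => ?_⟩
  -- The count of operations holds for every cost measure: it is used with measure 0 here and with
  -- word counts in the other case.
  · obtain ⟨T, h1, h2⟩ := hrun (fun _ => 0) 0 fun _ _ => le_rfl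
    refine ⟨ρ, T, h1, hρ.out, h2.trans ?_⟩
    rw [mul_zero, add_zero, mul_one]
    refine hT.trans (Nat.mul_le_mul_right _ ?_)
    unfold timeConst
    exact Nat.le_mul_of_pos_right _ (by omega)
  · obtain ⟨T, h1, h2⟩ := hrun (RAM.words (encodeInput M G w s t).length.size) _ fun z hz =>
      words_le hL hW (hb W (weightBound_le G w hW hw) z hz)
    refine ⟨ρ, T, h1, hρ.out, h2.trans ?_⟩
    have h3 : 1 ≤ Nat.log 2 (W + 1) := Nat.log_pos (by norm_num) (by omega)
    unfold timeConst
    set K := (c.wt * (C₀ + 6)).size + 5 + 3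
    calc c.cost * (σ.clock + 1) * (1 + 3 * (K * Nat.log 2 (W + 1)))
        ≤ c.cost * (C₀ + 1) * B * ((1 + 3 * K) * Nat.log 2 (W + 1)) := by
          refine Nat.mul_le_mul hT ?_
          have : (1 + 3 * K) * Nat.log 2 (W + 1) =
            Nat.log 2 (W + 1) + 3 * (K * Nat.log 2 (W + 1)) := by ring
          omega
      _ = _ := by ring

end bridge

/-! ### The three time bounds. -/

theorem mainTheorem2 :
    (∃ (c : RAM.Prog) (C : ℕ), ∀ (n : ℕ) (M : FinNFA n) (G : Digraph (Fin n))
      (w : Fin n → Fin n → ℤ) (s t : Fin n),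
        SolvesWithin c M G w s t (C * (M.size ^ 2 * n ^ 3))) ∧
    (∃ (c : RAM.Prog) (C : ℕ), ∀ (n : ℕ) (M : FinNFA n) (G : Digraph (Fin n))
      (w : Fin n → Fin n → ℤ) (s t : Fin n), (∀ u v, G.Adj u v → 0 ≤ w u v) →
        SolvesWithin c M G w s t (C * (M.size * Nat.log 2 (M.size + 1) * n ^ 2))) ∧
    (∃ (c : RAM.Prog) (C : ℕ), ∀ (n : ℕ) (M : FinNFA n) (G : Digraph (Fin n))
      (w : Fin n → Fin n → ℤ) (s t : Fin n), M.IsAcyclic →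
        SolvesWithin c M G w s t (C * (M.size * n ^ 2))) := by
  have facts : ∀ (n : ℕ) (M : FinNFA n) (G : Digraph (Fin n)) (w : Fin n → Fin n → ℤ)
      (s t : Fin n), 1 ≤ n ∧ 1 ≤ M.size ∧ n ≤ (encodeInput M G w s t).length ∧
        M.size ≤ (encodeInput M G w s t).length := by
    intro n M G w s t
    have h1 := M.start.2
    rw [length_encodeInput]
    refine ⟨s.pos, ?_, by nlinarith [Nat.zero_le n], ?_⟩ <;> unfold FinNFA.size <;> omega
  refine ⟨⟨HL.bellmanFord.compile, timeConst HL.bellmanFord 600, fun n M G w s t => ?_⟩,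
    ⟨HL.dijkstra.compile, timeConst HL.dijkstra 800, fun n M G w s t hw => ?_⟩,
    ⟨HL.kahn.compile, timeConst HL.kahn 200, fun n M G w s t hac => ?_⟩⟩
  all_goals
    obtain ⟨hn, hM, hnL, hML⟩ := facts n M G w s t
    set L := (encodeInput M G w s t).length with hL
  · refine solvesWithin_of_wp M G w s t (Nat.mul_pos (by positivity) (by positivity)) ?_
      (HL.wp_mono (HL.bellmanFord_spec (toCtx_enc M G w s t)) fun σ h => ⟨h.1.trans ?_, h.2⟩)
    · calc M.size ^ 2 * n ^ 3 ≤ L ^ 2 * L ^ 3 := by gcongr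
        _ = L ^ 5 := by ring
    · change 300 * (M.numStates * n * (1 + M.trans.length * n)) ≤ _
      have h1 : M.numStates ≤ M.size := Nat.le_add_right _ _
      have h2 : M.trans.length ≤ M.size := Nat.le_add_left _ _
      -- Absorbs the summand 1, which doubles the constant to 600; the estimate leaves a factor `n`
      -- to spare.
      have h3 : 1 ≤ M.size * n := Nat.mul_pos hM hn
      calc 300 * (M.numStates * n * (1 + M.trans.length * n))
          ≤ 300 * (M.size * n * (M.size * n + M.size * n)) := by gcongr
        _ = 600 * (M.size ^ 2 * (n ^ 2 * 1)) := by ring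
        _ ≤ 600 * (M.size ^ 2 * (n ^ 2 * n)) := by gcongr
        _ = _ := by ring
  · have hlog : 1 ≤ Nat.log 2 (M.size + 1) := Nat.log_pos (by norm_num) (by omega)
    have hlL : Nat.log 2 (M.size + 1) ≤ L :=
        (Nat.lt_succ_iff.1 (Nat.log_lt_self 2 (by omega))).trans hML
    -- The depth of the tree is bounded crudely, with `n` in place of the logarithm of `n`. The
    -- program needs only about `size * n` tree updates, so the other factor `n` of the claimed
    -- bound pays for this.
    have hN : (toInst M G w s t).N ≤ 2 ^ (Nat.log 2 (M.size + 1) + 1 + n) := by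
      change M.numStates * n ≤ _
      rw [pow_add]
      refine Nat.mul_le_mul ?_ Nat.lt_two_pow_self.le
      have h1 : M.numStates ≤ M.size := Nat.le_add_right _ _
      have := Nat.lt_pow_succ_log_self (b := 2) (by norm_num) (M.size + 1)
      omega
    refine solvesWithin_of_wp M G w s t (Nat.mul_pos (Nat.mul_pos hM hlog) (by positivity)) ?_
      (HL.wp_mono (HL.dijkstra_spec (toCtx_enc M G w s t) ?_ hN) fun σ h => ⟨h.1.trans ?_, h.2⟩)
    · calc M.size * Nat.log 2 (M.size + 1) * n ^ 2 ≤ L * L * L ^ 2 := by gcongr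
        _ = L ^ 4 := by ring
        _ ≤ L ^ 5 := Nat.pow_le_pow_right (by omega) (by norm_num)
    · intro v hv u hu hadj
      have := hw _ _ ((toInst_adj M G w s t ⟨v, hv⟩ ⟨u, hu⟩).1 hadj)
      rwa [← toInst_w M G w s t] at this
    · change 200 * ((M.numStates * n + M.trans.length * n) * _) ≤ _
      have h1 : M.numStates * n + M.trans.length * n = M.size * n := by
        unfold FinNFA.size; ring
      rw [h1]
      -- Each of the four summands is at most the product on the right, which turns 200 into 800.
      have h2 : Nat.log 2 (M.size + 1) + 1 + n + 1 ≤ 4 * (Nat.log 2 (M.size + 1) * n) := by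
        have h3 := Nat.le_mul_of_pos_right (Nat.log 2 (M.size + 1)) hn
        have h4 := Nat.le_mul_of_pos_left n hlog
        omega
      calc 200 * (M.size * n * (Nat.log 2 (M.size + 1) + 1 + n + 1))
          ≤ 200 * (M.size * n * (4 * (Nat.log 2 (M.size + 1) * n))) := by gcongr
        _ = _ := by ring
  · refine solvesWithin_of_wp M G w s t (Nat.mul_pos hM (by positivity)) ?_
      (HL.wp_mono (HL.kahn_spec (toCtx_enc M G w s t) (toInst_acyclic hac))
        fun σ h => ⟨h.1.trans ?_, h.2⟩)
    · calc M.size * n ^ 2 ≤ L * L ^ 2 := by gcongr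
        _ = L ^ 3 := by ring
        _ ≤ L ^ 5 := Nat.pow_le_pow_right (by omega) (by norm_num)
    · change 200 * (M.numStates * n + M.trans.length * n) ≤ _
      have h1 : M.numStates * n + M.trans.length * n = M.size * n := by
        unfold FinNFA.size; ring
      rw [h1]
      gcongr
      exact Nat.le_self_pow (by norm_num) n
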